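/- Let $r\ge 1$, let $a=(a_0,\dots,a_r)\in\mathbb R^{r+1}$ be non-zero, and let $U\subset\mathbb R^r$ be a non-empty open set with coordinates $w^0,\dots,w^{r-1}$. Let $\mathcal R=C^\infty(U)[w^{i,s}:0\le i<r,\ s\ge1]$ with $w^{i,0}=w^i$, and let $\partial_x=\sum_{i,\,s\ge0}w^{i,s+1}\,\partial/\partial w^{i,s}$ act coefficientwise on $\mathcal R[[\epsilon]]$. Let $\mathcal A\subset\mathcal R[[\epsilon]]$ be the set of series $\sum_d\epsilon^d f_d$ with $f_d$ homogeneous of degree $d$, where $\deg w^{i,s}=s$. Put $w^r=1$, and $w^k=a_k=0$ for $k<0$ and for $k>r$, and $$\hat A=\sum_{i=0}^r w^i\lambda^i,\qquad \hat a=\sum_{i=0}^r a_i\lambda^i,\qquad \mathcal D_k=2w^k\partial_x+w^k_x-\tfrac{\epsilon^2}2a_k\partial_x^3 .$$ Local multi-vectors are the elements of $\hat\Lambda=\hat{\mathcal A}/\partial_x\hat{\mathcal A}$, where $\hat{\mathcal A}=(\mathcal R\otimes_{\mathbb R}\bigwedge V)[[\epsilon]]$, $V$ is the real vector space with basis $\theta_i^s$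 ($0\le i<r$, $s\ge0$), $\theta_i=\theta_i^0$, and $\partial_x$ is extended as a derivation by $\partial_x\theta_i^s=\theta_i^{s+1}$; the class of $f$ is written $\int f\,dx$. Classes of elements of degree $0$ in $\theta$ are local functionals. The system $w^i_t=X^i$ is identified with the vector field $\int\sum_iX^i\theta_i\,dx$, and a matrix differential operator $J=(J^{ij})_{0\le i,j<r}$, $J^{ij}=\sum_s J^{ij}_s\partial_x^s$ (a finite sum), with $J+J^\dagger=0$ is identified with the bivector $\int-\frac12\sum_{i,j}\theta_iJ^{ij}(\theta_j)\,dx$. With $\frac{\delta}{\delta w^i}=\sum_s(-\partial_x)^s\frac{\partial}{\partial w^{i,s}}$ and $\frac{\delta}{\delta\theta_i}=\sum_s(-\partial_x)^s\frac{\partial}{\partial\theta_i^s}$ (left derivatives), the Schouten--Nijenhuis bracket of a $p$-vector $P$ with $Q$ is $$[P,Q]=\int\sum_{i=0}^{r-1}\Big(\frac{\delta P}{\delta\theta_i}\frac{\delta Q}{\delta w^i}+(-1)^p\frac{\delta P}{\delta w^i}\frac{\delta Q}{\delta\theta_i}\Big)dx .$$ $J$ is Hamiltonian if $J+J^\dagger=0$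 and its bivector $P$ satisfies $[P,P]=0$; two linearly independent Hamiltonian operators with bivectors $P$, $Q$ are compatible if $[P,Q]=0$. There is exactly one series $b=1+\sum_{k\ge1}b_k\lambda^{-k}$ with $b_k\in\mathcal A$ and $$\hat A b^2-\tfrac{\epsilon^2}4\hat a\,(2bb_{xx}-b_x^2)=\lambda^r. \tag{1}$$ If $w^0>0$ on $U$, there is exactly one series $c=\sum_{k\ge0}c_k\lambda^k$ with $c_k\in\mathcal A$ and $$\hat A c^2-\tfrac{\epsilon^2}4\hat a\,(2cc_{xx}-c_x^2)=1 \tag{2}$$ whose leading coefficient $c_0|_{\epsilon=0}$ is positive on $U$. For $n\ge 0$ let $B_n$ be the part $(\lambda^nb)_+$ of $\lambda^nb$ with powers $\lambda^j$, $j\ge0$, and let $H_n=\int2\operatorname{Res}_{\lambda=0}(\lambda^n/b)\,dx$. For $n<0$ let $B_n$ be the part $(\lambda^nc)_-$ of $\lambda^nc$ with powers $\lambda^j$, $j<0$, where $c$ is any solution of (2) with all $c_k\in\mathcal A$, and let $H_n=-\int2\operatorname{Res}_{\lambda=0}(\lambda^n/c)\,dx$. The residue is the coefficient of $\lambda^{-1}$.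 **Theorem.** For $m=0,\dots,r$ let $P_m$ be the matrix differential operator with entries $(P_m)^{ij}=f_m^{ij}\,\mathcal D_{i+j+1-m}$, $0\le i,j<r$, where $f_m^{ij}=1$ if $i,j<m$, $f_m^{ij}=-1$ if $i,j\ge m$, and $f_m^{ij}=0$ otherwise. The operators $P_0,\dots,P_r$ are linearly independent over $\mathbb R$, Hamiltonian, and pairwise compatible. For $n\ge0$, and for $n<0$ whenever a solution $c$ of (2) as above is given, there is a (necessarily unique) evolutionary system $X_n$, $w^i_{t_n}=X_n^i$, for which $$\hat A_{t_n}=2\hat A\,B_{n,x}+\hat A_x\,B_n-\tfrac{\epsilon^2}2\hat a\,B_{n,xxx}$$ holds identically in $\lambda$, and for all $m=0,\dots,r$ $$X_n=[P_{r-m},H_{n+m}]\quad(n\ge0),\qquad X_n=[P_m,H_{n-m}]\quad(n<0).$$ -/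

import Mathlib

open scoped TensorProduct ContDiff

noncomputable section

namespace RKdVCH

/-! ### Smooth functions on a coordinate domain -/

open Classical in
/-- Extension by zero of a function on an open set of `ℝ^r`. -/
def extendZero {r : ℕ} {U : TopologicalSpace.Opens (Fin r → ℝ)} (f : U → ℝ) : (Fin r → ℝ) → ℝ :=
  fun x => if h : x ∈ U then f ⟨x, h⟩ else 0

theorem extendZero_apply {r : ℕ} {U : TopologicalSpace.Opens (Fin r → ℝ)} (f : U → ℝ)
    {x : Fin r → ℝ} (h : x ∈ U) : extendZero f x = f ⟨x, h⟩ := dif_pos h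

theorem extendZero_contDiffOn_congr {r : ℕ} {U : TopologicalSpace.Opens (Fin r → ℝ)} {f : U → ℝ}
    {g : (Fin r → ℝ) → ℝ} (hg : ContDiffOn ℝ ∞ g U) (h : ∀ x : U, f x = g x) :
    ContDiffOn ℝ ∞ (extendZero f) U :=
  hg.congr fun x hx => by rw [extendZero_apply f hx, h ⟨x, hx⟩]

/-- The algebra `C^∞(U)`. -/
def Smooth {r : ℕ} (U : TopologicalSpace.Opens (Fin r → ℝ)) : Subalgebra ℝ (U → ℝ) where
  carrier := {f | ContDiffOn ℝ ∞ (extendZero f) U}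
  mul_mem' {f g} hf hg := extendZero_contDiffOn_congr (hf.mul hg) fun x => by
    simp [extendZero_apply _ x.2]
  add_mem' {f g} hf hg := extendZero_contDiffOn_congr (hf.add hg) fun x => by
    simp [extendZero_apply _ x.2]
  algebraMap_mem' c := extendZero_contDiffOn_congr (contDiffOn_const (c := c)) fun x => by simp

/-- The coordinate function `w ↦ w^i` on `U`. -/
def smoothCoord {r : ℕ} (U : TopologicalSpace.Opens (Fin r → ℝ)) (i : Fin r) : Smooth U :=
  ⟨fun x => x.1 i, extendZero_contDiffOn_congr (g := fun x => x i)
    (contDiff_apply ℝ ℝ i).contDiffOn fun _ => rfl⟩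

theorem smooth_contDiffAt {r : ℕ} {U : TopologicalSpace.Opens (Fin r → ℝ)} (f : Smooth U) {x : Fin r → ℝ}
    (hx : x ∈ U) : ContDiffAt ℝ ∞ (extendZero f.1) x :=
  f.2.contDiffAt (U.isOpen.mem_nhds hx)

theorem smooth_differentiableAt {r : ℕ} {U : TopologicalSpace.Opens (Fin r → ℝ)} (f : Smooth U)
    {x : Fin r → ℝ} (hx : x ∈ U) : DifferentiableAt ℝ (extendZero f.1) x :=
  (smooth_contDiffAt f hx).differentiableAt (by simp)

theorem extendZero_eventuallyEq {r : ℕ} {U : TopologicalSpace.Opens (Fin r → ℝ)} {f : U → ℝ}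
    {g : (Fin r → ℝ) → ℝ} (h : ∀ x : U, f x = g x) {x : Fin r → ℝ} (hx : x ∈ U) :
    extendZero f =ᶠ[nhds x] g := by
  filter_upwards [U.isOpen.mem_nhds hx] with y hy
  rw [extendZero_apply f hy, h ⟨y, hy⟩]

/-- The partial derivative `∂/∂w^i` on `C^∞(U)`, as a derivation. -/
def partialSmooth {r : ℕ} (U : TopologicalSpace.Opens (Fin r → ℝ)) (i : Fin r) :
    Derivation ℝ (Smooth U) (Smooth U) :=
  Derivation.mk'
    { toFun := fun f => ⟨fun x => fderiv ℝ (extendZero f.1) x (Pi.single i 1),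
        extendZero_contDiffOn_congr (g := fun x => fderiv ℝ (extendZero f.1) x (Pi.single i 1))
          ((f.2.fderiv_of_isOpen U.isOpen (by simp)).clm_apply contDiffOn_const) fun _ => rfl⟩
      map_add' := fun f g => by
        ext x
        have h : extendZero (f + g).1 =ᶠ[nhds x.1] extendZero f.1 + extendZero g.1 :=
          extendZero_eventuallyEq (fun y => by simp [extendZero_apply _ y.2]) x.2
        change fderiv ℝ (extendZero (f + g).1) x.1 (Pi.single i 1) = _
        rw [h.fderiv_eq, fderiv_add (smooth_differentiableAt f x.2) (smooth_differentiableAt g x.2)]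
        rfl
      map_smul' := fun c f => by
        ext x
        have h : extendZero (c • f).1 =ᶠ[nhds x.1] c • extendZero f.1 :=
          extendZero_eventuallyEq (fun y => by simp [extendZero_apply _ y.2]) x.2
        change fderiv ℝ (extendZero (c • f).1) x.1 (Pi.single i 1) = _
        rw [h.fderiv_eq, fderiv_const_smul (smooth_differentiableAt f x.2)]
        rfl }
    fun f g => by
      ext x
      have h : extendZero (f * g).1 =ᶠ[nhds x.1] extendZero f.1 * extendZero g.1 :=
        extendZero_eventuallyEq (fun y => by simp [extendZero_apply _ y.2]) x.2
      change fderiv ℝ (extendZero (f * g).1) x.1 (Pi.single i 1) =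
        f.1 x * fderiv ℝ (extendZero g.1) x.1 (Pi.single i 1)
          + g.1 x * fderiv ℝ (extendZero f.1) x.1 (Pi.single i 1)
      rw [h.fderiv_eq, fderiv_mul (smooth_differentiableAt f x.2) (smooth_differentiableAt g x.2)]
      simp [extendZero_apply _ x.2]

theorem partialSmooth_apply {r : ℕ} {U : TopologicalSpace.Opens (Fin r → ℝ)} (i : Fin r) (f : Smooth U)
    (x : U) : (partialSmooth U i f).1 x = fderiv ℝ (extendZero f.1) x (Pi.single i 1) := rfl

theorem two_le_infty : (2 : WithTop ℕ∞) ≤ ∞ :=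
  WithTop.coe_le_coe.2 (le_top : (2 : ℕ∞) ≤ ⊤)

theorem partialSmooth_comm {r : ℕ} {U : TopologicalSpace.Opens (Fin r → ℝ)} (i j : Fin r) (f : Smooth U) :
    partialSmooth U i (partialSmooth U j f) = partialSmooth U j (partialSmooth U i f) := by
  have key : ∀ (i j : Fin r) (x : U), (partialSmooth U i (partialSmooth U j f)).1 x
      = fderiv ℝ (fderiv ℝ (extendZero f.1)) x (Pi.single i 1) (Pi.single j 1) := by
    intro i j x
    have h : extendZero (partialSmooth U j f).1 =ᶠ[nhds x.1]
        fun y => fderiv ℝ (extendZero f.1) y (Pi.single j 1) :=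
      extendZero_eventuallyEq (fun y => partialSmooth_apply j f y) x.2
    have hd : DifferentiableAt ℝ (fderiv ℝ (extendZero f.1)) x.1 :=
      ((smooth_contDiffAt f x.2).fderiv_right (m := 1) (by rw [one_add_one_eq_two]; exact two_le_infty)).differentiableAt (by simp)
    rw [partialSmooth_apply, h.fderiv_eq, fderiv_clm_apply hd (by fun_prop)]
    simp
  ext x
  rw [key, key]
  exact ((smooth_contDiffAt f x.2).isSymmSndFDerivAt (by simpa using two_le_infty)).eq _ _

/-- `C^∞(U)` as a type of its own, with its structure of a commutative real algebra. -/
def SmoothFn {r : ℕ} (U : TopologicalSpace.Opens (Fin r → ℝ)) : Type := Smooth U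

instance {r : ℕ} (U : TopologicalSpace.Opens (Fin r → ℝ)) : CommRing (SmoothFn U) :=
  inferInstanceAs (CommRing (Smooth U))

instance {r : ℕ} (U : TopologicalSpace.Opens (Fin r → ℝ)) : Algebra ℝ (SmoothFn U) :=
  inferInstanceAs (Algebra ℝ (Smooth U))

/-- The value of a smooth function at a point. -/
def SmoothFn.eval {r : ℕ} {U : TopologicalSpace.Opens (Fin r → ℝ)} (f : SmoothFn U) (x : U) : ℝ :=
  Subtype.val (p := fun f => f ∈ Smooth U) f x

/-- The coordinate function `w ↦ w^i` on `U`. -/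
def coord {r : ℕ} (U : TopologicalSpace.Opens (Fin r → ℝ)) (i : Fin r) : SmoothFn U :=
  smoothCoord U i

/-- The partial derivative `∂/∂w^i` on `C^∞(U)`. -/
def partialFn {r : ℕ} (U : TopologicalSpace.Opens (Fin r → ℝ)) (i : Fin r) :
    Derivation ℝ (SmoothFn U) (SmoothFn U) :=
  partialSmooth U i

theorem partialFn_comm {r : ℕ} {U : TopologicalSpace.Opens (Fin r → ℝ)} (i j : Fin r)
    (f : SmoothFn U) : partialFn U i (partialFn U j f) = partialFn U j (partialFn U i f) :=
  partialSmooth_comm i j f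

/-! ### Differential polynomials -/

/-- The ring `C^∞(U)[w^{i,s} : 0 ≤ i < r, s ≥ 1]`. The variable with index `(i, s)` is the jet
coordinate `w^{i,s+1} = ∂_x^{s+1} w^i`. -/
abbrev DiffPoly {r : ℕ} (U : TopologicalSpace.Opens (Fin r → ℝ)) : Type :=
  MvPolynomial (Fin r × ℕ) (SmoothFn U)

/-- A derivation of the coefficient ring, applied to the coefficients of a polynomial. -/
def mapCoeffs {σ C : Type} [CommRing C] [Algebra ℝ C] (d : Derivation ℝ C C) :
    Derivation ℝ (MvPolynomial σ C) (MvPolynomial σ C) :=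
  Derivation.mk'
    { toFun := fun p => AddMonoidAlgebra.map (d : C →ₗ[ℝ] C).toAddMonoidHom p
      map_add' := fun p q => by ext m; simp
      map_smul' := fun c p => by ext m; simp }
    fun p q => by
      have hmon : ∀ m (c : C), (AddMonoidAlgebra.map (d : C →ₗ[ℝ] C).toAddMonoidHom
          (MvPolynomial.monomial m c) : MvPolynomial σ C) = MvPolynomial.monomial m (d c) :=
        fun m c => AddMonoidAlgebra.map_single _ _ _
      have hadd : ∀ p q : MvPolynomial σ C, (AddMonoidAlgebra.map (d : C →ₗ[ℝ] C).toAddMonoidHom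
          (p + q) : MvPolynomial σ C) = AddMonoidAlgebra.map (d : C →ₗ[ℝ] C).toAddMonoidHom p
            + AddMonoidAlgebra.map (d : C →ₗ[ℝ] C).toAddMonoidHom q := fun p q => by ext m; simp
      induction p using MvPolynomial.induction_on' with
      | add p p' hp hp' =>
        simp only [LinearMap.coe_mk, AddHom.coe_mk, smul_eq_mul, add_mul, mul_add, hadd] at *
        rw [hp, hp']; ring
      | monomial m c =>
        induction q using MvPolynomial.induction_on' with
        | add q q' hq hq' =>
          simp only [LinearMap.coe_mk, AddHom.coe_mk, smul_eq_mul, add_mul, mul_add, hadd] at *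
          rw [hq, hq']; ring
        | monomial n e =>
          simp only [LinearMap.coe_mk, AddHom.coe_mk, smul_eq_mul, hmon,
            MvPolynomial.monomial_mul, Derivation.leibniz, map_add]
          rw [add_comm n m, mul_comm e (d c)]

theorem mapCoeffs_monomial {σ C : Type} [CommRing C] [Algebra ℝ C] (d : Derivation ℝ C C)
    (m : σ →₀ ℕ) (c : C) :
    mapCoeffs d (MvPolynomial.monomial m c) = MvPolynomial.monomial m (d c) :=
  AddMonoidAlgebra.map_single _ _ _

theorem mapCoeffs_C {σ C : Type} [CommRing C] [Algebra ℝ C] (d : Derivation ℝ C C) (c : C) :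
    mapCoeffs d (MvPolynomial.C c : MvPolynomial σ C) = MvPolynomial.C (d c) :=
  mapCoeffs_monomial d 0 c

theorem mapCoeffs_X {σ C : Type} [CommRing C] [Algebra ℝ C] (d : Derivation ℝ C C) (i : σ) :
    mapCoeffs d (MvPolynomial.X i : MvPolynomial σ C) = 0 := by
  rw [MvPolynomial.X, mapCoeffs_monomial]; simp

/-- The partial derivative `∂/∂w^{i,s}` of differential polynomials, `s ≥ 0`, where
`w^{i,0} = w^i`. -/
def dw {r : ℕ} (U : TopologicalSpace.Opens (Fin r → ℝ)) (i : Fin r) :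
    ℕ → Derivation ℝ (DiffPoly U) (DiffPoly U)
  | 0 => mapCoeffs (partialFn U i)
  | s + 1 => (MvPolynomial.pderiv (i, s)).restrictScalars ℝ

/-- The total derivative `∂_x = ∑_{i, s ≥ 0} w^{i,s+1} ∂/∂w^{i,s}`. -/
def dx {r : ℕ} (U : TopologicalSpace.Opens (Fin r → ℝ)) :
    Derivation ℝ (DiffPoly U) (DiffPoly U) :=
  (∑ i : Fin r, (MvPolynomial.X (i, 0) : DiffPoly U) • dw U i 0)
    + (MvPolynomial.mkDerivation (SmoothFn U)
        fun q : Fin r × ℕ => (MvPolynomial.X (q.1, q.2 + 1) : DiffPoly U)).restrictScalars ℝ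

theorem derivation_ext {σ C : Type} [CommRing C] [Algebra ℝ C]
    {d e : Derivation ℝ (MvPolynomial σ C) (MvPolynomial σ C)}
    (hC : ∀ c, d (MvPolynomial.C c) = e (MvPolynomial.C c))
    (hX : ∀ i, d (MvPolynomial.X i) = e (MvPolynomial.X i)) : d = e := by
  ext p
  congr 1
  induction p using MvPolynomial.induction_on with
  | C c => exact hC c
  | add p q hp hq => rw [map_add, map_add, hp, hq]
  | mul_X p i hp => rw [Derivation.leibniz, Derivation.leibniz, hp, hX]

theorem derivation_sum_apply {C ι : Type} [CommRing C] [Algebra ℝ C] (t : Finset ι)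
    (d : ι → Derivation ℝ C C) (x : C) : (∑ i ∈ t, d i) x = ∑ i ∈ t, d i x := by
  classical
  induction t using Finset.induction_on with
  | empty => simp
  | insert i t hi ih => rw [Finset.sum_insert hi, Finset.sum_insert hi, Derivation.add_apply, ih]

theorem dx_C {r : ℕ} {U : TopologicalSpace.Opens (Fin r → ℝ)} (f : SmoothFn U) :
    dx U (MvPolynomial.C f)
      = ∑ i, MvPolynomial.X (i, 0) * MvPolynomial.C (partialFn U i f) := by
  simp [dx, dw, derivation_sum_apply, mapCoeffs_C]

theorem dx_X {r : ℕ} {U : TopologicalSpace.Opens (Fin r → ℝ)} (q : Fin r × ℕ) :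
    dx U (MvPolynomial.X q) = MvPolynomial.X (q.1, q.2 + 1) := by
  simp [dx, dw, derivation_sum_apply, mapCoeffs_X, MvPolynomial.mkDerivation_X]

theorem dw_zero_dx {r : ℕ} {U : TopologicalSpace.Opens (Fin r → ℝ)} (i : Fin r) (f : DiffPoly U) :
    dw U i 0 (dx U f) = dx U (dw U i 0 f) := by
  have h : ⁅dw U i 0, dx U⁆ = 0 := by
    apply derivation_ext
    · intro c
      simp only [Derivation.commutator_apply, dx_C, map_sum, dw, mapCoeffs_C, Derivation.leibniz,
        mapCoeffs_X, smul_eq_mul, mul_zero, add_zero, partialFn_comm i, Derivation.zero_apply,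
        sub_self]
    · intro q
      simp [Derivation.commutator_apply, dx_X, dw, mapCoeffs_X]
  simpa [Derivation.commutator_apply, sub_eq_zero] using congrArg (fun d => d f) h

theorem dw_succ_dx {r : ℕ} {U : TopologicalSpace.Opens (Fin r → ℝ)} (i : Fin r) (s : ℕ)
    (f : DiffPoly U) : dw U i (s + 1) (dx U f) = dx U (dw U i (s + 1) f) + dw U i s f := by
  have h : ⁅dw U i (s + 1), dx U⁆ = dw U i s := by
    apply derivation_ext
    · intro c
      simp only [Derivation.commutator_apply, dx_C, map_sum, dw, Derivation.leibniz,
        Derivation.restrictScalars_apply, MvPolynomial.pderiv_C, smul_zero, zero_add, map_zero,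
        sub_zero, smul_eq_mul, MvPolynomial.pderiv_X]
      cases s with
      | zero =>
        simp [dw, mapCoeffs_C, Pi.single_apply, Finset.sum_ite_eq]
      | succ s => simp [dw, Pi.single_apply]
    · intro q
      obtain ⟨j, t⟩ := q
      simp only [Derivation.commutator_apply, dx_X, dw, Derivation.restrictScalars_apply,
        MvPolynomial.pderiv_X]
      cases s with
      | zero => simp [dw, mapCoeffs_X, Pi.single_apply, apply_ite (dx U)]
      | succ s => simp [dw, MvPolynomial.pderiv_X, Pi.single_apply, apply_ite (dx U)]
  rw [← sub_eq_iff_eq_add', ← Derivation.commutator_apply, h]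

theorem dw_finite {r : ℕ} {U : TopologicalSpace.Opens (Fin r → ℝ)} (i : Fin r) (f : DiffPoly U) :
    {s | dw U i s f ≠ 0}.Finite := by
  refine (((f.vars.image fun q => q.2 + 1) ∪ {0} : Finset ℕ).finite_toSet).subset ?_
  intro s hs
  cases s with
  | zero => simp
  | succ s =>
    simp only [Finset.coe_union, Finset.coe_image, Finset.coe_singleton, Set.mem_union,
      Set.mem_image, Finset.mem_coe, Set.mem_singleton_iff]
    refine Or.inl ⟨(i, s), ?_, rfl⟩
    by_contra hn
    exact hs (MvPolynomial.pderiv_eq_zero_of_notMem_vars hn)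

/-! ### Exterior variables -/

/-- The exterior algebra of the real vector space with basis `θ_i^s`, `0 ≤ i < r`, `s ≥ 0`. -/
abbrev ThetaAlg (r : ℕ) : Type := ExteriorAlgebra ℝ (Fin r × ℕ →₀ ℝ)

/-- The generator `θ_i^s`. -/
def theta {r : ℕ} (i : Fin r) (s : ℕ) : ThetaAlg r :=
  ExteriorAlgebra.ι ℝ (Finsupp.single (i, s) 1)

/-- The derivative `∂/∂θ_i^s`, that is, left contraction with the dual basis vector. -/
def dtheta {r : ℕ} (i : Fin r) (s : ℕ) : ThetaAlg r →ₗ[ℝ] ThetaAlg r :=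
  CliffordAlgebra.contractLeft (Finsupp.lapply (i, s))

/-- The linear map `θ_i^s ↦ θ_i^{s+1}`. -/
def shift (r : ℕ) : (Fin r × ℕ →₀ ℝ) →ₗ[ℝ] (Fin r × ℕ →₀ ℝ) :=
  Finsupp.lmapDomain ℝ ℝ fun q => (q.1, q.2 + 1)

/-- The algebra map `x ↦ x + η δ(x)`, `η^2 = 0`, where `δ` is the even derivation that
extends `shift`. -/
def extShiftDual (r : ℕ) : ThetaAlg r →ₐ[ℝ] DualNumber (ThetaAlg r) :=
  ExteriorAlgebra.lift ℝ
    ⟨{ toFun := fun v => (ExteriorAlgebra.ι ℝ v, ExteriorAlgebra.ι ℝ (shift r v))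
       map_add' := fun v v' => by rw [map_add, map_add, map_add]; rfl
       map_smul' := fun c v => by rw [map_smul, map_smul, map_smul]; rfl },
     fun v => by
       refine TrivSqZeroExt.ext ?_ ?_
       · exact ExteriorAlgebra.ι_sq_zero v
       · exact ExteriorAlgebra.ι_add_mul_swap v (shift r v)⟩

/-- The derivation of the exterior algebra with `θ_i^s ↦ θ_i^{s+1}`. -/
def extShift (r : ℕ) : ThetaAlg r →ₗ[ℝ] ThetaAlg r :=
  (TrivSqZeroExt.sndHom (ThetaAlg r) (ThetaAlg r)).restrictScalars ℝ ∘ₗ (extShiftDual r).toLinearMap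

theorem extShiftDual_fst {r : ℕ} (x : ThetaAlg r) : (extShiftDual r x).fst = x := by
  have h : (TrivSqZeroExt.fstHom ℝ (ThetaAlg r) (ThetaAlg r)).comp (extShiftDual r) = AlgHom.id ℝ (ThetaAlg r) := by
    apply ExteriorAlgebra.hom_ext
    refine LinearMap.ext fun v => ?_
    change (extShiftDual r (ExteriorAlgebra.ι ℝ v)).fst = _
    rw [extShiftDual, ExteriorAlgebra.lift_ι_apply]
    rfl
  exact congrArg (fun g => g x) h

theorem extShift_mul {r : ℕ} (x y : ThetaAlg r) :
    extShift r (x * y) = extShift r x * y + x * extShift r y := by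
  change (extShiftDual r (x * y)).snd = (extShiftDual r x).snd * y + x * (extShiftDual r y).snd
  rw [map_mul, TrivSqZeroExt.snd_mul, extShiftDual_fst, extShiftDual_fst, add_comm]
  rfl

theorem extShift_ι {r : ℕ} (v : Fin r × ℕ →₀ ℝ) :
    extShift r (ExteriorAlgebra.ι ℝ v) = ExteriorAlgebra.ι ℝ (shift r v) := by
  change (extShiftDual r (ExteriorAlgebra.ι ℝ v)).snd = _
  rw [extShiftDual, ExteriorAlgebra.lift_ι_apply]
  rfl

theorem extShift_algebraMap {r : ℕ} (c : ℝ) : extShift r (algebraMap ℝ (ThetaAlg r) c) = 0 := by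
  change (extShiftDual r (algebraMap ℝ (ThetaAlg r) c)).snd = _
  rw [AlgHom.commutes]
  rfl

theorem extShift_theta {r : ℕ} (i : Fin r) (s : ℕ) :
    extShift r (theta i s) = theta i (s + 1) := by
  rw [theta, extShift_ι]; simp [shift, theta]

theorem dtheta_ι_mul {r : ℕ} (i : Fin r) (s : ℕ) (v : Fin r × ℕ →₀ ℝ) (x : ThetaAlg r) :
    dtheta i s (ExteriorAlgebra.ι ℝ v * x)
      = v (i, s) • x - ExteriorAlgebra.ι ℝ v * dtheta i s x :=
  CliffordAlgebra.contractLeft_ι_mul _ _ _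

theorem dtheta_algebraMap {r : ℕ} (i : Fin r) (s : ℕ) (c : ℝ) :
    dtheta i s (algebraMap ℝ (ThetaAlg r) c) = 0 :=
  CliffordAlgebra.contractLeft_algebraMap _ _ _

theorem ext_induction {r : ℕ} {p : ThetaAlg r → Prop} (h0 : ∀ c : ℝ, p (algebraMap ℝ (ThetaAlg r) c))
    (h1 : ∀ x y, p x → p y → p (x + y)) (h2 : ∀ x v, p x → p (ExteriorAlgebra.ι ℝ v * x))
    (x : ThetaAlg r) : p x :=
  CliffordAlgebra.left_induction _ h0 h1 h2 x

theorem shift_apply_zero {r : ℕ} (v : Fin r × ℕ →₀ ℝ) (i : Fin r) : shift r v (i, 0) = 0 := by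
  apply Finsupp.mapDomain_of_notMem_range
  rintro ⟨q, hq⟩
  simp at hq

theorem shift_apply_succ {r : ℕ} (v : Fin r × ℕ →₀ ℝ) (i : Fin r) (s : ℕ) :
    shift r v (i, s + 1) = v (i, s) :=
  Finsupp.mapDomain_apply (f := fun q : Fin r × ℕ => (q.1, q.2 + 1))
    (fun a b h => by simpa [Prod.ext_iff] using h) v (i, s)

theorem dtheta_zero_extShift {r : ℕ} (i : Fin r) (x : ThetaAlg r) :
    dtheta i 0 (extShift r x) = extShift r (dtheta i 0 x) := by
  induction x using ext_induction with
  | h0 c => simp [extShift_algebraMap, dtheta_algebraMap]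
  | h1 x y hx hy => simp only [map_add, hx, hy]
  | h2 x v hx =>
    simp only [extShift_mul, extShift_ι, map_add, map_sub, map_smul, dtheta_ι_mul,
      shift_apply_zero, hx, zero_smul]
    abel

theorem dtheta_succ_extShift {r : ℕ} (i : Fin r) (s : ℕ) (x : ThetaAlg r) :
    dtheta i (s + 1) (extShift r x) = extShift r (dtheta i (s + 1) x) + dtheta i s x := by
  induction x using ext_induction with
  | h0 c => simp [extShift_algebraMap, dtheta_algebraMap]
  | h1 x y hx hy => simp only [map_add, hx, hy]; abel
  | h2 x v hx =>
    simp only [extShift_mul, extShift_ι, map_add, map_sub, map_smul, dtheta_ι_mul,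
      shift_apply_succ, hx, mul_add]
    abel

theorem dtheta_finite {r : ℕ} (i : Fin r) (x : ThetaAlg r) : {s | dtheta i s x ≠ 0}.Finite := by
  induction x using ext_induction with
  | h0 c => simp [dtheta_algebraMap]
  | h1 x y hx hy =>
    refine (hx.union hy).subset fun s hs => ?_
    by_contra hn
    simp only [Set.mem_union, Set.mem_ofPred_eq, not_or, not_not] at hn
    exact hs (by rw [map_add, hn.1, hn.2, add_zero])
  | h2 x v hx =>
    refine (hx.union (v.support.image Prod.snd).finite_toSet).subset fun s hs => ?_
    by_contra hn
    simp only [Set.mem_union, Set.mem_ofPred_eq, not_or, not_not, Finset.coe_image, Set.mem_image,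
      Finset.mem_coe, Finsupp.mem_support_iff] at hn
    refine hs ?_
    have hv : v (i, s) = 0 := by
      by_contra h
      exact hn.2 ⟨(i, s), h, rfl⟩
    rw [dtheta_ι_mul, hn.1, hv]
    simp

/-! ### Variational derivatives -/

/-- The operator `f ↦ ∑_{s ≥ 0} (-D)^s (E_s f)`, for a family `E` that is finite on each `f`. -/
def euler {M : Type} [AddCommGroup M] [Module ℝ M] (D : M →ₗ[ℝ] M) (E : ℕ → M →ₗ[ℝ] M)
    (hE : ∀ f, {s | E s f ≠ 0}.Finite) : M →ₗ[ℝ] M where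
  toFun f := ∑ᶠ s : ℕ, ((-D) ^ s) (E s f)
  map_add' f g := by
    simp only [map_add]
    refine finsum_add_distrib ((hE f).subset fun s hs h => hs ?_) ((hE g).subset fun s hs h => hs ?_)
      <;> simp [h]
  map_smul' c f := by
    simp only [map_smul, RingHom.id_apply]
    rw [smul_finsum' c ((hE f).subset fun s hs h => hs (by simp [h]))]

theorem euler_comp {M : Type} [AddCommGroup M] [Module ℝ M] {D : M →ₗ[ℝ] M} {E : ℕ → M →ₗ[ℝ] M}
    {hE : ∀ f, {s | E s f ≠ 0}.Finite} (h0 : ∀ f, E 0 (D f) = D (E 0 f))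
    (h1 : ∀ s f, E (s + 1) (D f) = D (E (s + 1) f) + E s f) (f : M) : euler D E hE (D f) = 0 := by
  obtain ⟨N, hN⟩ : ∃ N, ∀ s, N ≤ s → E s f = 0 := by
    obtain ⟨N, hN⟩ := (hE f).bddAbove
    refine ⟨N + 1, fun s hs => ?_⟩
    by_contra h
    have := hN h
    omega
  have hsum : ∀ n, ∑ s ∈ Finset.range (n + 1), ((-D) ^ s) (E s (D f))
      = ((-D) ^ n) (D (E n f)) := by
    intro n
    induction n with
    | zero => simp [h0]
    | succ n ih =>
      rw [Finset.sum_range_succ, ih, h1, map_add, pow_succ (-D) n]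
      simp
  change ∑ᶠ s : ℕ, ((-D) ^ s) (E s (D f)) = 0
  rw [finsum_eq_sum_of_support_subset (s := Finset.range (N + 1 + 1))]
  · rw [hsum, hN _ (by omega)]; simp
  · intro s hs
    by_contra hn
    simp only [Finset.coe_range, Set.mem_Iio, not_lt] at hn
    obtain ⟨t, rfl⟩ : ∃ t, s = t + 1 := ⟨s - 1, by omega⟩
    refine hs ?_
    simp only [h1, hN (t + 1) (by omega), hN t (by omega)]
    simp

/-- Differential polynomials with exterior variables `θ_i^s`. -/
abbrev SDiffPoly {r : ℕ} (U : TopologicalSpace.Opens (Fin r → ℝ)) : Type := DiffPoly U ⊗[ℝ] ThetaAlg r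

/-- The total derivative
`∂_x = ∑_{i, s} (w^{i,s+1} ∂/∂w^{i,s} + θ_i^{s+1} ∂/∂θ_i^s)`. -/
def sdx {r : ℕ} (U : TopologicalSpace.Opens (Fin r → ℝ)) : SDiffPoly U →ₗ[ℝ] SDiffPoly U :=
  LinearMap.rTensor (ThetaAlg r) (dx U : DiffPoly U →ₗ[ℝ] DiffPoly U)
    + LinearMap.lTensor (DiffPoly U) (extShift r)

/-- `∂/∂w^{i,s}` in the presence of exterior variables. -/
def sdw {r : ℕ} (U : TopologicalSpace.Opens (Fin r → ℝ)) (i : Fin r) (s : ℕ) :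
    SDiffPoly U →ₗ[ℝ] SDiffPoly U :=
  LinearMap.rTensor (ThetaAlg r) (dw U i s : DiffPoly U →ₗ[ℝ] DiffPoly U)

/-- `∂/∂θ_i^s` in the presence of jet variables. -/
def sdtheta {r : ℕ} (U : TopologicalSpace.Opens (Fin r → ℝ)) (i : Fin r) (s : ℕ) :
    SDiffPoly U →ₗ[ℝ] SDiffPoly U :=
  LinearMap.lTensor (DiffPoly U) (dtheta i s)

theorem tensor_finite {M N : Type} [AddCommGroup M] [Module ℝ M] [AddCommGroup N] [Module ℝ N]
    {E : ℕ → M ⊗[ℝ] N →ₗ[ℝ] M ⊗[ℝ] N} (h : ∀ x y, {s | E s (x ⊗ₜ y) ≠ 0}.Finite)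
    (f : M ⊗[ℝ] N) : {s | E s f ≠ 0}.Finite := by
  induction f using TensorProduct.induction_on with
  | zero => simp
  | tmul x y => exact h x y
  | add f g hf hg =>
    refine (hf.union hg).subset fun s hs => ?_
    by_contra hn
    simp only [Set.mem_union, Set.mem_ofPred_eq, not_or, not_not] at hn
    exact hs (by rw [map_add, hn.1, hn.2, add_zero])

theorem sdw_finite {r : ℕ} {U : TopologicalSpace.Opens (Fin r → ℝ)} (i : Fin r) (f : SDiffPoly U) :
    {s | sdw U i s f ≠ 0}.Finite :=
  tensor_finite (fun x y => (dw_finite i x).subset fun s hs h => hs (by simp [sdw, h])) f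

theorem sdtheta_finite {r : ℕ} {U : TopologicalSpace.Opens (Fin r → ℝ)} (i : Fin r)
    (f : SDiffPoly U) : {s | sdtheta U i s f ≠ 0}.Finite :=
  tensor_finite (fun x y => (dtheta_finite i y).subset fun s hs h => hs (by simp [sdtheta, h])) f

/-- `δ/δw^i = ∑_s (-∂_x)^s ∂/∂w^{i,s}`. -/
def varW {r : ℕ} (U : TopologicalSpace.Opens (Fin r → ℝ)) (i : Fin r) :
    SDiffPoly U →ₗ[ℝ] SDiffPoly U :=
  euler (sdx U) (sdw U i) (sdw_finite i)

/-- `δ/δθ_i = ∑_s (-∂_x)^s ∂/∂θ_i^s`. -/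
def varTheta {r : ℕ} (U : TopologicalSpace.Opens (Fin r → ℝ)) (i : Fin r) :
    SDiffPoly U →ₗ[ℝ] SDiffPoly U :=
  euler (sdx U) (sdtheta U i) (sdtheta_finite i)

theorem varW_sdx {r : ℕ} {U : TopologicalSpace.Opens (Fin r → ℝ)} (i : Fin r) (f : SDiffPoly U) :
    varW U i (sdx U f) = 0 := by
  refine euler_comp (fun f => ?_) (fun s f => ?_) f
  · induction f using TensorProduct.induction_on with
    | zero => simp
    | tmul x y => simp [sdx, sdw, dw_zero_dx]
    | add f g hf hg => simp only [map_add, hf, hg]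
  · induction f using TensorProduct.induction_on with
    | zero => simp
    | tmul x y => simp [sdx, sdw, dw_succ_dx, TensorProduct.add_tmul]; abel
    | add f g hf hg => simp only [map_add, hf, hg]; abel

theorem varTheta_sdx {r : ℕ} {U : TopologicalSpace.Opens (Fin r → ℝ)} (i : Fin r)
    (f : SDiffPoly U) : varTheta U i (sdx U f) = 0 := by
  refine euler_comp (fun f => ?_) (fun s f => ?_) f
  · induction f using TensorProduct.induction_on with
    | zero => simp
    | tmul x y => simp [sdx, sdtheta, dtheta_zero_extShift]
    | add f g hf hg => simp only [map_add, hf, hg]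
  · induction f using TensorProduct.induction_on with
    | zero => simp
    | tmul x y => simp [sdx, sdtheta, dtheta_succ_extShift, TensorProduct.tmul_add]; abel
    | add f g hf hg => simp only [map_add, hf, hg]; abel

/-! ### Series in `ε`, local functionals and local multi-vectors

The ring `DiffSeries U` consists of all power series in `ε` with differential polynomials as
coefficients; it is closed under `∂_x`. The series `∑ ε^d f_d` with `f_d` homogeneous of
differential degree `d` form the degreewise completion of `C^∞(U)[ε w^i_x, ε^2 w^i_xx, …]`. -/

/-- The ring `C^∞(U)[w^{i,s} : s ≥ 1][[ε]]`. -/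
abbrev DiffSeries {r : ℕ} (U : TopologicalSpace.Opens (Fin r → ℝ)) : Type :=
  PowerSeries (DiffPoly U)

/-- Series in `ε` with exterior variables. -/
abbrev SDiffSeries {r : ℕ} (U : TopologicalSpace.Opens (Fin r → ℝ)) : Type :=
  PowerSeries (SDiffPoly U)

/-- A real linear map, applied to each coefficient of a power series. -/
def coeffwise {R S : Type} [Ring R] [Algebra ℝ R] [Ring S] [Algebra ℝ S] (T : R →ₗ[ℝ] S) :
    PowerSeries R →ₗ[ℝ] PowerSeries S where
  toFun f := PowerSeries.mk fun d => T (PowerSeries.coeff d f)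
  map_add' f g := by ext d; simp
  map_smul' c f := by ext d; simp

theorem coeff_coeffwise {R S : Type} [Ring R] [Algebra ℝ R] [Ring S] [Algebra ℝ S]
    (T : R →ₗ[ℝ] S) (f : PowerSeries R) (d : ℕ) :
    PowerSeries.coeff d (coeffwise T f) = T (PowerSeries.coeff d f) := by
  simp [coeffwise]

/-- Membership in the completion of `C^∞(U)[ε w^i_x, ε^2 w^i_xx, …]`: the coefficient of `ε^d`
is homogeneous of degree `d`, where `w^{i,s}` has degree `s`. -/
def IsGraded {r : ℕ} {U : TopologicalSpace.Opens (Fin r → ℝ)} (f : DiffSeries U) : Prop :=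
  ∀ d, MvPolynomial.IsWeightedHomogeneous (fun q : Fin r × ℕ => q.2 + 1) (PowerSeries.coeff d f) d

/-- The parameter `ε`. -/
def eps {r : ℕ} (U : TopologicalSpace.Opens (Fin r → ℝ)) : DiffSeries U := PowerSeries.X

/-- The derivation `∂_x` on series in `ε`. -/
def Dx {r : ℕ} (U : TopologicalSpace.Opens (Fin r → ℝ)) : DiffSeries U →ₗ[ℝ] DiffSeries U :=
  coeffwise (dx U : DiffPoly U →ₗ[ℝ] DiffPoly U)

/-- The derivation `∂_x` on series in `ε` with exterior variables. -/
def SDx {r : ℕ} (U : TopologicalSpace.Opens (Fin r → ℝ)) : SDiffSeries U →ₗ[ℝ] SDiffSeries U :=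
  coeffwise (sdx U)

/-- The inclusion of series without exterior variables. -/
def incl {r : ℕ} (U : TopologicalSpace.Opens (Fin r → ℝ)) : DiffSeries U →ₗ[ℝ] SDiffSeries U :=
  coeffwise ((TensorProduct.mk ℝ (DiffPoly U) (ThetaAlg r)).flip 1)

/-- The element `θ_i^s`. -/
def thetaS {r : ℕ} (U : TopologicalSpace.Opens (Fin r → ℝ)) (i : Fin r) (s : ℕ) : SDiffSeries U :=
  PowerSeries.C ((1 : DiffPoly U) ⊗ₜ[ℝ] theta i s)

/-- The space of local multi-vectors: series with exterior variables modulo total `x`-derivatives.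
Its part of degree `0` in the exterior variables is the space of local functionals. -/
abbrev Multivector {r : ℕ} (U : TopologicalSpace.Opens (Fin r → ℝ)) : Type :=
  SDiffSeries U ⧸ LinearMap.range (SDx U)

/-- The projection `f ↦ ∫ f dx`. -/
def integral {r : ℕ} (U : TopologicalSpace.Opens (Fin r → ℝ)) :
    SDiffSeries U →ₗ[ℝ] Multivector U :=
  (LinearMap.range (SDx U)).mkQ

/-- `δ/δw^i` on local multi-vectors. -/
def deltaW {r : ℕ} (U : TopologicalSpace.Opens (Fin r → ℝ)) (i : Fin r) :
    Multivector U →ₗ[ℝ] SDiffSeries U :=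
  (LinearMap.range (SDx U)).liftQ (coeffwise (varW U i)) <| by
    rintro _ ⟨f, rfl⟩
    rw [LinearMap.mem_ker]
    ext1 d
    rw [coeff_coeffwise, SDx, coeff_coeffwise, varW_sdx, map_zero]

/-- `δ/δθ_i` on local multi-vectors. -/
def deltaTheta {r : ℕ} (U : TopologicalSpace.Opens (Fin r → ℝ)) (i : Fin r) :
    Multivector U →ₗ[ℝ] SDiffSeries U :=
  (LinearMap.range (SDx U)).liftQ (coeffwise (varTheta U i)) <| by
    rintro _ ⟨f, rfl⟩
    rw [LinearMap.mem_ker]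
    ext1 d
    rw [coeff_coeffwise, SDx, coeff_coeffwise, varTheta_sdx, map_zero]

/-- The Schouten-Nijenhuis bracket `[P, Q]` of a local `p`-vector `P` and a local
multi-vector `Q`. -/
def schouten {r : ℕ} {U : TopologicalSpace.Opens (Fin r → ℝ)} (p : ℕ) (P Q : Multivector U) :
    Multivector U :=
  integral U (∑ i : Fin r, (deltaTheta U i P * deltaW U i Q
    + (-1 : ℝ) ^ p • (deltaW U i P * deltaTheta U i Q)))

/-- The local functional `∫ h dx`. -/
def functional {r : ℕ} {U : TopologicalSpace.Opens (Fin r → ℝ)} (h : DiffSeries U) :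
    Multivector U :=
  integral U (incl U h)

/-- The local vector field `∫ ∑ X^i θ_i dx` of the evolutionary system `w^i_t = X^i`. -/
def vectorField {r : ℕ} {U : TopologicalSpace.Opens (Fin r → ℝ)} (X : Fin r → DiffSeries U) :
    Multivector U :=
  integral U (∑ i : Fin r, incl U (X i) * thetaS U i 0)

/-! ### Matrix differential operators -/

/-- Scalar differential operators `∑_s L_s ∂_x^s`, given by their coefficients. -/
abbrev DiffOp {r : ℕ} (U : TopologicalSpace.Opens (Fin r → ℝ)) : Type := ℕ →₀ DiffSeries U

/-- The action `f ↦ ∑_s L_s ∂_x^s f`. -/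
def DiffOp.apply {r : ℕ} {U : TopologicalSpace.Opens (Fin r → ℝ)} (L : DiffOp U)
    (f : DiffSeries U) : DiffSeries U :=
  L.sum fun s p => p * (Dx U ^ s) f

/-- The action `f ↦ ∑_s (-∂_x)^s (L_s f)` of the adjoint operator. -/
def DiffOp.adjointApply {r : ℕ} {U : TopologicalSpace.Opens (Fin r → ℝ)} (L : DiffOp U)
    (f : DiffSeries U) : DiffSeries U :=
  L.sum fun s p => ((-Dx U) ^ s) (p * f)

/-- Matrix differential operators `J = (J^{ij})`, `0 ≤ i, j < r`. -/
abbrev MatDiffOp {r : ℕ} (U : TopologicalSpace.Opens (Fin r → ℝ)) : Type :=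
  Fin r → Fin r → DiffOp U

/-- `J + J† = 0`, where `(J†)^{ij} = (J^{ji})†`. -/
def MatDiffOp.IsSkew {r : ℕ} {U : TopologicalSpace.Opens (Fin r → ℝ)} (J : MatDiffOp U) : Prop :=
  ∀ i j f, DiffOp.apply (J i j) f + DiffOp.adjointApply (J j i) f = 0

/-- The local bivector `∫ (-1/2) ∑_{i,j} θ_i J^{ij}(θ_j) dx` of a matrix differential
operator. -/
def MatDiffOp.bivector {r : ℕ} {U : TopologicalSpace.Opens (Fin r → ℝ)} (J : MatDiffOp U) :
    Multivector U :=
  integral U ((-1 / 2 : ℝ) • ∑ i : Fin r, ∑ j : Fin r,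
    (J i j).sum fun s p => thetaS U i 0 * (incl U p * thetaS U j s))

/-- A Hamiltonian operator: a skew-adjoint matrix differential operator whose bivector `P`
satisfies `[P, P] = 0`. -/
def MatDiffOp.IsHamiltonian {r : ℕ} {U : TopologicalSpace.Opens (Fin r → ℝ)} (J : MatDiffOp U) :
    Prop :=
  MatDiffOp.IsSkew J ∧ schouten 2 (MatDiffOp.bivector J) (MatDiffOp.bivector J) = 0

/-- Compatibility of two linearly independent Hamiltonian operators with bivectors `P` and `Q`:
`[P, Q] = 0`. -/
def MatDiffOp.AreCompatible {r : ℕ} {U : TopologicalSpace.Opens (Fin r → ℝ)} (J K : MatDiffOp U) :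
    Prop :=
  LinearIndependent ℝ ![J, K] ∧ MatDiffOp.IsHamiltonian J ∧ MatDiffOp.IsHamiltonian K ∧
    schouten 2 (MatDiffOp.bivector J) (MatDiffOp.bivector K) = 0

/-! ### The hierarchy -/

/-- `w^k` for an integer `k`: the coordinate for `0 ≤ k < r`, with `w^r = 1` and `w^k = 0` for
`k < 0` and for `k > r`. -/
def wI {r : ℕ} (U : TopologicalSpace.Opens (Fin r → ℝ)) (k : ℤ) : DiffSeries U :=
  if h : 0 ≤ k ∧ k < r then
    PowerSeries.C (MvPolynomial.C (coord U ⟨k.toNat, by omega⟩))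
  else if k = r then 1 else 0

/-- `a_k` for an integer `k`, with `a_k = 0` for `k < 0` and for `k > r`. -/
def aI {r : ℕ} (a : Fin (r + 1) → ℝ) (k : ℤ) : ℝ :=
  if h : 0 ≤ k ∧ k ≤ r then a ⟨k.toNat, by omega⟩ else 0

/-- The operator `𝒟_k = 2 w^k ∂_x + w^{k}_x - (ε^2/2) a_k ∂_x^3`. -/
def opD {r : ℕ} (U : TopologicalSpace.Opens (Fin r → ℝ)) (a : Fin (r + 1) → ℝ) (k : ℤ) :
    DiffOp U :=
  Finsupp.single 1 (2 * wI U k) + Finsupp.single 0 (Dx U (wI U k))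
    + Finsupp.single 3 ((-(aI a k) / 2) • eps U ^ 2)

/-- The expression `p y^2 - (ε^2/4) q (2 y y_xx - y_x^2)` for series `p`, `q`, `y` in a spectral
parameter. -/
def quad {r : ℕ} {U : TopologicalSpace.Opens (Fin r → ℝ)} (p q y : PowerSeries (DiffSeries U)) :
    PowerSeries (DiffSeries U) :=
  p * y ^ 2 - (1 / 4 : ℝ) • (PowerSeries.C (eps U ^ 2) * q *
    (2 * y * coeffwise (Dx U) (coeffwise (Dx U) y) - coeffwise (Dx U) y ^ 2))

/-- The series `b = 1 + b_1 λ⁻¹ + b_2 λ⁻² + …`, as a power series in `λ⁻¹`, solves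
`Â b^2 - (ε^2/4) â (2 b b_xx - b_x^2) = λ^r`, with `Â = ∑ w^i λ^i` and `â = ∑ a_i λ^i`. The
equation is written after multiplication by `λ^{-r}`. -/
def IsPositiveSeries {r : ℕ} {U : TopologicalSpace.Opens (Fin r → ℝ)} (a : Fin (r + 1) → ℝ)
    (b : PowerSeries (DiffSeries U)) : Prop :=
  (∀ k, IsGraded (PowerSeries.coeff k b)) ∧ PowerSeries.coeff 0 b = 1 ∧
    quad (∑ i ∈ Finset.range (r + 1), PowerSeries.monomial (r - i) (wI U i))
      (∑ i ∈ Finset.range (r + 1), PowerSeries.monomial (r - i) (aI a i • (1 : DiffSeries U))) b = 1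

/-- The series `c = c_0 + c_1 λ + c_2 λ^2 + …`, as a power series in `λ`, solves
`Â c^2 - (ε^2/4) â (2 c c_xx - c_x^2) = 1`. -/
def IsNegativeSeries {r : ℕ} {U : TopologicalSpace.Opens (Fin r → ℝ)} (a : Fin (r + 1) → ℝ)
    (c : PowerSeries (DiffSeries U)) : Prop :=
  (∀ k, IsGraded (PowerSeries.coeff k c)) ∧
    quad (∑ i ∈ Finset.range (r + 1), PowerSeries.monomial i (wI U i))
      (∑ i ∈ Finset.range (r + 1), PowerSeries.monomial i (aI a i • (1 : DiffSeries U))) c = 1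

/-- The leading coefficient of `c_0`, a function on `U`, is positive. -/
def HasPositiveLeadingTerm {r : ℕ} {U : TopologicalSpace.Opens (Fin r → ℝ)}
    (c : PowerSeries (DiffSeries U)) : Prop :=
  ∀ x : U, 0 < (MvPolynomial.coeff 0 (PowerSeries.coeff 0 (PowerSeries.coeff 0 c))).eval x

/-- The coefficient of `λ^j` in `B_n`, where `B_n = (λ^n b)_+` for `n ≥ 0` and
`B_n = (λ^n c)_-` for `n < 0`. -/
def laxB {r : ℕ} {U : TopologicalSpace.Opens (Fin r → ℝ)} (b c : PowerSeries (DiffSeries U))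
    (n j : ℤ) : DiffSeries U :=
  if 0 ≤ n then
    if 0 ≤ j ∧ j ≤ n then PowerSeries.coeff (n - j).toNat b else 0
  else
    if j < 0 ∧ n ≤ j then PowerSeries.coeff (j - n).toNat c else 0

/-- The coefficient of `λ^j` in `2 Â B_x + Â_x B - (ε^2/2) â B_xxx = (∑_k 𝒟_k λ^k) B`, for
`B = B_n`. -/
def laxCoeff {r : ℕ} {U : TopologicalSpace.Opens (Fin r → ℝ)} (a : Fin (r + 1) → ℝ)
    (b c : PowerSeries (DiffSeries U)) (n j : ℤ) : DiffSeries U :=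
  ∑ k ∈ Finset.range (r + 1), DiffOp.apply (opD U a k) (laxB b c n (j - k))

/-- `X` is the evolutionary system `w^i_t = X^i` that the compatibility condition
`Â_t = 2 Â B_x + Â_x B - (ε^2/2) â B_xxx` with `B = B_n` amounts to. Since
`Â_t = ∑_{0 ≤ i < r} X^i λ^i`, the coefficients of all other powers of `λ` have to vanish. There is at most one such `X`. -/
def IsFlow {r : ℕ} {U : TopologicalSpace.Opens (Fin r → ℝ)} (a : Fin (r + 1) → ℝ)
    (b c : PowerSeries (DiffSeries U)) (n : ℤ) (X : Fin r → DiffSeries U) : Prop :=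
  ∀ j : ℤ, laxCoeff a b c n j = if h : 0 ≤ j ∧ j < r then X ⟨j.toNat, by omega⟩ else 0

/-- The local functional `H_n`: the integral of `2 Res_{λ=0} λ^n / b` for `n ≥ 0` and of
`-2 Res_{λ=0} λ^n / c` for `n < 0`, where the residue is the coefficient of `λ⁻¹`. -/
def hamiltonian {r : ℕ} {U : TopologicalSpace.Opens (Fin r → ℝ)}
    (b c : PowerSeries (DiffSeries U)) (n : ℤ) : Multivector U :=
  if 0 ≤ n then functional (2 * PowerSeries.coeff (n + 1).toNat (Ring.inverse b))
  else functional (-(2 * PowerSeries.coeff (-1 - n).toNat (Ring.inverse c)))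

/-- The operator `P_m`, with entries `𝒟_{i+j+1-m}` for `i, j < m`, `-𝒟_{i+j+1-m}` for
`i, j ≥ m`, and `0` otherwise. -/
def hamOp {r : ℕ} (U : TopologicalSpace.Opens (Fin r → ℝ)) (a : Fin (r + 1) → ℝ) (m : ℕ) :
    MatDiffOp U := fun i j =>
  if (i : ℕ) < m ∧ (j : ℕ) < m then opD U a ((i : ℤ) + j + 1 - m)
  else if m ≤ (i : ℕ) ∧ m ≤ (j : ℕ) then -opD U a ((i : ℤ) + j + 1 - m)
  else 0

end RKdVCH

end

noncomputable section

namespace RKdVCH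

/-! ### Coefficientwise operators -/

/-! Everything rests on the generating operator `∑ 𝒟_k λ^k`, which sends `y` to `2 Â y_x + Â_x y -
(ε²/2) â y_xxx`.

Recursion. The `x`-derivative of the left side of (1) or (2) is the unknown series times its image
under this operator. Since the unknown is invertible, the operator annihilates it
(`sum_opD_coeffInt_eq_zero`): `∑_k 𝒟_k b_{l+k} = 0` for every `l`, and likewise for `c`. The
coefficient of `λ^j` in the flow equation is the partial sum over `k ≤ j` for `b`, or over `k > j`
for `c`. The vanishing of the full sum kills the coefficients outside `0 ≤ j < r`, so the flow
exists.

Gradients. Varying the quadratic equation and integrating by parts shows that the variational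
derivatives of the coefficients of `2/b` are coefficients of `b` itself: `δH_n/δw^i = b_{n+1-r+i}`,
and `-c_{-1-n-i}` for negative `n` (`truncEuler_inverse`, `deltaW_coeff_inverse`). Row `j` of `P_m`
applied to the gradient of `H_{n+r-m}` is then a sum of terms `𝒟_k b_{n-j+k}` with `k = i+j+1-m`.
For `j < m` the block gives the sum over `k ≤ j`; for `j ≥ m` it gives minus the sum over `k > j`.
By the recursion these agree, so all `r+1` operators produce the same flow (`sum_blockSign_smul`).

Brackets. `[P_m, P_n]` is the integral of `∑ G(j,p,q) 𝒟_k(θ_j) θ_p ∂_xθ_q`, where `k` depends only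
on `j+p+q` and `G` is built from products of two block signs. `G` is symmetric in all three indices
(`blockSign_jacobi_swap`), whereas modulo total derivatives the density is a sum of terms each odd
under exchanging two of the `θ`'s. Hence every bracket vanishes (`schouten_hamOp`).

The series. `b` and `c` are fixed points of an approximate Newton iteration, which contracts for the
total order in the spectral variable and `ε` because the differential part of the equation carries
`ε²` (`newtonStep_sub_mem`, `exists_quad_eq_one`). -/

theorem coeffwise_mul {R : Type} [Ring R] [Algebra ℝ R] {T : R →ₗ[ℝ] R}
    (hT : ∀ x y, T (x * y) = T x * y + x * T y) (f g : PowerSeries R) :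
    coeffwise T (f * g) = coeffwise T f * g + f * coeffwise T g := by
  ext d
  simp [coeff_coeffwise, PowerSeries.coeff_mul, hT, Finset.sum_add_distrib]

theorem coeffwise_C {R S : Type} [Ring R] [Algebra ℝ R] [Ring S] [Algebra ℝ S] (T : R →ₗ[ℝ] S)
    (x : R) : coeffwise T (PowerSeries.C x) = PowerSeries.C (T x) := by
  ext d
  rw [coeff_coeffwise, PowerSeries.coeff_C, PowerSeries.coeff_C]
  split_ifs <;> simp

theorem coeffwise_monomial {R S : Type} [Ring R] [Algebra ℝ R] [Ring S] [Algebra ℝ S]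
    (T : R →ₗ[ℝ] S) (n : ℕ) (x : R) :
    coeffwise T (PowerSeries.monomial n x) = PowerSeries.monomial n (T x) := by
  ext d
  rw [coeff_coeffwise, PowerSeries.coeff_monomial, PowerSeries.coeff_monomial]
  split_ifs <;> simp

theorem Dx_mul {r : ℕ} {U : TopologicalSpace.Opens (Fin r → ℝ)} (f g : DiffSeries U) :
    Dx U (f * g) = Dx U f * g + f * Dx U g :=
  coeffwise_mul (fun x y => by simp [Derivation.leibniz]; ring) f g

theorem coeff_smul_ser {R : Type} [Ring R] [Algebra ℝ R] (c : ℝ) (f : PowerSeries R) (d : ℕ) :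
    PowerSeries.coeff d (c • f) = c • PowerSeries.coeff d f := rfl

/-- A derivation, applied to each coefficient of a power series. -/
def coeffwiseDer {R : Type} [CommRing R] [Algebra ℝ R] (T : Derivation ℝ R R) :
    Derivation ℝ (PowerSeries R) (PowerSeries R) :=
  Derivation.mk' (coeffwise (T : R →ₗ[ℝ] R)) fun f g => by
    rw [coeffwise_mul fun x y => by simp [Derivation.leibniz]; ring, smul_eq_mul, smul_eq_mul]
    ring

theorem coeffwiseDer_apply {R : Type} [CommRing R] [Algebra ℝ R] (T : Derivation ℝ R R)
    (f : PowerSeries R) : coeffwiseDer T f = coeffwise (T : R →ₗ[ℝ] R) f := rfl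

theorem Dx_eps {r : ℕ} {U : TopologicalSpace.Opens (Fin r → ℝ)} : Dx U (eps U) = 0 := by
  rw [Dx, eps, PowerSeries.X_eq, coeffwise_monomial]
  simp

theorem Dx_eps_sq {r : ℕ} {U : TopologicalSpace.Opens (Fin r → ℝ)} : Dx U (eps U ^ 2) = 0 := by
  rw [pow_two, Dx_mul, Dx_eps]; simp

/-! ### The ring of series with exterior variables -/

theorem sdx_tmul {r : ℕ} {U : TopologicalSpace.Opens (Fin r → ℝ)} (f : DiffPoly U)
    (x : ThetaAlg r) : sdx U (f ⊗ₜ x) = dx U f ⊗ₜ x + f ⊗ₜ extShift r x := by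
  simp [sdx]

theorem sdx_mul {r : ℕ} {U : TopologicalSpace.Opens (Fin r → ℝ)} (f g : SDiffPoly U) :
    sdx U (f * g) = sdx U f * g + f * sdx U g := by
  induction f using TensorProduct.induction_on with
  | zero => simp
  | add f f' hf hf' => simp only [map_add, add_mul, hf, hf']; abel
  | tmul p x =>
    induction g using TensorProduct.induction_on with
    | zero => simp
    | add g g' hg hg' => simp only [map_add, mul_add, hg, hg']; abel
    | tmul q y =>
      simp only [sdx_tmul, Algebra.TensorProduct.tmul_mul_tmul, Derivation.leibniz, smul_eq_mul,
        extShift_mul, TensorProduct.add_tmul, TensorProduct.tmul_add, add_mul, mul_add]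
      rw [mul_comm q (dx U p)]
      abel

theorem SDx_mul {r : ℕ} {U : TopologicalSpace.Opens (Fin r → ℝ)} (f g : SDiffSeries U) :
    SDx U (f * g) = SDx U f * g + f * SDx U g :=
  coeffwise_mul sdx_mul f g

theorem coeff_incl {r : ℕ} {U : TopologicalSpace.Opens (Fin r → ℝ)} (f : DiffSeries U) (d : ℕ) :
    PowerSeries.coeff d (incl U f) = PowerSeries.coeff d f ⊗ₜ 1 := by
  simp [incl, coeff_coeffwise]

theorem incl_mul {r : ℕ} {U : TopologicalSpace.Opens (Fin r → ℝ)} (f g : DiffSeries U) :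
    incl U (f * g) = incl U f * incl U g := by
  ext d
  simp only [coeff_incl, PowerSeries.coeff_mul, TensorProduct.sum_tmul,
    Algebra.TensorProduct.tmul_mul_tmul, mul_one]

theorem incl_one {r : ℕ} {U : TopologicalSpace.Opens (Fin r → ℝ)} : incl U 1 = 1 := by
  rw [← map_one PowerSeries.C, incl, coeffwise_C]
  simp [← Algebra.TensorProduct.one_def]

theorem incl_commute {r : ℕ} {U : TopologicalSpace.Opens (Fin r → ℝ)} (f : DiffSeries U)
    (z : SDiffSeries U) : incl U f * z = z * incl U f := by
  have h : ∀ (p : DiffPoly U) (y : SDiffPoly U), p ⊗ₜ 1 * y = y * p ⊗ₜ 1 := by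
    intro p y
    induction y using TensorProduct.induction_on with
    | zero => simp
    | add y y' hy hy' => rw [mul_add, add_mul, hy, hy']
    | tmul q x => simp [mul_comm]
  ext d
  rw [PowerSeries.coeff_mul, PowerSeries.coeff_mul, ← Finset.Nat.sum_antidiagonal_swap]
  simp [coeff_incl, h]

theorem SDx_incl {r : ℕ} {U : TopologicalSpace.Opens (Fin r → ℝ)} (f : DiffSeries U) :
    SDx U (incl U f) = incl U (Dx U f) := by
  ext d
  rw [SDx, coeff_coeffwise, coeff_incl, coeff_incl, Dx, coeff_coeffwise, sdx_tmul,
    ← map_one (algebraMap ℝ (ThetaAlg r)), extShift_algebraMap]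
  simp

theorem SDx_thetaS {r : ℕ} {U : TopologicalSpace.Opens (Fin r → ℝ)} (i : Fin r) (s : ℕ) :
    SDx U (thetaS U i s) = thetaS U i (s + 1) := by
  rw [SDx, thetaS, coeffwise_C, sdx_tmul, extShift_theta]
  simp [thetaS]

theorem thetaS_mul_swap {r : ℕ} {U : TopologicalSpace.Opens (Fin r → ℝ)} (i j : Fin r) (s t : ℕ) :
    thetaS U i s * thetaS U j t = -(thetaS U j t * thetaS U i s) := by
  rw [thetaS, thetaS, ← map_mul, ← map_mul, ← map_neg]
  simp only [Algebra.TensorProduct.tmul_mul_tmul, mul_one, ← TensorProduct.tmul_neg]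
  congr 2
  exact eq_neg_of_add_eq_zero_left (ExteriorAlgebra.ι_add_mul_swap _ _)

/-! ### Variational derivatives of bivectors -/

theorem euler_eq_sum {M : Type} [AddCommGroup M] [Module ℝ M] (D : M →ₗ[ℝ] M) (E : ℕ → M →ₗ[ℝ] M)
    (hE : ∀ f, {s | E s f ≠ 0}.Finite) {f : M} {N : ℕ} (hN : ∀ s, N ≤ s → E s f = 0) :
    euler D E hE f = ∑ s ∈ Finset.range N, ((-D) ^ s) (E s f) := by
  change ∑ᶠ s : ℕ, ((-D) ^ s) (E s f) = _
  rw [finsum_eq_sum_of_support_subset]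
  intro s hs
  by_contra hn
  simp only [Finset.coe_range, Set.mem_Iio, not_lt] at hn
  exact hs (by simp [hN s hn])

theorem coeff_coeffwise_neg_pow {R : Type} [Ring R] [Algebra ℝ R] (T : R →ₗ[ℝ] R) (s : ℕ)
    (f : PowerSeries R) (d : ℕ) :
    PowerSeries.coeff d (((-coeffwise T) ^ s) f) = ((-T) ^ s) (PowerSeries.coeff d f) := by
  induction s generalizing f with
  | zero => simp
  | succ s ih => rw [pow_succ, pow_succ, Module.End.mul_apply, Module.End.mul_apply, ih]; simp [coeff_coeffwise]

theorem partialFn_coord {r : ℕ} {U : TopologicalSpace.Opens (Fin r → ℝ)} (i k : Fin r) :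
    partialFn U i (coord U k) = if k = i then 1 else 0 := by
  apply Subtype.ext
  funext x
  have h : extendZero (smoothCoord U k).1 =ᶠ[nhds x.1] fun y => y k :=
    extendZero_eventuallyEq (f := (smoothCoord U k).1) (g := fun y => y k) (fun y => rfl) x.2
  change fderiv ℝ (extendZero (smoothCoord U k).1) x.1 (Pi.single i 1) = _
  rw [h.fderiv_eq, (hasFDerivAt_apply (𝕜 := ℝ) k x.1).fderiv]
  by_cases hk : k = i
  · subst hk
    rw [if_pos rfl]
    simp only [ContinuousLinearMap.proj_apply, Pi.single_eq_same]
    rfl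
  · rw [if_neg hk]
    simp only [ContinuousLinearMap.proj_apply, Pi.single_eq_of_ne hk]
    rfl

theorem dw_coord {r : ℕ} {U : TopologicalSpace.Opens (Fin r → ℝ)} (i k : Fin r) (s : ℕ) :
    dw U i s (MvPolynomial.C (coord U k)) = if k = i ∧ s = 0 then 1 else 0 := by
  cases s with
  | zero =>
    rw [dw, mapCoeffs_C, partialFn_coord]
    split_ifs <;> simp_all
  | succ s => simp [dw]

theorem varW_coord {r : ℕ} {U : TopologicalSpace.Opens (Fin r → ℝ)} (i k : Fin r) (x : ThetaAlg r) :
    varW U i (MvPolynomial.C (coord U k) ⊗ₜ x) = if k = i then 1 ⊗ₜ x else 0 := by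
  rw [varW, euler_eq_sum (N := 1)]
  · rw [Finset.sum_range_one, sdw, LinearMap.rTensor_tmul, Derivation.coeFn_coe, dw_coord]
    split_ifs <;> simp_all
  · intro s hs
    rw [sdw, LinearMap.rTensor_tmul, Derivation.coeFn_coe, dw_coord, if_neg (by omega)]
    simp

theorem varW_one {r : ℕ} {U : TopologicalSpace.Opens (Fin r → ℝ)} (i : Fin r) (x : ThetaAlg r) :
    varW U i (1 ⊗ₜ x) = 0 := by
  rw [varW, euler_eq_sum (N := 0)]
  · simp
  · intro s _
    rw [sdw, LinearMap.rTensor_tmul, Derivation.coeFn_coe, Derivation.map_one_eq_zero]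
    simp

/-- `δ/δw^i` of a coordinate times an exterior expression with constant coefficients. -/
theorem coeffwise_varW_wI {r : ℕ} {U : TopologicalSpace.Opens (Fin r → ℝ)} (i : Fin r) (k : ℤ)
    (x : ThetaAlg r) :
    coeffwise (varW U i) (incl U (wI U k) * PowerSeries.C ((1 : DiffPoly U) ⊗ₜ[ℝ] x))
      = if k = i then PowerSeries.C ((1 : DiffPoly U) ⊗ₜ[ℝ] x) else 0 := by
  rw [wI]
  split_ifs with h1 h2 h2 h3 h3
  · rw [incl, coeffwise_C, ← map_mul, coeffwise_C]
    simp only [LinearMap.flip_apply, TensorProduct.mk_apply, Algebra.TensorProduct.tmul_mul_tmul,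
      one_mul, mul_one]
    rw [varW_coord, if_pos (Fin.ext (by simp [h2]))]
  · rw [incl, coeffwise_C, ← map_mul, coeffwise_C]
    simp only [LinearMap.flip_apply, TensorProduct.mk_apply, Algebra.TensorProduct.tmul_mul_tmul,
      one_mul, mul_one]
    rw [varW_coord, if_neg (by rw [Fin.ext_iff]; simp; omega), map_zero]
  · exact absurd h3 (by have := i.2; omega)
  · rw [incl_one, one_mul, coeffwise_C, varW_one, map_zero]
  · exact absurd h3 (by have := i.2; omega)
  · simp

theorem coeffwise_varW_const {r : ℕ} {U : TopologicalSpace.Opens (Fin r → ℝ)} (i : Fin r)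
    (c : ℝ) (x : ThetaAlg r) :
    coeffwise (varW U i) (incl U (c • eps U ^ 2) * PowerSeries.C ((1 : DiffPoly U) ⊗ₜ[ℝ] x)) = 0 := by
  ext d
  rw [coeff_coeffwise, PowerSeries.coeff_mul_C, coeff_incl, coeff_smul_ser, eps,
    PowerSeries.coeff_X_pow]
  split_ifs
  · rw [← TensorProduct.smul_tmul', smul_mul_assoc, Algebra.TensorProduct.tmul_mul_tmul, one_mul,
      one_mul, map_smul, varW_one, smul_zero, map_zero]
  · simp

theorem dtheta_theta_mul {r : ℕ} (i a b : Fin r) (s t : ℕ) :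
    dtheta i t (theta a 0 * theta b s)
      = (if i = a ∧ t = 0 then theta b s else 0) - (if i = b ∧ t = s then theta a 0 else 0) := by
  rw [theta, theta, dtheta_ι_mul, ← mul_one (ExteriorAlgebra.ι ℝ (Finsupp.single (b, s) 1)),
    dtheta_ι_mul, ← map_one (algebraMap ℝ (ThetaAlg r)), dtheta_algebraMap]
  simp only [Finsupp.single_apply, Prod.mk.injEq, map_one, mul_one, mul_zero, sub_zero, ite_smul,
    one_smul, zero_smul, mul_ite]
  congr 1
  · exact if_congr (by constructor <;> rintro ⟨rfl, rfl⟩ <;> simp) rfl rfl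
  · exact if_congr (by constructor <;> rintro ⟨rfl, rfl⟩ <;> simp) rfl rfl

/-- A left derivative passes the first `θ` at the cost of a sign before it meets the second one,
whose `s` derivatives are then moved by `(-∂_x)^s` onto the rest. -/
theorem coeffwise_varTheta_mul {r : ℕ} {U : TopologicalSpace.Opens (Fin r → ℝ)} (i a b : Fin r)
    (p : DiffSeries U) (s : ℕ) :
    coeffwise (varTheta U i) (thetaS U a 0 * (incl U p * thetaS U b s))
      = (if i = a then incl U p * thetaS U b s else 0)
        - (if i = b then ((-SDx U) ^ s) (incl U p * thetaS U a 0) else 0) := by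
  have h : ∀ p : DiffPoly U, varTheta U i (p ⊗ₜ (theta a 0 * theta b s))
      = (if i = a then p ⊗ₜ theta b s else 0)
        - (if i = b then ((-sdx U) ^ s) (p ⊗ₜ theta a 0) else 0) := by
    intro p
    rw [varTheta, euler_eq_sum (N := s + 1)]
    · simp only [sdtheta, LinearMap.lTensor_tmul, dtheta_theta_mul, TensorProduct.tmul_sub, map_sub,
        Finset.sum_sub_distrib]
      congr 1
      · rw [Finset.sum_eq_single 0]
        · split_ifs <;> simp_all
        · intro t _ ht
          simp [ht]
        · simp
      · rw [Finset.sum_eq_single s]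
        · split_ifs <;> simp_all
        · intro t _ ht
          simp [ht]
        · simp
    · intro t ht
      rw [sdtheta, LinearMap.lTensor_tmul, dtheta_theta_mul, if_neg (by omega), if_neg (by omega)]
      simp
  ext d
  rw [← mul_assoc, ← incl_commute, mul_assoc, coeff_coeffwise, map_sub]
  have h2 : ∀ (x : ThetaAlg r), PowerSeries.coeff d
      (incl U p * PowerSeries.C ((1 : DiffPoly U) ⊗ₜ[ℝ] x)) = PowerSeries.coeff d p ⊗ₜ x := by
    intro x
    rw [PowerSeries.coeff_mul_C, coeff_incl]
    simp
  rw [thetaS, thetaS, ← map_mul, Algebra.TensorProduct.tmul_mul_tmul, mul_one, h2, h,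
    apply_ite (PowerSeries.coeff d), apply_ite (PowerSeries.coeff d), SDx, coeff_coeffwise_neg_pow,
    h2, h2, map_zero]

theorem coeffwise_varTheta_incl {r : ℕ} {U : TopologicalSpace.Opens (Fin r → ℝ)} (i : Fin r)
    (p : DiffSeries U) : coeffwise (varTheta U i) (incl U p) = 0 := by
  ext d
  rw [coeff_coeffwise, coeff_incl, varTheta, euler_eq_sum (N := 0)]
  · simp
  · intro s _
    rw [sdtheta, LinearMap.lTensor_tmul, ← map_one (algebraMap ℝ (ThetaAlg r)), dtheta_algebraMap]
    simp

/-! ### The bivectors of the operators `P_m` -/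

/-- The sign pattern `f_m^{ij}`, for arbitrary integer indices. -/
def blockSign (m i j : ℤ) : ℝ := if i < m ∧ j < m then 1 else if m ≤ i ∧ m ≤ j then -1 else 0

theorem blockSign_comm (m i j : ℤ) : blockSign m i j = blockSign m j i := by
  simp only [blockSign, and_comm]

/-- With the sign as a scalar factor, all three cases of the block pattern are handled by the same
computation with `𝒟_k`. -/
theorem hamOp_eq_smul {r : ℕ} (U : TopologicalSpace.Opens (Fin r → ℝ)) (a : Fin (r + 1) → ℝ) (m : ℕ)
    (i j : Fin r) :
    hamOp U a m i j = blockSign m i j • opD U a ((i : ℤ) + j + 1 - m) := by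
  simp only [hamOp, blockSign, Nat.cast_lt, Nat.cast_le]
  split_ifs <;> simp

/-- The coefficient `-(ε^2/2) a_k` of `∂_x^3` in `𝒟_k`. -/
def cubicCoeff {r : ℕ} (U : TopologicalSpace.Opens (Fin r → ℝ)) (a : Fin (r + 1) → ℝ) (k : ℤ) :
    DiffSeries U := (-(aI a k) / 2) • eps U ^ 2

theorem Dx_cubicCoeff {r : ℕ} {U : TopologicalSpace.Opens (Fin r → ℝ)} (a : Fin (r + 1) → ℝ) (k : ℤ) :
    Dx U (cubicCoeff U a k) = 0 := by
  rw [cubicCoeff, map_smul, Dx_eps_sq, smul_zero]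

/-- The bivector, the action and the adjoint action all sum a linear expression over the
coefficients of an operator; stating this for general `g` serves all three. -/
theorem opD_sum {r : ℕ} {U : TopologicalSpace.Opens (Fin r → ℝ)} (a : Fin (r + 1) → ℝ) (k : ℤ)
    {M : Type} [AddCommGroup M] [Module ℝ M] (c : ℝ) (g : ℕ → DiffSeries U →ₗ[ℝ] M) :
    (c • opD U a k).sum (fun s p => g s p)
      = c • (g 1 (2 * wI U k) + g 0 (Dx U (wI U k)) + g 3 (cubicCoeff U a k)) := by
  rw [Finsupp.sum_smul_index' (by simp)]
  simp only [map_smul]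
  rw [← Finsupp.smul_sum, opD, Finsupp.sum_add_index' (by simp) (by simp),
    Finsupp.sum_add_index' (by simp) (by simp), Finsupp.sum_single_index (by simp),
    Finsupp.sum_single_index (by simp), Finsupp.sum_single_index (by simp)]
  rfl

/-- The action of `𝒟_k` on series with exterior variables. -/
def opAct {r : ℕ} (U : TopologicalSpace.Opens (Fin r → ℝ)) (a : Fin (r + 1) → ℝ) (k : ℤ)
    (z : SDiffSeries U) : SDiffSeries U :=
  (2 : ℝ) • (incl U (wI U k) * SDx U z) + incl U (Dx U (wI U k)) * z
    + incl U (cubicCoeff U a k) * SDx U (SDx U (SDx U z))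

theorem incl_two_mul {r : ℕ} {U : TopologicalSpace.Opens (Fin r → ℝ)} (f : DiffSeries U) :
    incl U (2 * f) = (2 : ℝ) • incl U f := by
  rw [two_mul, map_add, two_smul]

/-- `𝒟_k` is skew-adjoint because `2w∂_x + w_x = w∂_x + ∂_x w` and the coefficient of `∂_x^3` is
constant in `x`. -/
theorem opAct_skew {r : ℕ} {U : TopologicalSpace.Opens (Fin r → ℝ)} (a : Fin (r + 1) → ℝ) (k : ℤ)
    (z : SDiffSeries U) :
    ((-SDx U) ^ 1) (incl U (2 * wI U k) * z) + ((-SDx U) ^ 0) (incl U (Dx U (wI U k)) * z)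
      + ((-SDx U) ^ 3) (incl U (cubicCoeff U a k) * z) = -opAct U a k z := by
  simp only [opAct, pow_succ, pow_zero, one_mul, Module.End.mul_apply, LinearMap.neg_apply, map_neg,
    neg_neg, SDx_mul, SDx_incl, Dx_cubicCoeff, two_mul, two_smul, map_add, map_zero, zero_mul,
    Module.End.one_apply, zero_add, add_mul]
  abel

theorem opAct_thetaS {r : ℕ} {U : TopologicalSpace.Opens (Fin r → ℝ)} (a : Fin (r + 1) → ℝ) (k : ℤ)
    (j : Fin r) :
    opAct U a k (thetaS U j 0) = (2 : ℝ) • (incl U (wI U k) * thetaS U j 1)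
      + incl U (Dx U (wI U k)) * thetaS U j 0 + incl U (cubicCoeff U a k) * thetaS U j 3 := by
  simp only [opAct, SDx_thetaS, Nat.reduceAdd]

theorem bivector_hamOp {r : ℕ} {U : TopologicalSpace.Opens (Fin r → ℝ)} (a : Fin (r + 1) → ℝ)
    (m : ℕ) :
    MatDiffOp.bivector (hamOp U a m) = integral U ((-1 / 2 : ℝ) • ∑ i : Fin r, ∑ j : Fin r,
      blockSign m i j • (thetaS U i 0 * (incl U (2 * wI U ((i : ℤ) + j + 1 - m)) * thetaS U j 1)
        + thetaS U i 0 * (incl U (Dx U (wI U ((i : ℤ) + j + 1 - m))) * thetaS U j 0)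
        + thetaS U i 0 * (incl U (cubicCoeff U a ((i : ℤ) + j + 1 - m)) * thetaS U j 3))) := by
  rw [MatDiffOp.bivector]
  congr 3
  funext i
  congr 1
  funext j
  rw [hamOp_eq_smul]
  exact opD_sum a _ _ fun s =>
    { toFun := fun p => thetaS U i 0 * (incl U p * thetaS U j s)
      map_add' := fun p q => by rw [map_add, add_mul, mul_add]
      map_smul' := fun c p => by
        rw [map_smul, smul_mul_assoc, mul_smul_comm, RingHom.id_apply] }

/-- Both `θ` slots of the bivector contribute equally, by skew-adjointness of `𝒟_k` and symmetry of
the matrix in its two indices; this cancels the factor `1/2`. -/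
theorem deltaTheta_bivector {r : ℕ} {U : TopologicalSpace.Opens (Fin r → ℝ)} (a : Fin (r + 1) → ℝ)
    (m : ℕ) (i : Fin r) :
    deltaTheta U i (MatDiffOp.bivector (hamOp U a m)) =
      -∑ j : Fin r, blockSign m i j • opAct U a ((i : ℤ) + j + 1 - m) (thetaS U j 0) := by
  rw [bivector_hamOp]
  change coeffwise (varTheta U i) _ = _
  have key : ∀ p q : Fin r, coeffwise (varTheta U i)
      (thetaS U p 0 * (incl U (2 * wI U ((p : ℤ) + q + 1 - m)) * thetaS U q 1)
        + thetaS U p 0 * (incl U (Dx U (wI U ((p : ℤ) + q + 1 - m))) * thetaS U q 0)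
        + thetaS U p 0 * (incl U (cubicCoeff U a ((p : ℤ) + q + 1 - m)) * thetaS U q 3))
      = (if i = p then opAct U a ((p : ℤ) + q + 1 - m) (thetaS U q 0) else 0)
        + (if i = q then opAct U a ((p : ℤ) + q + 1 - m) (thetaS U p 0) else 0) := by
    intro p q
    simp only [map_add, coeffwise_varTheta_mul]
    have e1 := opAct_skew (U := U) a ((p : ℤ) + q + 1 - m) (thetaS U p 0)
    have e2 := opAct_thetaS (U := U) a ((p : ℤ) + q + 1 - m) q
    rw [← smul_mul_assoc, ← incl_two_mul] at e2
    rw [neg_eq_iff_eq_neg.1 e1.symm, e2]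
    split_ifs <;> abel
  simp only [map_smul, map_sum, key]
  simp only [smul_add, Finset.sum_add_distrib, smul_ite, smul_zero]
  have e1 : ∀ (g : Fin r → Fin r → SDiffSeries U),
      ∑ p, ∑ q, (if i = p then g p q else 0) = ∑ q, g i q := by
    intro g
    rw [Finset.sum_comm]
    simp
  have e2 : ∀ (g : Fin r → Fin r → SDiffSeries U),
      ∑ p, ∑ q, (if i = q then g p q else 0) = ∑ p, g p i := by
    intro g
    simp
  rw [e1 fun p q => _, e2 fun p q => _]
  have e3 : ∀ p : Fin r, blockSign m p i • opAct U a ((p : ℤ) + i + 1 - m) (thetaS U p 0)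
      = blockSign m i p • opAct U a ((i : ℤ) + p + 1 - m) (thetaS U p 0) := by
    intro p
    rw [blockSign_comm, add_comm (p : ℤ)]
  simp only [e3, ← add_smul]
  norm_num

theorem thetaS_mul {r : ℕ} {U : TopologicalSpace.Opens (Fin r → ℝ)} (i j : Fin r) (s t : ℕ) :
    thetaS U i s * thetaS U j t = PowerSeries.C ((1 : DiffPoly U) ⊗ₜ[ℝ] (theta i s * theta j t)) := by
  rw [thetaS, thetaS, ← map_mul, Algebra.TensorProduct.tmul_mul_tmul, mul_one]

theorem deltaW_bivector {r : ℕ} {U : TopologicalSpace.Opens (Fin r → ℝ)} (a : Fin (r + 1) → ℝ)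
    (m : ℕ) (i : Fin r) :
    deltaW U i (MatDiffOp.bivector (hamOp U a m)) =
      -∑ p : Fin r, ∑ q : Fin r, if (p : ℤ) + q + 1 - m = i then
        blockSign m p q • (thetaS U p 0 * thetaS U q 1) else 0 := by
  rw [bivector_hamOp]
  change coeffwise (varW U i) _ = _
  have key : ∀ p q : Fin r, coeffwise (varW U i)
      (thetaS U p 0 * (incl U (2 * wI U ((p : ℤ) + q + 1 - m)) * thetaS U q 1)
        + thetaS U p 0 * (incl U (Dx U (wI U ((p : ℤ) + q + 1 - m))) * thetaS U q 0)
        + thetaS U p 0 * (incl U (cubicCoeff U a ((p : ℤ) + q + 1 - m)) * thetaS U q 3))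
      = (if (p : ℤ) + q + 1 - m = i then thetaS U p 0 * thetaS U q 1 else 0)
        + (if (p : ℤ) + q + 1 - m = i then thetaS U q 0 * thetaS U p 1 else 0) := by
    intro p q
    generalize (p : ℤ) + q + 1 - m = k
    have hS : ∀ z, coeffwise (varW U i) (SDx U z) = 0 := by
      intro z
      ext1 d
      rw [coeff_coeffwise, SDx, coeff_coeffwise, varW_sdx, map_zero]
    -- Up to a total derivative, which `δ/δw^i` kills, the density contains `w^k` only
    -- undifferentiated, so the variational derivative becomes an ordinary one.
    have h : thetaS U p 0 * (incl U (2 * wI U k) * thetaS U q 1)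
        + thetaS U p 0 * (incl U (Dx U (wI U k)) * thetaS U q 0)
        + thetaS U p 0 * (incl U (cubicCoeff U a k) * thetaS U q 3)
        = SDx U (incl U (wI U k) * (thetaS U p 0 * thetaS U q 0))
          + incl U (wI U k) * (thetaS U p 0 * thetaS U q 1)
          + incl U (wI U k) * (thetaS U q 0 * thetaS U p 1)
          + incl U (cubicCoeff U a k) * (thetaS U p 0 * thetaS U q 3) := by
      have hc : ∀ f s, thetaS U p 0 * (incl U f * thetaS U q s)
          = incl U f * (thetaS U p 0 * thetaS U q s) := by
        intro f s
        rw [← mul_assoc, ← incl_commute, mul_assoc]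
      rw [hc, hc, hc, SDx_mul, SDx_mul, SDx_incl, SDx_thetaS, SDx_thetaS, thetaS_mul_swap q p 0 1,
        incl_two_mul, smul_mul_assoc, two_smul]
      have hn : ∀ f g : SDiffSeries U, f * -g = -(f * g) := fun f g => mul_neg f g
      simp only [mul_add, hn, zero_add]
      abel
    rw [h]
    simp only [map_add, hS, thetaS_mul, coeffwise_varW_wI, cubicCoeff, coeffwise_varW_const,
      zero_add, add_zero]
  simp only [map_smul, map_sum, key]
  simp only [smul_add, Finset.sum_add_distrib, smul_ite, smul_zero]
  have hswap : (∑ p : Fin r, ∑ q : Fin r, if (p : ℤ) + q + 1 - m = i then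
        blockSign m p q • (thetaS U q 0 * thetaS U p 1) else 0)
      = ∑ p : Fin r, ∑ q : Fin r, if (p : ℤ) + q + 1 - m = i then
        blockSign m p q • (thetaS U p 0 * thetaS U q 1) else 0 := by
    rw [Finset.sum_comm]
    refine Finset.sum_congr rfl fun q _ => Finset.sum_congr rfl fun p _ => ?_
    rw [blockSign_comm, add_comm (p : ℤ)]
  rw [hswap, ← add_smul]
  norm_num

theorem deltaTheta_functional {r : ℕ} {U : TopologicalSpace.Opens (Fin r → ℝ)} (i : Fin r)
    (h : DiffSeries U) : deltaTheta U i (functional h) = 0 :=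
  coeffwise_varTheta_incl i h

/-! ### Skew-adjointness -/

theorem opD_apply {r : ℕ} {U : TopologicalSpace.Opens (Fin r → ℝ)} (a : Fin (r + 1) → ℝ) (k : ℤ)
    (c : ℝ) (f : DiffSeries U) :
    DiffOp.apply (c • opD U a k) f = c • (2 * wI U k * Dx U f + Dx U (wI U k) * f
      + cubicCoeff U a k * Dx U (Dx U (Dx U f))) := by
  have := opD_sum (U := U) a k c fun s =>
    { toFun := fun p => p * (Dx U ^ s) f
      map_add' := fun p q => by rw [add_mul]
      map_smul' := fun c p => by rw [smul_mul_assoc, RingHom.id_apply] }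
  rw [DiffOp.apply]
  refine this.trans ?_
  simp [pow_succ]

theorem opD_adjointApply {r : ℕ} {U : TopologicalSpace.Opens (Fin r → ℝ)} (a : Fin (r + 1) → ℝ)
    (k : ℤ) (c : ℝ) (f : DiffSeries U) :
    DiffOp.adjointApply (c • opD U a k) f = c • (-Dx U (2 * wI U k * f) + Dx U (wI U k) * f
      + -Dx U (Dx U (Dx U (cubicCoeff U a k * f)))) := by
  have := opD_sum (U := U) a k c fun s =>
    { toFun := fun p => ((-Dx U) ^ s) (p * f)
      map_add' := fun p q => by rw [add_mul, map_add]
      map_smul' := fun c p => by rw [smul_mul_assoc, map_smul, RingHom.id_apply] }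
  rw [DiffOp.adjointApply]
  refine this.trans ?_
  simp [pow_succ]

theorem hamOp_isSkew {r : ℕ} {U : TopologicalSpace.Opens (Fin r → ℝ)} (a : Fin (r + 1) → ℝ)
    (m : ℕ) : MatDiffOp.IsSkew (hamOp U a m) := by
  intro i j f
  rw [hamOp_eq_smul, hamOp_eq_smul, blockSign_comm m j i, add_comm (j : ℤ), opD_apply,
    opD_adjointApply, ← smul_add]
  simp only [Dx_mul, Dx_cubicCoeff, two_mul, map_add, zero_mul, zero_add, add_mul]
  convert smul_zero _
  ring

/-! ### Jacobi identity and compatibility -/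

/-- The positions of `p` and `q` relative to `m` and `n` may leave open on which side of `m` the
index `p+q+1-n` lies. But `p+q+1-n < m` holds exactly when `p+q+1-m < n`, so the same alternative
governs both terms and they compensate. The rest is a check of cases. Together with the symmetry in
`p, q` this exchange generates all permutations of `j, p, q`. -/
theorem blockSign_jacobi_swap (m n j p q : ℤ) :
    blockSign m (p + q + 1 - n) j * blockSign n p q + blockSign n (p + q + 1 - m) j * blockSign m p q
      = blockSign m (j + q + 1 - n) p * blockSign n j q
        + blockSign n (j + q + 1 - m) p * blockSign m j q := by
  wlog h : m ≤ n generalizing m n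
  · rw [add_comm, this n m (le_of_not_ge h), add_comm]
  unfold blockSign
  rcases lt_or_ge j m with hj | hj <;> rcases lt_or_ge p m with hp | hp <;>
  rcases lt_or_ge q m with hq | hq <;> rcases lt_or_ge j n with hj' | hj' <;>
  rcases lt_or_ge p n with hp' | hp' <;> rcases lt_or_ge q n with hq' | hq' <;>
  first
  | omega
  | grind

theorem sum_triple_eq_zero {A ι : Type} [Fintype ι] [AddCommGroup A] [Module ℝ A]
    (S : ι → ι → ι → A)
    (h : (∀ j p q, S j p q = -S p j q) ∨ (∀ j p q, S j p q = -S j q p) ∨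
      (∀ j p q, S j p q = -S q p j)) : ∑ j, ∑ p, ∑ q, S j p q = 0 := by
  suffices hS : ∑ j, ∑ p, ∑ q, S j p q = -∑ j, ∑ p, ∑ q, S j p q by
    generalize ∑ j, ∑ p, ∑ q, S j p q = x at hS ⊢
    have h2 : (2 : ℝ) • x = 0 := by
      rw [two_smul]
      nth_rewrite 1 [hS]
      exact neg_add_cancel x
    exact (smul_eq_zero.1 h2).resolve_left two_ne_zero
  simp only [← Finset.sum_neg_distrib]
  rcases h with h | h | h
  · rw [Finset.sum_comm]
    exact Finset.sum_congr rfl fun j _ => Finset.sum_congr rfl fun p _ =>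
      Finset.sum_congr rfl fun q _ => h _ _ _
  · refine Finset.sum_congr rfl fun j _ => ?_
    rw [Finset.sum_comm]
    exact Finset.sum_congr rfl fun p _ => Finset.sum_congr rfl fun q _ => h _ _ _
  · have : ∀ T : ι → ι → ι → A, ∑ j, ∑ p, ∑ q, T j p q = ∑ j, ∑ p, ∑ q, T q p j := by
      intro T
      rw [Finset.sum_comm]
      conv_rhs => rw [Finset.sum_comm]
      exact Finset.sum_congr rfl fun p _ => Finset.sum_comm
    rw [this]
    exact Finset.sum_congr rfl fun j _ => Finset.sum_congr rfl fun p _ =>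
      Finset.sum_congr rfl fun q _ => h _ _ _

theorem thetaS_swap_left {r : ℕ} {U : TopologicalSpace.Opens (Fin r → ℝ)} (i j k : Fin r)
    (s t u : ℕ) : thetaS U i s * (thetaS U j t * thetaS U k u)
      = -(thetaS U j t * (thetaS U i s * thetaS U k u)) := by
  rw [← mul_assoc, thetaS_mul_swap, ← mul_assoc]
  exact neg_mul (thetaS U j t * thetaS U i s) (thetaS U k u)

theorem thetaS_swap_right {r : ℕ} {U : TopologicalSpace.Opens (Fin r → ℝ)} (i j k : Fin r)
    (s t u : ℕ) : thetaS U i s * (thetaS U j t * thetaS U k u)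
      = -(thetaS U i s * (thetaS U k u * thetaS U j t)) := by
  rw [thetaS_mul_swap j k]
  exact mul_neg (thetaS U i s) (thetaS U k u * thetaS U j t)

theorem thetaS_reverse {r : ℕ} {U : TopologicalSpace.Opens (Fin r → ℝ)} (i j k : Fin r)
    (s t u : ℕ) : thetaS U i s * (thetaS U j t * thetaS U k u)
      = -(thetaS U k u * (thetaS U j t * thetaS U i s)) := by
  rw [thetaS_swap_left, thetaS_swap_right, thetaS_swap_left k j]

theorem wI_eq_zero {r : ℕ} {U : TopologicalSpace.Opens (Fin r → ℝ)} {k : ℤ} (hk : k < 0 ∨ r < k) :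
    wI U k = 0 := by
  rw [wI, dif_neg (by omega), if_neg (by omega)]

theorem cubicCoeff_eq_zero {r : ℕ} {U : TopologicalSpace.Opens (Fin r → ℝ)} (a : Fin (r + 1) → ℝ)
    {k : ℤ} (hk : k < 0 ∨ r < k) : cubicCoeff U a k = 0 := by
  rw [cubicCoeff, aI, dif_neg (by omega)]
  simp

theorem opAct_eq_zero {r : ℕ} {U : TopologicalSpace.Opens (Fin r → ℝ)} (a : Fin (r + 1) → ℝ)
    {k : ℤ} (hk : k < 0 ∨ r < k) (z : SDiffSeries U) : opAct U a k z = 0 := by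
  rw [opAct, wI_eq_zero hk, cubicCoeff_eq_zero a hk]
  simp

/-- The density `𝒟_k(θ_j) θ_p ∂_x θ_q`. -/
def cubicDensity {r : ℕ} (U : TopologicalSpace.Opens (Fin r → ℝ)) (a : Fin (r + 1) → ℝ) (k : ℤ)
    (j p q : Fin r) : SDiffSeries U :=
  opAct U a k (thetaS U j 0) * (thetaS U p 0 * thetaS U q 1)

/-- Integration by parts is arranged so that in every remaining term two of the three `θ`'s carry
the same number of derivatives; exchanging those two changes the sign. -/
theorem cubicDensity_eq {r : ℕ} {U : TopologicalSpace.Opens (Fin r → ℝ)} (a : Fin (r + 1) → ℝ)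
    (k : ℤ) (j p q : Fin r) :
    cubicDensity U a k j p q =
      SDx U (incl U (wI U k) * (thetaS U j 0 * (thetaS U p 0 * thetaS U q 1))
        + incl U (cubicCoeff U a k) * (thetaS U j 2 * (thetaS U p 0 * thetaS U q 1)))
      + incl U (wI U k) * (thetaS U j 1 * (thetaS U p 0 * thetaS U q 1))
      - incl U (wI U k) * (thetaS U j 0 * (thetaS U p 1 * thetaS U q 1))
      - incl U (wI U k) * (thetaS U j 0 * (thetaS U p 0 * thetaS U q 2))
      - incl U (cubicCoeff U a k) * (thetaS U j 2 * (thetaS U p 1 * thetaS U q 1))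
      - incl U (cubicCoeff U a k) * (thetaS U j 2 * (thetaS U p 0 * thetaS U q 2)) := by
  rw [cubicDensity, opAct_thetaS]
  simp only [map_add, SDx_mul, SDx_incl, SDx_thetaS, Dx_cubicCoeff, map_zero, zero_mul, mul_add,
    add_mul, two_smul, mul_assoc, zero_add, Nat.reduceAdd]
  abel

theorem integral_SDx {r : ℕ} {U : TopologicalSpace.Opens (Fin r → ℝ)} (f : SDiffSeries U) :
    integral U (SDx U f) = 0 :=
  (Submodule.Quotient.mk_eq_zero _).2 ⟨f, rfl⟩

/-- Each non-exact term of the density is odd under a transposition of two indices that fixes both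
`G` and the index of `w` and `a`, since the latter depends only on `j + p + q`. Its sum therefore
equals its own negative. -/
theorem integral_cubicDensity_sum {r : ℕ} {U : TopologicalSpace.Opens (Fin r → ℝ)}
    (a : Fin (r + 1) → ℝ) (e : ℤ) (G : ℤ → ℤ → ℤ → ℝ) (h1 : ∀ j p q, G j p q = G p j q)
    (h2 : ∀ j p q, G j p q = G j q p) :
    integral U (∑ j : Fin r, ∑ p : Fin r, ∑ q : Fin r,
      G j p q • cubicDensity U a ((j : ℤ) + p + q + e) j p q) = 0 := by
  have h3 : ∀ j p q, G j p q = G q p j := fun j p q => by rw [h1, h2, h1]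
  have hneg : ∀ (c : ℝ) (f g : SDiffSeries U), c • (f * -g) = -(c • (f * g)) := fun c f g => by
    rw [← smul_neg]; congr 1; exact mul_neg f g
  simp only [cubicDensity_eq, smul_add, smul_sub, Finset.sum_add_distrib, Finset.sum_sub_distrib]
  rw [sum_triple_eq_zero (fun j p q : Fin r => G j p q •
      (incl U (wI U (j + p + q + e)) * (thetaS U j 1 * (thetaS U p 0 * thetaS U q 1)))) (by
        refine Or.inr (Or.inr fun j p q => ?_)
        rw [thetaS_reverse, hneg, h3, show (j : ℤ) + p + q + e = q + p + j + e by ring]),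
    sum_triple_eq_zero (fun j p q : Fin r => G j p q •
      (incl U (wI U (j + p + q + e)) * (thetaS U j 0 * (thetaS U p 1 * thetaS U q 1)))) (by
        refine Or.inr (Or.inl fun j p q => ?_)
        rw [thetaS_swap_right, hneg, h2, show (j : ℤ) + p + q + e = j + q + p + e by ring]),
    sum_triple_eq_zero (fun j p q : Fin r => G j p q •
      (incl U (wI U (j + p + q + e)) * (thetaS U j 0 * (thetaS U p 0 * thetaS U q 2)))) (by
        refine Or.inl fun j p q => ?_
        rw [thetaS_swap_left, hneg, h1, show (j : ℤ) + p + q + e = p + j + q + e by ring]),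
    sum_triple_eq_zero (fun j p q : Fin r => G j p q •
      (incl U (cubicCoeff U a (j + p + q + e)) * (thetaS U j 2 * (thetaS U p 1 * thetaS U q 1)))) (by
        refine Or.inr (Or.inl fun j p q => ?_)
        rw [thetaS_swap_right, hneg, h2, show (j : ℤ) + p + q + e = j + q + p + e by ring]),
    sum_triple_eq_zero (fun j p q : Fin r => G j p q •
      (incl U (cubicCoeff U a (j + p + q + e)) * (thetaS U j 2 * (thetaS U p 0 * thetaS U q 2)))) (by
        refine Or.inr (Or.inr fun j p q => ?_)
        rw [thetaS_reverse, hneg, h3, show (j : ℤ) + p + q + e = q + p + j + e by ring])]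
  simp only [add_zero, sub_zero, ← map_smul, ← map_sum, integral_SDx]

/-- The sum over `i` can be collapsed even when `x` is not an index of a coordinate. For `x < 0`
either `j < m`, and then `x + j + 1 - m < 0` makes `𝒟` vanish, or `j ≥ m`, and then the sign is `0`.
For `x ≥ r` either `j ≥ m`, and the index of `𝒟` exceeds `r`, or `j < m ≤ x`, and the sign is `0`.
-/
theorem sum_blockSign_cubicDensity {r : ℕ} {U : TopologicalSpace.Opens (Fin r → ℝ)}
    (a : Fin (r + 1) → ℝ) {m : ℕ} (hm : m ≤ r) (x : ℤ) (c : ℝ) (j p q : Fin r) :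
    ∑ i : Fin r, (if x = i then
        (blockSign m i j * c) • cubicDensity U a ((i : ℤ) + j + 1 - m) j p q else 0)
      = (blockSign m x j * c) • cubicDensity U a (x + j + 1 - m) j p q := by
  by_cases hx : 0 ≤ x ∧ x < r
  · lift x to ℕ using hx.1
    have hx' : x < r := by omega
    rw [Finset.sum_eq_single ⟨x, hx'⟩]
    · simp
    · intro i _ hi
      rw [if_neg]
      contrapose! hi
      exact Fin.ext (by simpa using hi.symm)
    · simp
  · rw [Finset.sum_eq_zero]
    · by_cases hk : x + j + 1 - m < 0 ∨ r < x + j + 1 - m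
      · rw [cubicDensity, opAct_eq_zero a hk, zero_mul, smul_zero]
      · rw [blockSign, if_neg (by omega), if_neg (by omega), zero_mul, zero_smul]
    · intro i _
      rw [if_neg]
      have := i.2
      omega

theorem deltaTheta_mul_deltaW {r : ℕ} {U : TopologicalSpace.Opens (Fin r → ℝ)}
    (a : Fin (r + 1) → ℝ) {m : ℕ} (hm : m ≤ r) (n : ℕ) :
    ∑ i : Fin r, deltaTheta U i (MatDiffOp.bivector (hamOp U a m))
        * deltaW U i (MatDiffOp.bivector (hamOp U a n))
      = ∑ j : Fin r, ∑ p : Fin r, ∑ q : Fin r,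
        (blockSign m ((p : ℤ) + q + 1 - n) j * blockSign n p q) •
          cubicDensity U a ((j : ℤ) + p + q + (2 - m - n)) j p q := by
  have h : ∀ i : Fin r, deltaTheta U i (MatDiffOp.bivector (hamOp U a m))
        * deltaW U i (MatDiffOp.bivector (hamOp U a n))
      = ∑ j : Fin r, ∑ p : Fin r, ∑ q : Fin r, if (p : ℤ) + q + 1 - n = i then
          (blockSign m i j * blockSign n p q) •
            cubicDensity U a ((i : ℤ) + j + 1 - m) j p q else 0 := by
    intro i
    have hnn : ∀ f g : SDiffSeries U, -f * -g = f * g := fun f g => neg_mul_neg f g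
    rw [deltaTheta_bivector, deltaW_bivector, hnn, Finset.sum_mul]
    refine Finset.sum_congr rfl fun j _ => ?_
    rw [Finset.mul_sum]
    refine Finset.sum_congr rfl fun p _ => ?_
    rw [Finset.mul_sum]
    refine Finset.sum_congr rfl fun q _ => ?_
    rw [mul_ite, mul_zero, smul_mul_assoc, mul_smul_comm, smul_smul, cubicDensity]
  rw [Finset.sum_congr rfl fun i _ => h i, Finset.sum_comm]
  refine Finset.sum_congr rfl fun j _ => ?_
  rw [Finset.sum_comm]
  refine Finset.sum_congr rfl fun p _ => ?_
  rw [Finset.sum_comm]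
  refine Finset.sum_congr rfl fun q _ => ?_
  rw [sum_blockSign_cubicDensity a hm]
  congr 2
  ring

/-- `δP/δw^i` is quadratic in the `θ`'s, hence central. This makes the two halves of the bracket the
same expression with `m` and `n` exchanged. -/
theorem deltaW_mul_deltaTheta {r : ℕ} {U : TopologicalSpace.Opens (Fin r → ℝ)}
    (a : Fin (r + 1) → ℝ) (m n : ℕ) (i : Fin r) :
    deltaW U i (MatDiffOp.bivector (hamOp U a m)) * deltaTheta U i (MatDiffOp.bivector (hamOp U a n))
      = deltaTheta U i (MatDiffOp.bivector (hamOp U a n))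
        * deltaW U i (MatDiffOp.bivector (hamOp U a m)) := by
  have hθ : ∀ (f : DiffSeries U) (p q j : Fin r) (s : ℕ),
      Commute (thetaS U p 0 * thetaS U q 1) (incl U f * thetaS U j s) := by
    intro f p q j s
    have hf : Commute (thetaS U p 0 * thetaS U q 1) (incl U f) := (incl_commute f _).symm
    refine hf.mul_right ?_
    change _ * _ = _ * _
    rw [mul_assoc, thetaS_swap_right, thetaS_swap_left, neg_neg]
  have hnn : ∀ f g : SDiffSeries U, -f * -g = f * g := fun f g => neg_mul_neg f g
  rw [deltaTheta_bivector, deltaW_bivector, hnn, hnn]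
  change Commute _ _
  refine Commute.sum_left _ _ _ fun p _ => Commute.sum_left _ _ _ fun q _ =>
    Commute.sum_right _ _ _ fun j _ => ?_
  split_ifs
  · refine (Commute.smul_right ?_ _).smul_left _
    rw [opAct_thetaS]
    exact (((hθ _ _ _ _ _).smul_right _).add_right (hθ _ _ _ _ _)).add_right (hθ _ _ _ _ _)
  · exact Commute.zero_left _

theorem schouten_hamOp {r : ℕ} {U : TopologicalSpace.Opens (Fin r → ℝ)} (a : Fin (r + 1) → ℝ)
    {m n : ℕ} (hm : m ≤ r) (hn : n ≤ r) :
    schouten 2 (MatDiffOp.bivector (hamOp U a m)) (MatDiffOp.bivector (hamOp U a n)) = 0 := by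
  rw [schouten, Finset.sum_add_distrib]
  simp only [even_two, Even.neg_pow, one_pow, one_smul, deltaW_mul_deltaTheta,
    deltaTheta_mul_deltaW a hm, deltaTheta_mul_deltaW a hn]
  rw [sub_right_comm (2 : ℤ) n m]
  simp only [ ← Finset.sum_add_distrib, ← add_smul]
  exact integral_cubicDensity_sum a _ (fun j p q => blockSign m (p + q + 1 - n) j * blockSign n p q
    + blockSign n (p + q + 1 - m) j * blockSign m p q)
    (fun j p q => blockSign_jacobi_swap m n j p q)
    (fun j p q => by rw [blockSign_comm n p q, blockSign_comm m p q, add_comm p q])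

/-! ### Linear independence -/

theorem blockSign_ne_zero_diag (m i : ℤ) : blockSign m i i ≠ 0 := by
  unfold blockSign
  split_ifs with h1 h2
  · norm_num
  · norm_num
  · omega

/-- The value of `w^k` at a point. -/
def wVal {r : ℕ} (x : Fin r → ℝ) (k : ℤ) : ℝ :=
  if h : 0 ≤ k ∧ k < r then x ⟨k.toNat, by omega⟩ else if k = r then 1 else 0

/-- The value at a point of the part of degree zero. -/
def constEval {r : ℕ} {U : TopologicalSpace.Opens (Fin r → ℝ)} (x : U) : DiffSeries U →ₗ[ℝ] ℝ where
  toFun f := (MvPolynomial.coeff 0 (PowerSeries.coeff 0 f)).eval x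
  map_add' _ _ := by simp; rfl
  map_smul' _ _ := rfl

theorem constEval_wI {r : ℕ} {U : TopologicalSpace.Opens (Fin r → ℝ)} (x : U) (k : ℤ) :
    constEval x (wI U k) = wVal x.1 k := by
  rw [wI, wVal]
  split_ifs
  · simp [constEval]; rfl
  · simp [constEval]; rfl
  · simp

/-- Moving a point of `U` slightly along the coordinate `w^{e-m}` changes only the term with index
`m`, so its coefficient vanishes. Once the genuine coordinates are gone, only the constant `w^r = 1`
can remain, and its coefficient vanishes too. -/
theorem eq_zero_of_sum_wVal {r : ℕ} {U : TopologicalSpace.Opens (Fin r → ℝ)}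
    (hU : (U : Set (Fin r → ℝ)).Nonempty) (c : Fin (r + 1) → ℝ) (e : ℤ)
    (h : ∀ x ∈ U, ∑ m : Fin (r + 1), c m * wVal x (e - m) = 0) (m : Fin (r + 1))
    (hm0 : 0 ≤ e - m) (hmr : e - m ≤ r) : c m = 0 := by
  obtain ⟨x, hx⟩ := hU
  have hlow : ∀ m : Fin (r + 1), 0 ≤ e - m → e - m < r → c m = 0 := by
    intro m hm0 hmr
    obtain ⟨i, hi⟩ : ∃ i : Fin r, (i : ℤ) = e - m := ⟨⟨(e - m).toNat, by omega⟩, by simp; omega⟩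
    have hcont : Filter.Tendsto (fun t : ℝ => x + t • (Pi.single i 1 : Fin r → ℝ)) (nhdsWithin 0 {0}ᶜ)
        (nhds x) := by
      have : ContinuousAt (fun t : ℝ => x + t • (Pi.single i 1 : Fin r → ℝ)) 0 := by fun_prop
      simpa using this.tendsto.mono_left nhdsWithin_le_nhds
    obtain ⟨t, ht, ht0⟩ := ((hcont.eventually (U.isOpen.mem_nhds hx)).and
      self_mem_nhdsWithin).exists
    have h3 : ∑ l : Fin (r + 1), (c l * wVal (x + t • (Pi.single i 1 : Fin r → ℝ)) (e - l)
        - c l * wVal x (e - l)) = c m * t := by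
      rw [Finset.sum_eq_single m]
      · have := i.2
        simp [wVal, ← hi]
        ring
      · intro l _ hl
        rw [wVal, wVal]
        split_ifs with h0
        · have hne : (⟨(e - l).toNat, by omega⟩ : Fin r) ≠ i := by
            intro he
            apply hl
            have := congrArg Fin.val he
            simp only at this
            exact Fin.ext (by omega)
          rw [Pi.add_apply, Pi.smul_apply, Pi.single_eq_of_ne hne, smul_zero, add_zero, sub_self]
        · ring
        · ring
      · simp
    rw [Finset.sum_sub_distrib, h _ ht, h _ hx, sub_zero] at h3
    exact (mul_eq_zero.1 h3.symm).resolve_right ht0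
  rcases hmr.lt_or_eq with hmr | hmr
  · exact hlow m hm0 hmr
  · have h1 := h x hx
    rw [Finset.sum_eq_single m] at h1
    · simpa [wVal, hmr] using h1
    · intro l _ hl
      have hl' : (l : ℕ) ≠ m := fun he => hl (Fin.ext he)
      by_cases h0 : 0 ≤ e - l ∧ e - l < r
      · rw [hlow l h0.1 h0.2, zero_mul]
      · rw [wVal, dif_neg h0, if_neg (by omega), mul_zero]
    · simp

/-- A diagonal entry `(i, i)` is never in a zero block, and its `∂_x` coefficient `±2w^{2i+1-m}`
involves a different coordinate for each `m`. -/
theorem hamOp_linearIndependent {r : ℕ} {U : TopologicalSpace.Opens (Fin r → ℝ)}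
    (hr : 0 < r) (hU : (U : Set (Fin r → ℝ)).Nonempty) (a : Fin (r + 1) → ℝ) :
    LinearIndependent ℝ fun m : Fin (r + 1) => hamOp U a m := by
  rw [Fintype.linearIndependent_iff]
  intro g hg m
  -- With `i = ⌊m/2⌋` the index `2i + 1 - m` is `0` or `1`, hence in the range `0, …, r` as `r ≥ 1`.
  obtain ⟨i, hi1, hi2⟩ : ∃ i : Fin r, (m : ℤ) ≤ 2 * i + 1 ∧ 2 * (i : ℤ) + 1 - m ≤ r := by
    have := m.2
    exact ⟨⟨(m : ℕ) / 2, by omega⟩, by simp; omega, by simp; omega⟩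
  have h1 : ∀ x ∈ U, ∑ m : Fin (r + 1),
      g m * blockSign m i i * wVal x ((i : ℤ) + i + 1 - m) = 0 := by
    intro x hx
    have h2 := congrFun (congrFun hg i) i
    have h3 := congrArg (fun L : DiffOp U => constEval ⟨x, hx⟩ (L 1)) h2
    simp only [Finset.sum_apply, Pi.smul_apply, hamOp_eq_smul, Finsupp.coe_finsetSum,
      Finsupp.coe_smul, map_sum, map_smul] at h3
    have h4 : ∀ k : ℤ, constEval ⟨x, hx⟩ (opD U a k 1) = 2 * wVal x k := by
      intro k
      have : opD U a k 1 = 2 * wI U k := by simp [opD]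
      rw [this, two_mul, map_add, constEval_wI, two_mul]
    simp only [h4, smul_eq_mul] at h3
    refine (mul_eq_zero.1 (?_ : (2 : ℝ) * _ = 0)).resolve_left two_ne_zero
    rw [Finset.mul_sum]
    refine (Finset.sum_congr rfl fun m _ => ?_).trans (h3.trans ?_)
    · ring
    · exact map_zero (constEval (⟨x, hx⟩ : U))
  have h5 := eq_zero_of_sum_wVal hU (fun m => g m * blockSign m i i) _ h1 m (by omega) (by omega)
  exact (mul_eq_zero.1 h5).resolve_right (blockSign_ne_zero_diag _ _)

/-! ### Hamiltonian vector fields -/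

/-- Skew-adjointness again, now moving `𝒟_k` from the exterior variables onto the gradient; the
explicit total derivative is the boundary term. -/
theorem integral_opAct_mul {r : ℕ} {U : TopologicalSpace.Opens (Fin r → ℝ)} (a : Fin (r + 1) → ℝ)
    (k : ℤ) (c : ℝ) (z : SDiffSeries U) (g : DiffSeries U) :
    integral U (c • opAct U a k z * incl U g)
      = -integral U (incl U (DiffOp.apply (c • opD U a k) g) * z) := by
  have h : opAct U a k z * incl U g
      = SDx U (incl U (wI U k) * z * incl U g + incl U (wI U k) * z * incl U g
        + incl U (cubicCoeff U a k) * (SDx U (SDx U z) * incl U g - SDx U z * incl U (Dx U g)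
          + z * incl U (Dx U (Dx U g))))
      - incl U (DiffOp.apply ((1 : ℝ) • opD U a k) g) * z := by
    rw [opD_apply, one_smul]
    simp only [opAct, map_add, map_sub, SDx_mul, SDx_incl, Dx_cubicCoeff, incl_mul, two_mul,
      two_smul, add_mul, mul_add, mul_sub, map_zero, zero_mul, zero_add, mul_assoc,
      incl_commute g, incl_commute (Dx U g),
      incl_commute (Dx U (Dx U (Dx U g)))]
    abel
  have hc : DiffOp.apply (c • opD U a k) g = c • DiffOp.apply ((1 : ℝ) • opD U a k) g := by
    rw [opD_apply, opD_apply, one_smul]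
  rw [smul_mul_assoc, h, hc, map_smul, map_smul, smul_mul_assoc, map_smul, map_sub, integral_SDx,
    zero_sub, smul_neg]

/-- The Hamiltonian vector field of a local functional for the operator `P_m`. -/
theorem schouten_hamOp_functional {r : ℕ} {U : TopologicalSpace.Opens (Fin r → ℝ)}
    (a : Fin (r + 1) → ℝ) (m : ℕ) (h : DiffSeries U) (g : Fin r → DiffSeries U)
    (hg : ∀ i, deltaW U i (functional h) = incl U (g i)) :
    schouten 2 (MatDiffOp.bivector (hamOp U a m)) (functional h)
      = vectorField fun j => ∑ i, DiffOp.apply (hamOp U a m j i) (g i) := by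
  have hnm : ∀ f g : SDiffSeries U, -f * g = -(f * g) := fun f g => neg_mul f g
  simp only [schouten, vectorField, deltaTheta_functional, deltaTheta_bivector, hg, mul_zero,
    smul_zero, add_zero, hnm, Finset.sum_mul, map_sum, map_neg, integral_opAct_mul,
    Finset.sum_neg_distrib, neg_neg]
  rw [Finset.sum_comm]
  refine Finset.sum_congr rfl fun j _ => Finset.sum_congr rfl fun i _ => ?_
  rw [hamOp_eq_smul, blockSign_comm, add_comm (i : ℤ)]

/-! ### The Euler operator of a quadratic constraint -/

/-- The truncated operator `f ↦ ∑_{s < N} (-D)^s (g E_s f)`. -/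
def truncEuler {S : Type} [CommRing S] [Algebra ℝ S] (D : Derivation ℝ S S)
    (E : ℕ → Derivation ℝ S S) (N : ℕ) (g f : S) : S :=
  ∑ s ∈ Finset.range N, ((-(D : S →ₗ[ℝ] S)) ^ s) (g * E s f)

section truncEuler

variable {S : Type} [CommRing S] [Algebra ℝ S] (D : Derivation ℝ S S) (E : ℕ → Derivation ℝ S S)
  (N : ℕ)

theorem truncEuler_mul (g f h : S) :
    truncEuler D E N g (f * h) = truncEuler D E N (g * f) h + truncEuler D E N (g * h) f := by
  simp only [truncEuler, ← Finset.sum_add_distrib, ← map_add, Derivation.leibniz, smul_eq_mul]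
  refine Finset.sum_congr rfl fun s _ => congrArg _ ?_
  ring

theorem truncEuler_sub_right (g f h : S) :
    truncEuler D E N g (f - h) = truncEuler D E N g f - truncEuler D E N g h := by
  simp only [truncEuler, ← Finset.sum_sub_distrib, map_sub, mul_sub]

theorem truncEuler_add_left (g f h : S) :
    truncEuler D E N (g + f) h = truncEuler D E N g h + truncEuler D E N f h := by
  simp only [truncEuler, ← Finset.sum_add_distrib, ← map_add, add_mul]

/-- Integration by parts. The two parts of `E_{s+1} D = D E_{s+1} + E_s` telescope, and the
truncation leaves one boundary term of top order. -/
theorem truncEuler_deriv (h0 : ∀ f, E 0 (D f) = D (E 0 f))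
    (h1 : ∀ s f, E (s + 1) (D f) = D (E (s + 1) f) + E s f) (g f : S) :
    truncEuler D E (N + 1) g (D f) = -truncEuler D E (N + 1) (D g) f
      - ((-(D : S →ₗ[ℝ] S)) ^ (N + 1)) (g * E N f) := by
  induction N with
  | zero =>
    simp [truncEuler, h0]
    ring
  | succ n ih =>
    rw [truncEuler, Finset.sum_range_succ, ← truncEuler, ih, truncEuler, truncEuler,
      Finset.sum_range_succ _ (n + 1), h1, pow_succ _ (n + 1)]
    simp only [Module.End.mul_apply, LinearMap.neg_apply, Derivation.coeFn_coe, Derivation.leibniz,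
      smul_eq_mul, mul_add, map_add, map_neg, neg_add, mul_comm (D g)]
    ring

theorem truncEuler_const {q : S} (hq : ∀ s, E s q = 0) (g : S) : truncEuler D E N g q = 0 := by
  simp [truncEuler, hq]

/-- If `A b^2 - q (2 b b_xx - b_x^2) = 1`, then the variational derivative of `2 / b` is the one of
`A` times `b`, up to an ideal that contains the derivatives of `b` of high order. -/
theorem truncEuler_inverse (h0 : ∀ f, E 0 (D f) = D (E 0 f))
    (h1 : ∀ s f, E (s + 1) (D f) = D (E (s + 1) f) + E s f) {I : Ideal S}
    (hI : ∀ f ∈ I, D f ∈ I) {A q b β : S} (hA : ∀ s, E (s + 1) A = 0) (hq : ∀ s, E s q = 0)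
    (hDq : D q = 0) (hb : b * β = 1) (hN : ∀ s, N ≤ s → E s b ∈ I)
    (heq : A * (b * b) - q * (2 * (b * D (D b)) - D b * D b) = 1) :
    E 0 A * b - truncEuler D E (N + 2) 2 β ∈ I := by
  have hIpow : ∀ (n : ℕ) (f : S), f ∈ I → ((-(D : S →ₗ[ℝ] S)) ^ n) f ∈ I := by
    intro n
    induction n with
    | zero => simp
    | succ n ih =>
      intro f hf
      rw [pow_succ, Module.End.mul_apply]
      exact ih _ (by simpa using hI f hf)
  have hTA : ∀ g, truncEuler D E (N + 2) g A = g * E 0 A := by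
    intro g
    rw [truncEuler, Finset.sum_range_succ']
    simp [hA]
  have hTq : ∀ g, truncEuler D E (N + 2) g q = 0 := truncEuler_const D E _ hq
  have hT1 : ∀ g, truncEuler D E (N + 2) g 1 = 0 :=
    truncEuler_const D E _ fun s => (E s).map_one_eq_zero
  have hT0 : ∀ f, truncEuler D E (N + 2) 0 f = 0 := fun f => by simp [truncEuler]
  have hDβ : D β = -(β * β * D b) := by
    have := congrArg D hb
    rw [Derivation.leibniz, Derivation.map_one_eq_zero, smul_eq_mul, smul_eq_mul] at this
    linear_combination (-D β) * hb + β * this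
  have two : ∀ g f : S, truncEuler D E (N + 2) g (2 * f) = truncEuler D E (N + 2) (g * 2) f := by
    intro g f
    have : truncEuler D E (N + 2) (g * f) (2 : S) = 0 :=
      truncEuler_const D E _ (fun s => by simpa using (E s).map_natCast 2) _
    rw [truncEuler_mul, this, add_zero]
  -- The weight of `D²b` collapses to `2q` because `βb = 1`; as `2q` is constant, one integration by
  -- parts leaves only the boundary term.
  obtain ⟨e1, he1, hd1⟩ : ∃ e ∈ I, truncEuler D E (N + 2) (β * q * 2 * b) (D (D b)) = e := by
    refine ⟨_, ?_, rfl⟩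
    rw [truncEuler_deriv D E (N + 1) h0 h1, show β * q * 2 * b = 2 * q by linear_combination 2 * q * hb]
    have : D (2 * q) = 0 := by rw [two_mul, map_add, hDq, add_zero]
    rw [this, hT0, neg_zero, zero_sub]
    refine I.neg_mem (hIpow _ _ (I.mul_mem_left _ ?_))
    rw [h1]
    exact I.add_mem (hI _ (hN _ (by omega))) (hN _ le_rfl)
  -- Here the weight does not become constant: the derivative of `βq·Db` is computed from `Dβ = -β²
  -- Db`.
  obtain ⟨e2, he2, hd2⟩ : ∃ e ∈ I, truncEuler D E (N + 2) (β * q * D b) (D b)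
      = -truncEuler D E (N + 2) (q * (β * D (D b) - β * β * (D b * D b))) b + e := by
    refine ⟨-((-(D : S →ₗ[ℝ] S)) ^ (N + 2)) (β * q * D b * E (N + 1) b), ?_, ?_⟩
    rotate_left
    · rw [truncEuler_deriv D E (N + 1) h0 h1, sub_eq_add_neg]
      congr 3
      simp only [Derivation.leibniz, hDq, hDβ, smul_eq_mul]
      ring
    · exact I.neg_mem (hIpow _ _ (I.mul_mem_left _ (hN _ (by omega))))
  -- The constraint is varied with weight `β = 1/b`, so that `E 0 A` appears with coefficient `β b²
  -- = b`.
  have h2 := hT1 β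
  rw [← heq, truncEuler_sub_right, truncEuler_mul, hTA, truncEuler_mul, truncEuler_mul, hTq,
    truncEuler_sub_right, two, truncEuler_mul, truncEuler_mul, hd1, hd2, add_zero] at h2
  -- Varying `bβ = 1` with weight `2β` converts the variation of `b` with weight `2β²` into minus
  -- that of `β` with weight `2`.
  have h3 := hT1 (2 * β)
  rw [← hb, truncEuler_mul] at h3
  have e3 : β * (b * b) * E 0 A = E 0 A * b := by linear_combination E 0 A * b * hb
  have e4 : 2 * β * b = 2 := by linear_combination 2 * hb
  rw [e4] at h3
  -- All weights in front of `b` are collected; by the constraint multiplied by `2β²` their total is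
  -- `2β²`.
  have key : truncEuler D E (N + 2) (β * A * b) b + truncEuler D E (N + 2) (β * A * b) b
      = truncEuler D E (N + 2) (β * q * 2 * D (D b)) b
        + (truncEuler D E (N + 2) (q * (β * D (D b) - β * β * (D b * D b))) b
          + truncEuler D E (N + 2) (q * (β * D (D b) - β * β * (D b * D b))) b)
        + truncEuler D E (N + 2) (2 * β * β) b := by
    simp only [← truncEuler_add_left]
    congr 1
    linear_combination (2 * β * β) * heq - (2 * β * A * b - 4 * q * β * D (D b)) * hb
  have h4 : E 0 A * b - truncEuler D E (N + 2) 2 β = e1 - (e2 + e2) := by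
    linear_combination h2 - h3 - key - e3
  rw [h4]
  exact I.sub_mem he1 (I.add_mem he2 he2)

end truncEuler

/-! ### Variational derivatives of the Hamiltonians -/

/-- A derivation of differential polynomials, extended to double series. -/
def seriesDer {r : ℕ} {U : TopologicalSpace.Opens (Fin r → ℝ)}
    (T : Derivation ℝ (DiffPoly U) (DiffPoly U)) :
    Derivation ℝ (PowerSeries (DiffSeries U)) (PowerSeries (DiffSeries U)) :=
  coeffwiseDer (coeffwiseDer T)

theorem coeff_seriesDer {r : ℕ} {U : TopologicalSpace.Opens (Fin r → ℝ)}
    (T : Derivation ℝ (DiffPoly U) (DiffPoly U)) (f : PowerSeries (DiffSeries U)) (k d : ℕ) :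
    PowerSeries.coeff d (PowerSeries.coeff k (seriesDer T f))
      = T (PowerSeries.coeff d (PowerSeries.coeff k f)) := by
  rw [seriesDer, coeffwiseDer_apply, coeff_coeffwise, Derivation.coeFn_coe, coeffwiseDer_apply,
    coeff_coeffwise, Derivation.coeFn_coe]

theorem series_ext {R : Type} [Semiring R] {f g : PowerSeries (PowerSeries R)}
    (h : ∀ k d, PowerSeries.coeff d (PowerSeries.coeff k f)
      = PowerSeries.coeff d (PowerSeries.coeff k g)) : f = g :=
  PowerSeries.ext fun k => PowerSeries.ext fun d => h k d

theorem coeff_seriesDer_neg_pow {r : ℕ} {U : TopologicalSpace.Opens (Fin r → ℝ)}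
    (T : Derivation ℝ (DiffPoly U) (DiffPoly U)) (s : ℕ) (f : PowerSeries (DiffSeries U))
    (k d : ℕ) :
    PowerSeries.coeff d (PowerSeries.coeff k
      (((-(seriesDer T : PowerSeries (DiffSeries U) →ₗ[ℝ] _)) ^ s) f))
      = ((-(T : DiffPoly U →ₗ[ℝ] DiffPoly U)) ^ s)
        (PowerSeries.coeff d (PowerSeries.coeff k f)) := by
  induction s generalizing f with
  | zero => simp
  | succ s ih =>
    rw [pow_succ, pow_succ, Module.End.mul_apply, Module.End.mul_apply, ih]
    simp [coeff_seriesDer]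

/-- The ideal of double series whose coefficients of bidegree at most `(K, L)` vanish. -/
def truncIdeal (R : Type) [CommRing R] (K L : ℕ) : Ideal (PowerSeries (PowerSeries R)) where
  carrier := {f | ∀ k ≤ K, ∀ d ≤ L, PowerSeries.coeff d (PowerSeries.coeff k f) = 0}
  zero_mem' := by simp
  add_mem' {f g} hf hg k hk d hd := by simp [hf k hk d hd, hg k hk d hd]
  smul_mem' c f hf k hk d hd := by
    rw [smul_eq_mul, PowerSeries.coeff_mul, map_sum]
    refine Finset.sum_eq_zero fun x hx => ?_
    rw [PowerSeries.coeff_mul]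
    refine Finset.sum_eq_zero fun y hy => ?_
    have h1 := Finset.HasAntidiagonal.mem_antidiagonal.1 hx
    have h2 := Finset.HasAntidiagonal.mem_antidiagonal.1 hy
    rw [hf _ (by omega) _ (by omega), mul_zero]

theorem varW_tmul_one {r : ℕ} {U : TopologicalSpace.Opens (Fin r → ℝ)} (i : Fin r) (f : DiffPoly U)
    {N : ℕ} (hN : ∀ s, N ≤ s → dw U i s f = 0) :
    varW U i (f ⊗ₜ 1) = (∑ s ∈ Finset.range N,
      ((-(dx U : DiffPoly U →ₗ[ℝ] DiffPoly U)) ^ s) (dw U i s f)) ⊗ₜ 1 := by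
  have hpow : ∀ (s : ℕ) (g : DiffPoly U), ((-sdx U) ^ s) (g ⊗ₜ[ℝ] (1 : ThetaAlg r))
      = (((-(dx U : DiffPoly U →ₗ[ℝ] DiffPoly U)) ^ s) g) ⊗ₜ 1 := by
    intro s
    induction s with
    | zero => simp
    | succ s ih =>
      intro g
      rw [pow_succ, pow_succ, Module.End.mul_apply, Module.End.mul_apply, ← ih,
        LinearMap.neg_apply, sdx_tmul, ← map_one (algebraMap ℝ (ThetaAlg r)), extShift_algebraMap,
        TensorProduct.tmul_zero, add_zero, LinearMap.neg_apply, TensorProduct.neg_tmul]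
      rfl
  rw [varW, euler_eq_sum (N := N), TensorProduct.sum_tmul]
  · refine Finset.sum_congr rfl fun s _ => ?_
    rw [← hpow, sdw, LinearMap.rTensor_tmul]
    rfl
  · intro s hs
    rw [sdw, LinearMap.rTensor_tmul, Derivation.coeFn_coe, hN s hs, TensorProduct.zero_tmul]

/-- The jet order of the coefficients of `b` need not be bounded, so no single truncation of the
Euler operator need serve the whole series. For one coefficient of bidegree `(K, L)` only finitely
many differential polynomials matter; modulo `truncIdeal`, which is stable under `∂_x`, the jet
order is bounded and `truncEuler_inverse` applies. -/
theorem deltaW_functional_inverse {r : ℕ} {U : TopologicalSpace.Opens (Fin r → ℝ)} (i : Fin r)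
    {A q b β : PowerSeries (DiffSeries U)} (hA : ∀ s, seriesDer (dw U i (s + 1)) A = 0)
    (hq : ∀ s, seriesDer (dw U i s) q = 0) (hDq : seriesDer (dx U) q = 0) (hb : b * β = 1)
    (heq : A * (b * b) - q * (2 * (b * seriesDer (dx U) (seriesDer (dx U) b))
      - seriesDer (dx U) b * seriesDer (dx U) b) = 1) (K : ℕ) :
    deltaW U i (functional (2 * PowerSeries.coeff K β))
      = incl U (PowerSeries.coeff K (seriesDer (dw U i 0) A * b)) := by
  change coeffwise (varW U i) (incl U _) = _
  ext L
  rw [coeff_coeffwise, coeff_incl, coeff_incl]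
  have hev : ∀ f : DiffPoly U, ∀ᶠ s in Filter.atTop, dw U i s f = 0 := by
    intro f
    rw [← Nat.cofinite_eq_atTop, Filter.eventually_cofinite]
    exact dw_finite i f
  obtain ⟨N, hN⟩ := Filter.eventually_atTop.1 ((hev (PowerSeries.coeff L
    (2 * PowerSeries.coeff K β))).and ((Filter.eventually_all_finset (Finset.range (K + 1))).2
      fun k _ => (Filter.eventually_all_finset (Finset.range (L + 1))).2
        fun d _ => hev (PowerSeries.coeff d (PowerSeries.coeff k b))))
  have key := truncEuler_inverse (seriesDer (dx U)) (fun s => seriesDer (dw U i s)) N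
    (fun f => series_ext fun k d => by simp only [coeff_seriesDer, dw_zero_dx])
    (fun s f => series_ext fun k d => by simp only [coeff_seriesDer, dw_succ_dx, map_add])
    (I := truncIdeal (DiffPoly U) K L)
    (fun f hf k hk d hd => by rw [coeff_seriesDer, hf k hk d hd, map_zero]) hA hq hDq hb
    (fun s hs k hk d hd => by
      rw [coeff_seriesDer]
      exact (hN s hs).2 k (by simpa using Nat.lt_succ_of_le hk) d
        (by simpa using Nat.lt_succ_of_le hd)) heq
  have h2 := key K le_rfl L le_rfl
  rw [map_sub, map_sub, sub_eq_zero] at h2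
  rw [h2, varW_tmul_one (N := N + 2) i _ fun s hs => (hN s (by omega)).1, truncEuler, map_sum,
    map_sum]
  congr 1
  refine Finset.sum_congr rfl fun s _ => ?_
  rw [coeff_seriesDer_neg_pow, two_mul, two_mul, map_add, map_add, map_add, map_add, map_add,
    map_add, coeff_seriesDer]

/-! ### Gradings -/

/-- The weight of the jet variable with index `(i, s)`, which stands for `w^{i,s+1}`. -/
abbrev jetWeight (r : ℕ) : Fin r × ℕ → ℕ := fun q => q.2 + 1

theorem dx_isWeightedHomogeneous {r : ℕ} {U : TopologicalSpace.Opens (Fin r → ℝ)} {f : DiffPoly U}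
    {n : ℕ} (hf : MvPolynomial.IsWeightedHomogeneous (jetWeight r) f n) :
    MvPolynomial.IsWeightedHomogeneous (jetWeight r) (dx U f) (n + 1) := by
  have hX : ∀ q : Fin r × ℕ, MvPolynomial.IsWeightedHomogeneous (jetWeight r)
      (MvPolynomial.X q : DiffPoly U) (q.2 + 1) :=
    fun q => MvPolynomial.isWeightedHomogeneous_X _ _ q
  have hC : ∀ (c : SmoothFn U),
      MvPolynomial.IsWeightedHomogeneous (jetWeight r) (dx U (MvPolynomial.C c)) 1 := by
    intro c
    rw [dx_C]
    refine MvPolynomial.IsWeightedHomogeneous.sum _ _ _ fun i _ => ?_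
    exact (hX (i, 0)).mul (MvPolynomial.isWeightedHomogeneous_C _ _)
  have hmon : ∀ (m : Fin r × ℕ →₀ ℕ) (c : SmoothFn U), MvPolynomial.IsWeightedHomogeneous
      (jetWeight r) (dx U (MvPolynomial.monomial m c)) (Finsupp.weight (jetWeight r) m + 1) := by
    intro m
    induction m using Finsupp.induction_linear with
    | zero => simpa using hC
    | single q k =>
      intro c
      induction k with
      | zero => simpa using hC c
      | succ k ih =>
        have : (MvPolynomial.monomial (Finsupp.single q (k + 1)) c : DiffPoly U)
            = MvPolynomial.monomial (Finsupp.single q k) c * MvPolynomial.X q := by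
          rw [MvPolynomial.X, MvPolynomial.monomial_mul, mul_one, Finsupp.single_add]
        rw [this, Derivation.leibniz, smul_eq_mul, smul_eq_mul, dx_X, Finsupp.single_add, map_add]
        have hq : Finsupp.weight (jetWeight r) (Finsupp.single q 1) = q.2 + 1 := by
          rw [Finsupp.weight_single, one_smul]
        rw [hq]
        refine MvPolynomial.IsWeightedHomogeneous.add ?_ ?_
        · rw [add_assoc]
          exact (MvPolynomial.isWeightedHomogeneous_monomial _ _ _ rfl).mul (hX (q.1, q.2 + 1))
        · rw [add_comm (Finsupp.weight _ _), add_assoc]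
          exact (hX q).mul ih
    | add m m' hm hm' =>
      intro c
      have : (MvPolynomial.monomial (m + m') c : DiffPoly U)
          = MvPolynomial.monomial m c * MvPolynomial.monomial m' 1 := by
        rw [MvPolynomial.monomial_mul, mul_one]
      have h1 : ∀ m (c : SmoothFn U), MvPolynomial.IsWeightedHomogeneous (jetWeight r)
          (MvPolynomial.monomial m c) (Finsupp.weight (jetWeight r) m) :=
        fun m c => MvPolynomial.isWeightedHomogeneous_monomial _ _ _ rfl
      rw [this, Derivation.leibniz, smul_eq_mul, smul_eq_mul, map_add]
      refine MvPolynomial.IsWeightedHomogeneous.add ?_ ?_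
      · rw [add_assoc]
        exact (h1 _ _).mul (hm' _)
      · rw [add_comm (Finsupp.weight _ m), add_assoc]
        exact (h1 _ _).mul (hm _)
  rw [f.as_sum, map_sum]
  refine MvPolynomial.IsWeightedHomogeneous.sum _ _ _ fun m hm => ?_
  rw [← hf (MvPolynomial.mem_support_iff.1 hm)]
  exact hmon _ _

/-- Double series in `λ` and `ε` whose coefficient of `ε^d` is homogeneous of degree `d + n`. -/
def IsShiftGraded {r : ℕ} {U : TopologicalSpace.Opens (Fin r → ℝ)} (n : ℕ)
    (f : PowerSeries (DiffSeries U)) : Prop :=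
  ∀ k d, MvPolynomial.IsWeightedHomogeneous (jetWeight r)
    (PowerSeries.coeff d (PowerSeries.coeff k f)) (d + n)

namespace IsShiftGraded

variable {r : ℕ} {U : TopologicalSpace.Opens (Fin r → ℝ)} {m n : ℕ}
  {f g : PowerSeries (DiffSeries U)}

theorem add (hf : IsShiftGraded n f) (hg : IsShiftGraded n g) : IsShiftGraded n (f + g) := by
  intro k d
  rw [map_add, map_add]
  exact (hf k d).add (hg k d)

theorem sub (hf : IsShiftGraded n f) (hg : IsShiftGraded n g) : IsShiftGraded n (f - g) := by
  intro k d
  rw [map_sub, map_sub]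
  exact (hf k d).sub (hg k d)

theorem smul (hf : IsShiftGraded n f) (c : ℝ) : IsShiftGraded n (c • f) := by
  intro k d
  have : PowerSeries.coeff d (PowerSeries.coeff k (c • f))
      = MvPolynomial.C (algebraMap ℝ (SmoothFn U) c) * PowerSeries.coeff d (PowerSeries.coeff k f) := by
    rw [coeff_smul_ser, coeff_smul_ser, Algebra.smul_def]
    rfl
  rw [this]
  exact (hf k d).C_mul _

theorem mul (hf : IsShiftGraded m f) (hg : IsShiftGraded n g) : IsShiftGraded (m + n) (f * g) := by
  intro k d
  rw [PowerSeries.coeff_mul, map_sum]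
  refine MvPolynomial.IsWeightedHomogeneous.sum _ _ _ fun x _ => ?_
  rw [PowerSeries.coeff_mul]
  refine MvPolynomial.IsWeightedHomogeneous.sum _ _ _ fun y hy => ?_
  have h := (hf x.1 y.1).mul (hg x.2 y.2)
  rwa [add_add_add_comm, Finset.HasAntidiagonal.mem_antidiagonal.1 hy] at h

theorem deriv (hf : IsShiftGraded n f) : IsShiftGraded (n + 1) (seriesDer (dx U) f) := by
  intro k d
  rw [coeff_seriesDer, ← add_assoc]
  exact dx_isWeightedHomogeneous (hf k d)

/-- The factor `ε²` absorbs the weight of two `x`-derivatives; this is why the quadratic equation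
preserves the grading. -/
theorem C_eps_sq_mul (hf : IsShiftGraded 2 f) :
    IsShiftGraded 0 (PowerSeries.C (eps U ^ 2) * f) := by
  intro k d
  rw [PowerSeries.coeff_C_mul, eps, PowerSeries.coeff_X_pow_mul']
  split_ifs with h
  · have := hf k (d - 2)
    rwa [Nat.sub_add_cancel h] at this
  · exact MvPolynomial.isWeightedHomogeneous_zero _ _ _

theorem C_C (x : SmoothFn U) :
    IsShiftGraded 0 (PowerSeries.C (PowerSeries.C (MvPolynomial.C x)) :
      PowerSeries (DiffSeries U)) := by
  intro k d
  rw [PowerSeries.coeff_C]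
  split_ifs with h
  · rw [PowerSeries.coeff_C]
    split_ifs with h'
    · rw [h']
      exact MvPolynomial.isWeightedHomogeneous_C _ _
    · exact MvPolynomial.isWeightedHomogeneous_zero _ _ _
  · rw [map_zero]
    exact MvPolynomial.isWeightedHomogeneous_zero _ _ _

theorem one : IsShiftGraded 0 (1 : PowerSeries (DiffSeries U)) := by
  simpa using C_C (1 : SmoothFn U)

end IsShiftGraded

theorem quad_eq {r : ℕ} {U : TopologicalSpace.Opens (Fin r → ℝ)}
    (p q y : PowerSeries (DiffSeries U)) :
    quad p q y = p * (y * y) - ((1 / 4 : ℝ) • (PowerSeries.C (eps U ^ 2) * q))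
      * (2 * (y * seriesDer (dx U) (seriesDer (dx U) y))
        - seriesDer (dx U) y * seriesDer (dx U) y) := by
  have h : ∀ f : PowerSeries (DiffSeries U), coeffwise (Dx U) f = seriesDer (dx U) f :=
    fun f => rfl
  rw [quad, h, h, smul_mul_assoc, pow_two, pow_two (seriesDer (dx U) y), mul_assoc 2]

theorem IsShiftGraded.quad {r : ℕ} {U : TopologicalSpace.Opens (Fin r → ℝ)}
    {p q y : PowerSeries (DiffSeries U)} (hp : IsShiftGraded 0 p) (hq : IsShiftGraded 0 q)
    (hy : IsShiftGraded 0 y) : IsShiftGraded 0 (quad p q y) := by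
  rw [quad_eq, smul_mul_assoc, mul_assoc, two_mul]
  refine (hp.mul (hy.mul hy)).sub (IsShiftGraded.smul (IsShiftGraded.C_eps_sq_mul ?_) _)
  have h2 := hy.mul hy.deriv.deriv
  have := hq.mul ((h2.add h2).sub (hy.deriv.mul hy.deriv))
  simpa using this

/-! ### The filtration by total order -/

/-- The ideal of double series of total order at least `N`. -/
def orderIdeal (R : Type) [CommRing R] (N : ℕ) : Ideal (PowerSeries (PowerSeries R)) where
  carrier := {f | ∀ k d, k + d < N → PowerSeries.coeff d (PowerSeries.coeff k f) = 0}
  zero_mem' := by simp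
  add_mem' {f g} hf hg k d h := by simp [hf k d h, hg k d h]
  smul_mem' c f hf k d h := by
    rw [smul_eq_mul, PowerSeries.coeff_mul, map_sum]
    refine Finset.sum_eq_zero fun x hx => ?_
    rw [PowerSeries.coeff_mul]
    refine Finset.sum_eq_zero fun y hy => ?_
    have h1 := Finset.HasAntidiagonal.mem_antidiagonal.1 hx
    have h2 := Finset.HasAntidiagonal.mem_antidiagonal.1 hy
    rw [hf _ _ (by omega), mul_zero]

theorem mul_mem_orderIdeal {R : Type} [CommRing R] {M N : ℕ} {f g : PowerSeries (PowerSeries R)}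
    (hf : f ∈ orderIdeal R M) (hg : g ∈ orderIdeal R N) : f * g ∈ orderIdeal R (M + N) := by
  intro k d h
  rw [PowerSeries.coeff_mul, map_sum]
  refine Finset.sum_eq_zero fun x hx => ?_
  rw [PowerSeries.coeff_mul]
  refine Finset.sum_eq_zero fun y hy => ?_
  have h1 := Finset.HasAntidiagonal.mem_antidiagonal.1 hx
  have h2 := Finset.HasAntidiagonal.mem_antidiagonal.1 hy
  by_cases h3 : x.1 + y.1 < M
  · rw [hf _ _ h3, zero_mul]
  · rw [hg _ _ (by omega), mul_zero]

theorem mem_orderIdeal_one {R : Type} [CommRing R] {f : PowerSeries (PowerSeries R)} :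
    f ∈ orderIdeal R 1 ↔ PowerSeries.coeff 0 (PowerSeries.coeff 0 f) = 0 := by
  refine ⟨fun h => h 0 0 one_pos, fun h k d hkd => ?_⟩
  obtain rfl : k = 0 := by omega
  obtain rfl : d = 0 := by omega
  exact h

theorem orderIdeal_anti {R : Type} [CommRing R] {M N : ℕ} (h : M ≤ N) :
    orderIdeal R N ≤ orderIdeal R M := fun _ hf k d hkd => hf k d (by omega)

theorem eq_of_sub_mem_orderIdeal {R : Type} [CommRing R] {f g : PowerSeries (PowerSeries R)}
    (h : ∀ N, f - g ∈ orderIdeal R N) : f = g :=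
  series_ext fun k d => by
    have := h (k + d + 1) k d (by omega)
    rwa [map_sub, map_sub, sub_eq_zero] at this

theorem smul_mem_orderIdeal {R : Type} [CommRing R] [Algebra ℝ R] {N : ℕ}
    {f : PowerSeries (PowerSeries R)} (c : ℝ) (hf : f ∈ orderIdeal R N) :
    c • f ∈ orderIdeal R N := fun k d h => by
  rw [coeff_smul_ser, coeff_smul_ser, hf k d h, smul_zero]

theorem seriesDer_mem_orderIdeal {r : ℕ} {U : TopologicalSpace.Opens (Fin r → ℝ)} {N : ℕ}
    (T : Derivation ℝ (DiffPoly U) (DiffPoly U)) {f : PowerSeries (DiffSeries U)}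
    (hf : f ∈ orderIdeal (DiffPoly U) N) : seriesDer T f ∈ orderIdeal (DiffPoly U) N :=
  fun k d h => by rw [coeff_seriesDer, hf k d h, map_zero]

theorem C_eps_sq_mem_orderIdeal {r : ℕ} {U : TopologicalSpace.Opens (Fin r → ℝ)} :
    PowerSeries.C (eps U ^ 2) ∈ orderIdeal (DiffPoly U) 1 := by
  rw [mem_orderIdeal_one]
  simp [eps]

theorem quad_difference {S : Type} [CommRing S] (p e y y1 y2 z z1 z2 : S) :
    p * (y * y) - e * (2 * (y * y2) - y1 * y1) - (p * (z * z) - e * (2 * (z * z2) - z1 * z1))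
        - p * (y + z) * (y - z)
      = -e * (2 * y2 * (y - z) + 2 * z * (y2 - z2) - (y1 + z1) * (y1 - z1)) := by
  ring

/-- The linearisation of `quad` is `p (y + z)` times the difference, up to terms with a factor `ε²`;
`∂_x` does not lower the order, so these terms are of higher order. -/
theorem quad_sub_quad_mem {r : ℕ} {U : TopologicalSpace.Opens (Fin r → ℝ)} {N : ℕ}
    (p q : PowerSeries (DiffSeries U)) {y z : PowerSeries (DiffSeries U)}
    (h : y - z ∈ orderIdeal (DiffPoly U) N) :
    quad p q y - quad p q z - p * (y + z) * (y - z) ∈ orderIdeal (DiffPoly U) (N + 1) := by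
  have hQ : (1 / 4 : ℝ) • (PowerSeries.C (eps U ^ 2) * q) ∈ orderIdeal (DiffPoly U) 1 :=
    smul_mem_orderIdeal _ (Ideal.mul_mem_right _ _ C_eps_sq_mem_orderIdeal)
  have h2 := seriesDer_mem_orderIdeal (dx U) h
  have h3 := seriesDer_mem_orderIdeal (dx U) h2
  rw [quad_eq, quad_eq, quad_difference, ← map_sub, ← map_sub, add_comm N]
  refine mul_mem_orderIdeal (Ideal.neg_mem_iff _ |>.2 hQ) ?_
  exact Ideal.sub_mem _ (Ideal.add_mem _ (Ideal.mul_mem_left _ _ h)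
    (Ideal.mul_mem_left _ _ h3)) (Ideal.mul_mem_left _ _ h2)

/-! ### Existence and uniqueness of the series `b` and `c` -/

/-- The approximate Newton step for `quad p q y = 1`, with `c` the leading coefficient of `y`. -/
def newtonStep {r : ℕ} {U : TopologicalSpace.Opens (Fin r → ℝ)} (p q : PowerSeries (DiffSeries U))
    (c : DiffPoly U) (y : PowerSeries (DiffSeries U)) : PowerSeries (DiffSeries U) :=
  y - ((1 / 2 : ℝ) • PowerSeries.C (PowerSeries.C c)) * (quad p q y - 1)

theorem coeff_zero_mul {R : Type} [CommRing R] (f g : PowerSeries (PowerSeries R)) :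
    PowerSeries.coeff 0 (PowerSeries.coeff 0 (f * g)) = PowerSeries.coeff 0 (PowerSeries.coeff 0 f)
      * PowerSeries.coeff 0 (PowerSeries.coeff 0 g) := by
  simp

theorem coeff_zero_C {R : Type} [CommRing R] (x : R) :
    PowerSeries.coeff 0 (PowerSeries.coeff 0 (PowerSeries.C (PowerSeries.C x))) = x := by
  simp

theorem coeff_zero_one {R : Type} [CommRing R] :
    PowerSeries.coeff 0 (PowerSeries.coeff 0 (1 : PowerSeries (PowerSeries R))) = 1 := by
  simp

section

variable {r : ℕ} {U : TopologicalSpace.Opens (Fin r → ℝ)} {p q : PowerSeries (DiffSeries U)}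
  {c : DiffPoly U}

theorem coeff_zero_quad (y : PowerSeries (DiffSeries U)) :
    PowerSeries.coeff 0 (PowerSeries.coeff 0 (quad p q y))
      = PowerSeries.coeff 0 (PowerSeries.coeff 0 p) * (PowerSeries.coeff 0 (PowerSeries.coeff 0 y)
        * PowerSeries.coeff 0 (PowerSeries.coeff 0 y)) := by
  rw [quad_eq, map_sub, map_sub, coeff_zero_mul, coeff_zero_mul, coeff_zero_mul, coeff_smul_ser,
    coeff_smul_ser, coeff_zero_mul, mem_orderIdeal_one.1 C_eps_sq_mem_orderIdeal]
  simp

/-- The Newton factor `c/2` inverts the leading coefficient `2 p₀ c` of the linearisation, since `p₀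
c² = 1`. Each step therefore gains one order. -/
theorem newtonStep_sub_mem (hc : PowerSeries.coeff 0 (PowerSeries.coeff 0 p) * (c * c) = 1) {N : ℕ}
    {y z : PowerSeries (DiffSeries U)} (hy : PowerSeries.coeff 0 (PowerSeries.coeff 0 y) = c)
    (hz : PowerSeries.coeff 0 (PowerSeries.coeff 0 z) = c) (h : y - z ∈ orderIdeal (DiffPoly U) N) :
    newtonStep p q c y - newtonStep p q c z ∈ orderIdeal (DiffPoly U) (N + 1) := by
  set u : PowerSeries (DiffSeries U) := (1 / 2 : ℝ) • PowerSeries.C (PowerSeries.C c) with hu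
  have e : newtonStep p q c y - newtonStep p q c z
      = (1 - u * (p * (y + z))) * (y - z)
        - u * (quad p q y - quad p q z - p * (y + z) * (y - z)) := by
    rw [newtonStep, newtonStep, ← hu]
    ring
  rw [e]
  refine Ideal.sub_mem _ ?_ (Ideal.mul_mem_left _ _ (quad_sub_quad_mem p q h))
  rw [add_comm N]
  refine mul_mem_orderIdeal (mem_orderIdeal_one.2 ?_) h
  rw [map_sub, map_sub, coeff_zero_one, coeff_zero_mul, coeff_zero_mul, map_add, map_add, hy, hz,
    hu, coeff_smul_ser, coeff_smul_ser, coeff_zero_C, ← two_smul ℝ c, mul_smul_comm,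
    smul_mul_smul_comm, mul_left_comm, hc]
  norm_num

theorem newtonStep_eq_self {y : PowerSeries (DiffSeries U)} (h : quad p q y = 1) :
    newtonStep p q c y = y := by
  rw [newtonStep, h, sub_self, mul_zero, sub_zero]

theorem quad_eq_one_unique (hc : PowerSeries.coeff 0 (PowerSeries.coeff 0 p) * (c * c) = 1)
    {y z : PowerSeries (DiffSeries U)} (hy : PowerSeries.coeff 0 (PowerSeries.coeff 0 y) = c)
    (hz : PowerSeries.coeff 0 (PowerSeries.coeff 0 z) = c) (hqy : quad p q y = 1)
    (hqz : quad p q z = 1) : y = z := by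
  refine eq_of_sub_mem_orderIdeal fun N => ?_
  induction N with
  | zero => exact fun k d h => absurd h (Nat.not_lt_zero _)
  | succ N ih =>
    have := newtonStep_sub_mem (q := q) hc hy hz ih
    rwa [newtonStep_eq_self hqy, newtonStep_eq_self hqz] at this

theorem exists_quad_eq_one {c : SmoothFn U}
    (hc : PowerSeries.coeff 0 (PowerSeries.coeff 0 p) * (MvPolynomial.C c * MvPolynomial.C c) = 1)
    (hp : IsShiftGraded 0 p) (hq : IsShiftGraded 0 q) :
    ∃ y : PowerSeries (DiffSeries U), IsShiftGraded 0 y ∧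
      PowerSeries.coeff 0 (PowerSeries.coeff 0 y) = MvPolynomial.C c ∧ quad p q y = 1 := by
  set T := newtonStep p q (MvPolynomial.C c) with hT
  set y0 : PowerSeries (DiffSeries U) := PowerSeries.C (PowerSeries.C (MvPolynomial.C c)) with hy0
  have hlead : ∀ y, PowerSeries.coeff 0 (PowerSeries.coeff 0 y) = MvPolynomial.C c →
      PowerSeries.coeff 0 (PowerSeries.coeff 0 (T y)) = MvPolynomial.C c := by
    intro y hy
    rw [hT, newtonStep, map_sub, map_sub, coeff_zero_mul, map_sub, map_sub, coeff_zero_quad, hy, hc,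
      coeff_zero_one, sub_self, mul_zero, sub_zero]
  have hl : ∀ n, PowerSeries.coeff 0 (PowerSeries.coeff 0 (T^[n] y0)) = MvPolynomial.C c := by
    intro n
    induction n with
    | zero => exact coeff_zero_C _
    | succ n ih => rw [Function.iterate_succ_apply']; exact hlead _ ih
  have hgr : ∀ n, IsShiftGraded 0 (T^[n] y0) := by
    intro n
    induction n with
    | zero => exact IsShiftGraded.C_C c
    | succ n ih =>
      rw [Function.iterate_succ_apply', hT, newtonStep]
      exact ih.sub (((IsShiftGraded.C_C c).smul _).mul ((hp.quad hq ih).sub IsShiftGraded.one))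
  have hstep : ∀ n, T^[n + 1] y0 - T^[n] y0 ∈ orderIdeal (DiffPoly U) (n + 1) := by
    intro n
    induction n with
    | zero =>
      refine mem_orderIdeal_one.2 ?_
      rw [map_sub, map_sub, hl, hl, sub_self]
    | succ n ih =>
      rw [Function.iterate_succ_apply' T (n + 1), Function.iterate_succ_apply' T n]
      rw [Function.iterate_succ_apply' T n] at ih
      exact newtonStep_sub_mem hc (by rw [← Function.iterate_succ_apply' T n]; exact hl _) (hl n) ih
  have hle : ∀ n j, T^[n + j] y0 - T^[n] y0 ∈ orderIdeal (DiffPoly U) (n + 1) := by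
    intro n j
    induction j with
    | zero => simp
    | succ j ih =>
      rw [← sub_add_sub_cancel _ (T^[n + j] y0)]
      exact Ideal.add_mem _ (orderIdeal_anti (by omega) (hstep (n + j))) ih
  -- The coefficients of total order `k + d` no longer change after `k + d` iterations, so the limit
  -- is read off from that iterate.
  set y : PowerSeries (DiffSeries U) := PowerSeries.mk fun k => PowerSeries.mk fun d =>
    PowerSeries.coeff d (PowerSeries.coeff k (T^[k + d] y0)) with hy
  have hyc : ∀ k d, PowerSeries.coeff d (PowerSeries.coeff k y)
      = PowerSeries.coeff d (PowerSeries.coeff k (T^[k + d] y0)) := by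
    intro k d
    rw [hy, PowerSeries.coeff_mk, PowerSeries.coeff_mk]
  have hlim : ∀ n, y - T^[n] y0 ∈ orderIdeal (DiffPoly U) (n + 1) := by
    intro n k d h
    obtain ⟨j, rfl⟩ : ∃ j, n = k + d + j := ⟨n - (k + d), by omega⟩
    have := hle (k + d) j k d (by omega)
    rw [map_sub, map_sub, sub_eq_zero] at this
    rw [map_sub, map_sub, hyc, this, sub_self]
  have hyl : PowerSeries.coeff 0 (PowerSeries.coeff 0 y) = MvPolynomial.C c := by
    rw [hyc]; exact hl 0
  have hfix : T y = y := by
    refine eq_of_sub_mem_orderIdeal fun N => ?_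
    rw [← sub_sub_sub_cancel_right _ _ (T^[N + 1] y0)]
    refine Ideal.sub_mem _ ?_ (orderIdeal_anti (by omega) (hlim (N + 1)))
    rw [Function.iterate_succ_apply' T N]
    exact orderIdeal_anti (by omega) (newtonStep_sub_mem hc hyl (hl N) (hlim N))
  refine ⟨y, fun k d => ?_, hyl, ?_⟩
  · rw [hyc]; exact hgr _ k d
  · rw [hT, newtonStep, sub_eq_self, smul_mul_assoc] at hfix
    have h1 := (smul_eq_zero.1 hfix).resolve_left (by norm_num)
    -- A fixed point only gives `c · (quad - 1) = 0`; the factor `c` is removed with its inverse `p₀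
    -- c`.
    have h2 : (PowerSeries.C (PowerSeries.C (PowerSeries.coeff 0 (PowerSeries.coeff 0 p)
        * MvPolynomial.C c)) : PowerSeries (DiffSeries U))
        * PowerSeries.C (PowerSeries.C (MvPolynomial.C c)) = 1 := by
      rw [← map_mul, ← map_mul, mul_assoc, hc, map_one, map_one]
    have h3 := congrArg (fun f => PowerSeries.C (PowerSeries.C (PowerSeries.coeff 0
      (PowerSeries.coeff 0 p) * MvPolynomial.C c)) * f) h1
    simp only [mul_zero] at h3
    rw [← mul_assoc, h2, one_mul, sub_eq_zero] at h3
    exact h3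

end

theorem isShiftGraded_monomial {r : ℕ} {U : TopologicalSpace.Opens (Fin r → ℝ)} (k : ℕ)
    {f : DiffSeries U} (hf : IsGraded f) : IsShiftGraded 0 (PowerSeries.monomial k f) := by
  intro j d
  rw [PowerSeries.coeff_monomial]
  split_ifs
  · exact hf d
  · exact MvPolynomial.isWeightedHomogeneous_zero _ _ _

theorem isGraded_C {r : ℕ} {U : TopologicalSpace.Opens (Fin r → ℝ)} (x : SmoothFn U) :
    IsGraded (PowerSeries.C (MvPolynomial.C x) : DiffSeries U) := by
  have := IsShiftGraded.C_C x 0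
  intro d
  simpa using this d

theorem isGraded_wI {r : ℕ} {U : TopologicalSpace.Opens (Fin r → ℝ)} (k : ℤ) :
    IsGraded (wI U k) := by
  rw [wI]
  split_ifs
  · exact isGraded_C _
  · simpa using isGraded_C (1 : SmoothFn U)
  · exact fun d => MvPolynomial.isWeightedHomogeneous_zero _ _ _

theorem isGraded_smul_one {r : ℕ} {U : TopologicalSpace.Opens (Fin r → ℝ)} (x : ℝ) :
    IsGraded (x • (1 : DiffSeries U)) := by
  have h := (IsShiftGraded.one (U := U)).smul x
  intro d
  have := h 0 d
  rwa [coeff_smul_ser, PowerSeries.coeff_zero_one] at this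

theorem IsShiftGraded.sum {r : ℕ} {U : TopologicalSpace.Opens (Fin r → ℝ)} {ι : Type}
    (s : Finset ι) {f : ι → PowerSeries (DiffSeries U)} (h : ∀ i ∈ s, IsShiftGraded 0 (f i)) :
    IsShiftGraded 0 (∑ i ∈ s, f i) := by
  intro k d
  rw [map_sum, map_sum]
  exact MvPolynomial.IsWeightedHomogeneous.sum _ _ _ fun i hi => h i hi k d

theorem isShiftGraded_wSeries {r : ℕ} {U : TopologicalSpace.Opens (Fin r → ℝ)} (e : ℕ → ℕ) :
    IsShiftGraded 0 (∑ i ∈ Finset.range (r + 1), PowerSeries.monomial (e i) (wI U i)) :=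
  IsShiftGraded.sum _ fun _ _ => isShiftGraded_monomial _ (isGraded_wI _)

theorem isShiftGraded_aSeries {r : ℕ} {U : TopologicalSpace.Opens (Fin r → ℝ)}
    (a : Fin (r + 1) → ℝ) (e : ℕ → ℕ) :
    IsShiftGraded 0 (∑ i ∈ Finset.range (r + 1),
      PowerSeries.monomial (e i) (aI a i • (1 : DiffSeries U))) :=
  IsShiftGraded.sum _ fun _ _ => isShiftGraded_monomial _ (isGraded_smul_one _)

theorem coeff_zero_sum_monomial {R : Type} [CommRing R] (n : ℕ) (e : ℕ → ℕ) (f : ℕ → R) {k : ℕ}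
    (hk : k < n) (he : ∀ i < n, e i = 0 ↔ i = k) :
    PowerSeries.coeff 0 (∑ i ∈ Finset.range n, PowerSeries.monomial (e i) (f i)) = f k := by
  rw [map_sum, Finset.sum_eq_single k]
  · rw [(he k hk).2 rfl, PowerSeries.coeff_monomial_same]
  · intro i hi hik
    rw [PowerSeries.coeff_monomial, if_neg]
    exact fun h => hik ((he i (Finset.mem_range.1 hi)).1 h.symm)
  · intro h
    exact absurd (Finset.mem_range.2 hk) h

theorem wI_self {r : ℕ} {U : TopologicalSpace.Opens (Fin r → ℝ)} : wI U (r : ℤ) = 1 := by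
  rw [wI, dif_neg (by omega), if_pos rfl]

theorem wI_zero {r : ℕ} {U : TopologicalSpace.Opens (Fin r → ℝ)} (hr : 0 < r) :
    wI U ((0 : ℕ) : ℤ) = PowerSeries.C (MvPolynomial.C (coord U ⟨0, hr⟩)) := by
  rw [wI, dif_pos (by omega)]
  rfl

/-- Taking the constant term in the spectral variable is compatible with the equation, so the zeroth
coefficient of a solution solves an equation of its own. -/
theorem quad_C_coeff_zero {r : ℕ} {U : TopologicalSpace.Opens (Fin r → ℝ)}
    (p q y : PowerSeries (DiffSeries U)) :
    quad (PowerSeries.C (PowerSeries.coeff 0 p)) (PowerSeries.C (PowerSeries.coeff 0 q))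
      (PowerSeries.C (PowerSeries.coeff 0 y)) = PowerSeries.C (PowerSeries.coeff 0 (quad p q y)) := by
  have hD : ∀ f : PowerSeries (DiffSeries U),
      seriesDer (dx U) (PowerSeries.C (PowerSeries.coeff 0 f))
        = PowerSeries.C (PowerSeries.coeff 0 (seriesDer (dx U) f)) := by
    intro f
    change coeffwise _ _ = PowerSeries.C (PowerSeries.coeff 0 (coeffwise _ _))
    rw [coeffwise_C, coeff_coeffwise]
  have hs : ∀ (x : ℝ) (f : DiffSeries U), PowerSeries.C (x • f) = x • PowerSeries.C f := by
    intro x f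
    ext k : 1
    rw [coeff_smul_ser, PowerSeries.coeff_C, PowerSeries.coeff_C]
    split_ifs <;> simp
  rw [quad_eq, quad_eq, hD, hD]
  simp only [PowerSeries.coeff_zero_eq_constantCoeff_apply, map_sub, map_mul, two_mul, map_add]
  congr 2
  have h : PowerSeries.constantCoeff ((1 / 4 : ℝ) • (PowerSeries.C (eps U ^ 2) * q))
      = (1 / 4 : ℝ) • (eps U ^ 2 * PowerSeries.constantCoeff q) := by
    have := coeff_smul_ser (1 / 4 : ℝ) (PowerSeries.C (eps U ^ 2) * q) 0
    rwa [PowerSeries.coeff_zero_eq_constantCoeff_apply,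
      PowerSeries.coeff_zero_eq_constantCoeff_apply, map_mul, PowerSeries.constantCoeff_C] at this
  rw [h, hs, map_mul]

theorem quad_one {r : ℕ} {U : TopologicalSpace.Opens (Fin r → ℝ)}
    (p q : PowerSeries (DiffSeries U)) : quad p q 1 = p := by
  rw [quad_eq, Derivation.map_one_eq_zero, map_zero]
  simp

theorem existsUnique_isPositiveSeries {r : ℕ} (a : Fin (r + 1) → ℝ)
    (U : TopologicalSpace.Opens (Fin r → ℝ)) :
    ∃! b : PowerSeries (DiffSeries U), IsPositiveSeries a b := by
  set p : PowerSeries (DiffSeries U) :=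
    ∑ i ∈ Finset.range (r + 1), PowerSeries.monomial (r - i) (wI U i) with hp
  set q : PowerSeries (DiffSeries U) := ∑ i ∈ Finset.range (r + 1),
    PowerSeries.monomial (r - i) (aI a i • (1 : DiffSeries U)) with hq
  have hp0 : PowerSeries.coeff 0 p = 1 := by
    rw [hp, coeff_zero_sum_monomial (r + 1) (fun i => r - i) (fun i => wI U i) (Nat.lt_succ_self r)
      (by intro i hi; omega), wI_self]
  have hc : PowerSeries.coeff 0 (PowerSeries.coeff 0 p)
      * (MvPolynomial.C (1 : SmoothFn U) * MvPolynomial.C 1) = (1 : DiffPoly U) := by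
    rw [hp0]; simp
  have hlead : ∀ b, PowerSeries.coeff 0 b = (1 : DiffSeries U) →
      PowerSeries.coeff 0 (PowerSeries.coeff 0 b) = MvPolynomial.C (1 : SmoothFn U) := by
    intro b hb
    rw [hb]; simp
  obtain ⟨b, hb1, hb2, hb3⟩ := exists_quad_eq_one hc (isShiftGraded_wSeries fun i => r - i)
    (isShiftGraded_aSeries a fun i => r - i)
  refine ⟨b, ⟨hb1, ?_, hb3⟩, fun y hy => ?_⟩
  -- The iteration controls only the `ε⁰` part of `b_0`. Because `w^r = 1`, both `b_0` and `1` solve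
  -- the equation for the zeroth coefficient with the same leading term, so `b_0 = 1` to all orders
  -- in `ε`.
  · have h1 := quad_C_coeff_zero p q b
    rw [hb3] at h1
    have h2 := quad_one (PowerSeries.C (PowerSeries.coeff 0 p)) (PowerSeries.C (PowerSeries.coeff 0 q))
    rw [hp0] at h1 h2
    have h3 := quad_eq_one_unique (c := MvPolynomial.C (1 : SmoothFn U)) (by simp)
      (by simpa using hb2) (by simp) (h1.trans (by simp)) (h2.trans (by simp))
    simpa using congrArg (PowerSeries.coeff 0) h3
  · exact quad_eq_one_unique hc (hlead y hy.2.1) hb2 hy.2.2 hb3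

/-- All jet variables have positive weight, so no monomial but the trivial one has weight zero. -/
theorem eq_C_of_isWeightedHomogeneous_zero {r : ℕ} {U : TopologicalSpace.Opens (Fin r → ℝ)}
    {f : DiffPoly U} (hf : MvPolynomial.IsWeightedHomogeneous (jetWeight r) f 0) :
    f = MvPolynomial.C (MvPolynomial.coeff 0 f) := by
  refine hf.eq_monomial_of_unique_weight fun m hm => ?_
  ext q
  have h := Finsupp.le_weight (jetWeight r) (Nat.succ_ne_zero q.2 : jetWeight r q ≠ 0) m
  simp only [Finsupp.coe_zero, Pi.zero_apply]
  omega

/-- The function `(w^0)^{-1/2}` on a domain where `w^0` is positive. -/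
def invSqrtCoord {r : ℕ} (hr : 0 < r) (U : TopologicalSpace.Opens (Fin r → ℝ))
    (hpos : ∀ w ∈ U, 0 < w ⟨0, hr⟩) : SmoothFn U :=
  (⟨fun x => (Real.sqrt (x.1 ⟨0, hr⟩))⁻¹, extendZero_contDiffOn_congr
    (g := fun x => (Real.sqrt (x ⟨0, hr⟩))⁻¹)
    (((contDiff_apply ℝ ℝ (⟨0, hr⟩ : Fin r)).contDiffOn.sqrt fun x hx => (hpos x hx).ne').inv
      fun x hx => (Real.sqrt_pos.2 (hpos x hx)).ne') fun _ => rfl⟩ : Smooth U)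

theorem smoothFn_ext {r : ℕ} {U : TopologicalSpace.Opens (Fin r → ℝ)} {f g : SmoothFn U}
    (h : ∀ x, f.eval x = g.eval x) : f = g :=
  Subtype.ext (funext h)

/-- By the grading, the `ε⁰` part of `c_0` is a function `f` on `U`, and the equation forces `w^0 f²
= 1`. Positivity selects `f = (w^0)^{-1/2}`, after which the solution is determined. -/
theorem existsUnique_isNegativeSeries {r : ℕ} (hr : 0 < r) (a : Fin (r + 1) → ℝ)
    (U : TopologicalSpace.Opens (Fin r → ℝ)) (hpos : ∀ w ∈ U, 0 < w ⟨0, hr⟩) :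
    ∃! c : PowerSeries (DiffSeries U), IsNegativeSeries a c ∧ HasPositiveLeadingTerm c := by
  set p : PowerSeries (DiffSeries U) :=
    ∑ i ∈ Finset.range (r + 1), PowerSeries.monomial i (wI U i) with hp
  have hp0 : PowerSeries.coeff 0 (PowerSeries.coeff 0 p)
      = MvPolynomial.C (coord U ⟨0, hr⟩) := by
    rw [hp, coeff_zero_sum_monomial (r + 1) (fun i => i) (fun i => wI U i) (Nat.succ_pos r)
      (by intro i hi; rfl), wI_zero hr, PowerSeries.coeff_zero_C]
  have hval : ∀ x : U, (invSqrtCoord hr U hpos).eval x = (Real.sqrt (x.1 ⟨0, hr⟩))⁻¹ :=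
    fun x => rfl
  have hc1 : coord U ⟨0, hr⟩ * (invSqrtCoord hr U hpos * invSqrtCoord hr U hpos) = 1 := by
    refine smoothFn_ext fun x => ?_
    change x.1 ⟨0, hr⟩ * ((Real.sqrt (x.1 ⟨0, hr⟩))⁻¹ * (Real.sqrt (x.1 ⟨0, hr⟩))⁻¹) = 1
    rw [← mul_inv, Real.mul_self_sqrt (hpos _ x.2).le, mul_inv_cancel₀ (hpos _ x.2).ne']
  have hc : PowerSeries.coeff 0 (PowerSeries.coeff 0 p)
      * (MvPolynomial.C (invSqrtCoord hr U hpos) * MvPolynomial.C (invSqrtCoord hr U hpos)) = 1 := by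
    rw [hp0, ← map_mul, ← map_mul, hc1, map_one]
  have hlead : ∀ y, IsNegativeSeries a y ∧ HasPositiveLeadingTerm y →
      PowerSeries.coeff 0 (PowerSeries.coeff 0 y)
        = MvPolynomial.C (invSqrtCoord hr U hpos) := by
    rintro y ⟨⟨hy1, hy2⟩, hy3⟩
    have h1 := eq_C_of_isWeightedHomogeneous_zero (hy1 0 0)
    have h2 := congrArg (fun f => PowerSeries.coeff 0 (PowerSeries.coeff 0 f)) hy2
    simp only [coeff_zero_quad, coeff_zero_one] at h2
    rw [← hp, hp0, h1, ← map_mul, ← map_mul, ← map_one MvPolynomial.C] at h2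
    have h3 := MvPolynomial.C_injective _ _ h2
    rw [h1]
    congr 1
    refine smoothFn_ext fun x => ?_
    have h4 : x.1 ⟨0, hr⟩ * ((MvPolynomial.coeff 0 (PowerSeries.coeff 0 (PowerSeries.coeff 0 y))).eval x
        * (MvPolynomial.coeff 0 (PowerSeries.coeff 0 (PowerSeries.coeff 0 y))).eval x) = 1 :=
      congrArg (fun f => f.eval x) h3
    have h5 := hy3 x
    rw [hval]
    refine eq_inv_of_mul_eq_one_left ?_
    have h6 := Real.sq_sqrt (hpos _ x.2).le
    have h7 := Real.sqrt_pos.2 (hpos _ x.2)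
    refine (pow_eq_one_iff_of_nonneg (mul_pos h5 h7).le two_ne_zero).1 ?_
    rw [mul_pow, h6]
    linarith
  obtain ⟨y, hy1, hy2, hy3⟩ := exists_quad_eq_one hc (isShiftGraded_wSeries fun i => i)
    (isShiftGraded_aSeries a fun i => i)
  refine ⟨y, ⟨⟨hy1, hy3⟩, fun x => ?_⟩, fun z hz => ?_⟩
  · rw [hy2, MvPolynomial.coeff_zero_C, hval]
    exact inv_pos.2 (Real.sqrt_pos.2 (hpos _ x.2))
  · exact quad_eq_one_unique hc (hlead z hz) hy2 hz.1.2 hy3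

/-! ### The flows -/

/-- The coefficient of a power series at an integer index, zero at negative indices. -/
def coeffInt {R : Type} [CommRing R] (f : PowerSeries R) (l : ℤ) : R :=
  if 0 ≤ l then PowerSeries.coeff l.toNat f else 0

theorem coeffInt_neg {R : Type} [CommRing R] (f : PowerSeries R) {l : ℤ} (hl : l < 0) :
    coeffInt f l = 0 := if_neg (by omega)

theorem coeffInt_seriesDer {r : ℕ} {U : TopologicalSpace.Opens (Fin r → ℝ)}
    (f : PowerSeries (DiffSeries U)) (l : ℤ) :
    coeffInt (seriesDer (dx U) f) l = Dx U (coeffInt f l) := by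
  rw [coeffInt, coeffInt]
  split_ifs
  · exact coeff_coeffwise _ _ _
  · rw [map_zero]

theorem coeff_sum_monomial_mul {R : Type} [CommRing R] (s : Finset ℕ) (e : ℕ → ℕ) (x : ℕ → R)
    (f : PowerSeries R) (n : ℕ) :
    PowerSeries.coeff n ((∑ i ∈ s, PowerSeries.monomial (e i) (x i)) * f)
      = ∑ i ∈ s, x i * coeffInt f ((n : ℤ) - e i) := by
  rw [Finset.sum_mul, map_sum]
  refine Finset.sum_congr rfl fun i _ => ?_
  have : PowerSeries.monomial (e i) (x i) = PowerSeries.C (x i) * PowerSeries.X ^ (e i) := by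
    ext k
    rw [PowerSeries.coeff_monomial, PowerSeries.coeff_C_mul, PowerSeries.coeff_X_pow]
    split_ifs <;> simp
  rw [this, mul_assoc, PowerSeries.coeff_C_mul, PowerSeries.coeff_X_pow_mul', coeffInt]
  congr 1
  by_cases h : e i ≤ n
  · rw [if_pos h, if_pos (by omega), show ((n : ℤ) - e i).toNat = n - e i by omega]
  · rw [if_neg h, if_neg (by omega)]

theorem seriesDer_sum_monomial {r : ℕ} {U : TopologicalSpace.Opens (Fin r → ℝ)}
    (T : Derivation ℝ (DiffPoly U) (DiffPoly U)) (s : Finset ℕ) (e : ℕ → ℕ) (x : ℕ → DiffSeries U) :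
    seriesDer T (∑ i ∈ s, PowerSeries.monomial (e i) (x i))
      = ∑ i ∈ s, PowerSeries.monomial (e i) (coeffwiseDer T (x i)) := by
  rw [map_sum]
  exact Finset.sum_congr rfl fun i _ => coeffwise_monomial _ _ _

theorem coeffwiseDer_eps {r : ℕ} {U : TopologicalSpace.Opens (Fin r → ℝ)}
    (T : Derivation ℝ (DiffPoly U) (DiffPoly U)) : coeffwiseDer T (eps U) = 0 := by
  rw [eps, PowerSeries.X_eq, coeffwiseDer_apply, coeffwise_monomial]
  simp

theorem coeffwiseDer_dw_wI {r : ℕ} {U : TopologicalSpace.Opens (Fin r → ℝ)} (i : Fin r) (s : ℕ)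
    (k : ℤ) : coeffwiseDer (dw U i s) (wI U k) = if k = i ∧ s = 0 then 1 else 0 := by
  have hi := i.2
  rw [wI]
  by_cases h : 0 ≤ k ∧ k < r
  · rw [dif_pos h, coeffwiseDer_apply, coeffwise_C, Derivation.coeFn_coe, dw_coord]
    have : (⟨k.toNat, by omega⟩ : Fin r) = i ↔ k = i := by rw [Fin.ext_iff]; simp; omega
    simp only [this]
    split_ifs <;> simp
  · rw [dif_neg h]
    by_cases hk : k = r
    · rw [if_pos hk, if_neg (by omega)]
      exact Derivation.map_one_eq_zero _
    · rw [if_neg hk, if_neg (by omega)]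
      exact map_zero _

/-! ### Both expansions at once: `e i = r - i` for powers of `λ⁻¹` and `e i = i` for powers of `λ`.
-/

section

variable {r : ℕ} {U : TopologicalSpace.Opens (Fin r → ℝ)} (a : Fin (r + 1) → ℝ) (e : ℕ → ℕ)

/-- The series `(ε^2/4) â`, with `λ^i` replaced by the power `e i` of the variable. -/
def quarterSeries : PowerSeries (DiffSeries U) :=
  (1 / 4 : ℝ) • (PowerSeries.C (eps U ^ 2) * ∑ i ∈ Finset.range (r + 1),
    PowerSeries.monomial (e i) (aI a i • (1 : DiffSeries U)))

theorem neg_two_mul_quarterSeries :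
    -(2 * quarterSeries a e) = ∑ i ∈ Finset.range (r + 1),
      PowerSeries.monomial (e i) (cubicCoeff U a i) := by
  have h : ∀ (c : ℝ) (k : ℕ) (f : DiffSeries U),
      c • PowerSeries.monomial k f = PowerSeries.monomial k (c • f) := by
    intro c k f
    ext j : 1
    rw [coeff_smul_ser, PowerSeries.coeff_monomial, PowerSeries.coeff_monomial]
    split_ifs <;> simp
  have h2 : ∀ f : PowerSeries (DiffSeries U), -(2 * ((1 / 4 : ℝ) • f)) = (-1 / 2 : ℝ) • f := by
    intro f
    rw [two_mul, ← add_smul, ← neg_smul]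
    norm_num
  rw [quarterSeries, h2, Finset.mul_sum, Finset.smul_sum]
  refine Finset.sum_congr rfl fun i _ => ?_
  have h3 : PowerSeries.C (eps U ^ 2) * PowerSeries.monomial (e i) (aI a i • (1 : DiffSeries U))
      = PowerSeries.monomial (e i) (aI a i • eps U ^ 2) := by
    ext j : 1
    rw [PowerSeries.coeff_C_mul, PowerSeries.coeff_monomial, PowerSeries.coeff_monomial]
    split_ifs
    · rw [mul_smul_comm, mul_one]
    · rw [mul_zero]
  rw [h3, h, cubicCoeff, smul_smul]
  congr 2
  ring

theorem seriesDer_quarterSeries (T : Derivation ℝ (DiffPoly U) (DiffPoly U)) :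
    seriesDer T (quarterSeries a e) = 0 := by
  have h : ∀ c : ℝ, coeffwiseDer T (c • (1 : DiffSeries U)) = 0 := by
    intro c
    rw [Derivation.map_smul, Derivation.map_one_eq_zero, smul_zero]
  have h2 : seriesDer T (PowerSeries.C (eps U ^ 2)) = 0 := by
    rw [seriesDer, coeffwiseDer_apply, coeffwise_C, Derivation.coeFn_coe, pow_two,
      Derivation.leibniz, coeffwiseDer_eps]
    simp
  rw [quarterSeries, Derivation.map_smul, Derivation.leibniz, h2, seriesDer_sum_monomial]
  simp [h]

variable {a e}

/-- A solution of the quadratic equation is annihilated by `∑_k 𝒟_k λ^k`. -/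
theorem sum_opD_coeffInt_eq_zero {b β : PowerSeries (DiffSeries U)}
    (hb : quad (∑ i ∈ Finset.range (r + 1), PowerSeries.monomial (e i) (wI U i))
      (∑ i ∈ Finset.range (r + 1), PowerSeries.monomial (e i) (aI a i • (1 : DiffSeries U))) b = 1)
    (hβ : b * β = 1) (n : ℤ) :
    ∑ k ∈ Finset.range (r + 1), DiffOp.apply (opD U a k) (coeffInt b (n - e k)) = 0 := by
  set p : PowerSeries (DiffSeries U) :=
    ∑ i ∈ Finset.range (r + 1), PowerSeries.monomial (e i) (wI U i) with hp
  rw [quad_eq, ← quarterSeries] at hb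
  set D := seriesDer (dx U) with hD
  have hDq : D (quarterSeries a e) = 0 := seriesDer_quarterSeries a e _
  have h1 : D p * b + (p + p) * D b + -(2 * quarterSeries a e) * D (D (D b)) = 0 := by
    have h := congrArg D hb
    simp only [map_sub, map_add, two_mul, Derivation.leibniz, hDq, Derivation.map_one_eq_zero,
      smul_eq_mul] at h
    -- The derivative of the quadratic expression is `b` times the third-order linear one, so
    -- multiplication by `β = b⁻¹` isolates the latter.
    linear_combination β * h - (D p * b + (p + p) * D b + -(2 * quarterSeries a e) * D (D (D b))) * hβ
  have hpp : p + p = ∑ i ∈ Finset.range (r + 1), PowerSeries.monomial (e i) (2 * wI U i) := by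
    rw [hp, ← Finset.sum_add_distrib]
    exact Finset.sum_congr rfl fun i _ => by rw [two_mul, map_add]
  rw [neg_two_mul_quarterSeries, hpp, hp, hD, seriesDer_sum_monomial, ← hD] at h1
  by_cases hn : 0 ≤ n
  · lift n to ℕ using hn
    have h2 := congrArg (PowerSeries.coeff n) h1
    simp only [map_add, coeff_sum_monomial_mul, hD, coeffInt_seriesDer, map_zero,
      ← Finset.sum_add_distrib] at h2
    refine (Finset.sum_congr rfl fun k _ => ?_).trans h2
    rw [← one_smul ℝ (opD U a k), opD_apply, one_smul, add_comm (2 * wI U k * _)]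
    rfl
  · refine Finset.sum_eq_zero fun k _ => ?_
    rw [coeffInt_neg _ (by omega), ← one_smul ℝ (opD U a k), opD_apply]
    simp

/-- The variational derivatives of the coefficients of `2 / b`. -/
theorem deltaW_coeff_inverse {b β : PowerSeries (DiffSeries U)}
    (hb : quad (∑ i ∈ Finset.range (r + 1), PowerSeries.monomial (e i) (wI U i))
      (∑ i ∈ Finset.range (r + 1), PowerSeries.monomial (e i) (aI a i • (1 : DiffSeries U))) b = 1)
    (hβ : b * β = 1) (i : Fin r) (K : ℕ) :
    deltaW U i (functional (2 * PowerSeries.coeff K β)) = incl U (coeffInt b (K - e i)) := by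
  rw [quad_eq, ← quarterSeries] at hb
  rw [deltaW_functional_inverse i (fun s => ?_) (fun s => seriesDer_quarterSeries a e _)
    (seriesDer_quarterSeries a e _) hβ hb K, seriesDer_sum_monomial, coeff_sum_monomial_mul,
    Finset.sum_eq_single (i : ℕ)]
  · rw [coeffwiseDer_dw_wI, if_pos ⟨rfl, rfl⟩, one_mul]
  · intro k _ hk
    rw [coeffwiseDer_dw_wI, if_neg (by omega), zero_mul]
  · intro h
    have := i.2
    exact absurd (Finset.mem_range.2 (by omega)) h
  · rw [seriesDer_sum_monomial]
    refine Finset.sum_eq_zero fun k _ => ?_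
    rw [coeffwiseDer_dw_wI, if_neg (by omega), map_zero]

end

/-! ### From rows of the block operators to coefficients of the flow. -/

theorem sum_range_add_add {A : Type} [AddCommMonoid A] (G : ℕ → A) (x y z : ℕ) :
    ∑ k ∈ Finset.range (x + (y + z)), G k = ∑ k ∈ Finset.range x, G k
      + (∑ k ∈ Finset.range y, G (x + k) + ∑ k ∈ Finset.range z, G (x + (y + k))) := by
  rw [Finset.sum_range_add, Finset.sum_range_add]

/-- This is why all the operators generate one flow: the right side does not involve `m`. A row in
the upper block yields the lower partial sum, a row in the lower block yields minus the
complementary one, and the two agree because the full sum is zero. -/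
theorem sum_blockSign_smul {A : Type} [AddCommGroup A] [Module ℝ A] {r : ℕ} (F : ℤ → A)
    (hneg : ∀ k, k < 0 → F k = 0) (hlarge : ∀ k, (r : ℤ) < k → F k = 0)
    (hsum : ∑ k ∈ Finset.range (r + 1), F k = 0) {m : ℕ} (hm : m ≤ r) (j : Fin r) :
    ∑ i : Fin r, blockSign m j i • F ((j : ℤ) + i + 1 - m)
      = ∑ k ∈ Finset.range (r + 1), if (k : ℤ) ≤ j then F k else 0 := by
  have hj := j.2
  have hlow : ∑ k ∈ Finset.range (r + 1), (if (k : ℤ) ≤ j then F k else 0)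
      = ∑ k ∈ Finset.range ((j : ℕ) + 1), F k := by
    rw [← Finset.sum_filter]
    congr 1
    ext k
    simp only [Finset.mem_filter, Finset.mem_range]
    omega
  have hsum' : ∑ k ∈ Finset.range ((j : ℕ) + 1), F k
      = -∑ k ∈ Finset.range (r - j), F (((j : ℕ) + 1 + k : ℕ) : ℤ) := by
    rw [show r + 1 = ((j : ℕ) + 1) + (r - j) by omega, Finset.sum_range_add] at hsum
    exact eq_neg_of_add_eq_zero_left hsum
  rw [hlow]
  rcases lt_or_ge (j : ℕ) m with hjm | hjm
  · have h1 : ∀ i : Fin r, blockSign m j i • F ((j : ℤ) + i + 1 - m)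
        = (fun i : ℕ => if i < m then F ((j : ℤ) + i + 1 - m) else 0) i := by
      intro i
      simp only [blockSign]
      split_ifs <;> first | omega | simp
    rw [Finset.sum_congr rfl fun i _ => h1 i,
      Fin.sum_univ_eq_sum_range (fun i : ℕ => if i < m then F ((j : ℤ) + i + 1 - m) else 0) r,
      ← Finset.sum_filter]
    -- The first `m - 1 - j` values of `i` give negative indices `k` and contribute nothing; the
    -- remaining `j + 1` give `k = 0, …, j`.
    have h2 : (Finset.range r).filter (fun i => i < m) = Finset.range ((m - 1 - j) + (j + 1)) := by
      ext k
      simp only [Finset.mem_filter, Finset.mem_range]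
      omega
    rw [h2, Finset.sum_range_add, Finset.sum_eq_zero, zero_add]
    · refine Finset.sum_congr rfl fun k _ => ?_
      congr 1
      omega
    · intro k hk
      have := Finset.mem_range.1 hk
      exact hneg _ (by omega)
  · have h1 : ∀ i : Fin r, blockSign m j i • F ((j : ℤ) + i + 1 - m)
        = (fun i : ℕ => if m ≤ i then -F ((j : ℤ) + i + 1 - m) else 0) i := by
      intro i
      simp only [blockSign]
      split_ifs <;> first | omega | simp
    -- The first `m` values of `i` lie in the zero block, the next `r - j` give `k = j + 1, …, r`,
    -- and the last `j - m` give `k > r`.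
    have h2 := sum_range_add_add (fun i : ℕ => if m ≤ i then -F ((j : ℤ) + i + 1 - m) else 0)
      m (r - j) (j - m)
    rw [show m + ((r - j) + (j - m)) = r by omega] at h2
    rw [Finset.sum_congr rfl fun i _ => h1 i,
      Fin.sum_univ_eq_sum_range (fun i : ℕ => if m ≤ i then -F ((j : ℤ) + i + 1 - m) else 0) r,
      h2, hsum', Finset.sum_eq_zero, zero_add, ← Finset.sum_neg_distrib,
      Finset.sum_eq_zero (s := Finset.range (j - m)), add_zero]
    · refine Finset.sum_congr rfl fun k _ => ?_
      rw [if_pos (by omega)]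
      congr 2
      push_cast
      ring
    · intro k hk
      rw [if_pos (by omega), hlarge _ (by push_cast; omega), neg_zero]
    · intro k hk
      rw [if_neg]
      have := Finset.mem_range.1 hk
      omega

/-- At lowest order the equation reads `p₀ y₀² = 1`, so `y₀` is invertible with inverse `p₀ y₀`.
This turns `Ring.inverse` into a genuine inverse. -/
theorem isUnit_of_quad_eq_one {r : ℕ} {U : TopologicalSpace.Opens (Fin r → ℝ)}
    {p q y : PowerSeries (DiffSeries U)} (h : quad p q y = 1) : IsUnit y := by
  have h1 := congrArg (fun f => PowerSeries.coeff 0 (PowerSeries.coeff 0 f)) h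
  simp only [coeff_zero_quad, coeff_zero_one] at h1
  rw [PowerSeries.isUnit_iff_constantCoeff, PowerSeries.isUnit_iff_constantCoeff,
    ← PowerSeries.coeff_zero_eq_constantCoeff_apply, ← PowerSeries.coeff_zero_eq_constantCoeff_apply]
  exact IsUnit.of_mul_eq_one (PowerSeries.coeff 0 (PowerSeries.coeff 0 p)
    * PowerSeries.coeff 0 (PowerSeries.coeff 0 y)) (by linear_combination h1)

section

variable {r : ℕ} {U : TopologicalSpace.Opens (Fin r → ℝ)} (a : Fin (r + 1) → ℝ)

theorem opD_apply_one {k : ℤ} (f : DiffSeries U) :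
    DiffOp.apply (opD U a k) f = 2 * wI U k * Dx U f + Dx U (wI U k) * f
      + cubicCoeff U a k * Dx U (Dx U (Dx U f)) := by
  rw [← one_smul ℝ (opD U a k), opD_apply, one_smul]

theorem opD_apply_zero (k : ℤ) : DiffOp.apply (opD U a k) 0 = 0 := by
  rw [opD_apply_one]
  simp

theorem opD_apply_neg (k : ℤ) (f : DiffSeries U) :
    DiffOp.apply (opD U a k) (-f) = -DiffOp.apply (opD U a k) f := by
  rw [opD_apply_one, opD_apply_one]
  simp only [map_neg]
  ring

theorem opD_apply_eq_zero {k : ℤ} (hk : k < 0 ∨ r < k) (f : DiffSeries U) :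
    DiffOp.apply (opD U a k) f = 0 := by
  rw [opD_apply_one, wI_eq_zero hk, cubicCoeff_eq_zero a hk]
  simp

theorem hamOp_apply (m : ℕ) (i j : Fin r) (f : DiffSeries U) :
    DiffOp.apply (hamOp U a m i j) f
      = blockSign m i j • DiffOp.apply (opD U a ((i : ℤ) + j + 1 - m)) f := by
  rw [hamOp_eq_smul, opD_apply, opD_apply_one]

theorem functional_neg (h : DiffSeries U) : functional (-h) = -functional h := by
  rw [functional, functional, map_neg, map_neg]

variable {a} {b : PowerSeries (DiffSeries U)}

/-- Only the cut at nonnegative powers of `λ` survives as the condition `k ≤ j`; the upper bound `j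
- k ≤ n` is absorbed by `coeffInt`, which vanishes at negative indices. -/
theorem laxCoeff_of_nonneg (c : PowerSeries (DiffSeries U)) {n : ℤ} (hn : 0 ≤ n) (j : ℤ) :
    laxCoeff a b c n j = ∑ k ∈ Finset.range (r + 1), if (k : ℤ) ≤ j then
      DiffOp.apply (opD U a k) (coeffInt b (n - j + k)) else 0 := by
  rw [laxCoeff]
  refine Finset.sum_congr rfl fun k _ => ?_
  rw [laxB, if_pos hn]
  by_cases hk : (k : ℤ) ≤ j
  · rw [if_pos hk, coeffInt]
    by_cases h : j - k ≤ n
    · rw [if_pos (by omega), if_pos (by omega), show n - (j - k) = n - j + k by ring]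
    · rw [if_neg (by omega), if_neg (by omega)]
  · rw [if_neg hk, if_neg (by omega), opD_apply_zero]

theorem laxCoeff_of_neg (c : PowerSeries (DiffSeries U)) {n : ℤ} (hn : n < 0) (j : ℤ) :
    laxCoeff a b c n j = ∑ k ∈ Finset.range (r + 1), if (k : ℤ) ≤ j then 0 else
      DiffOp.apply (opD U a k) (coeffInt c (j - n - k)) := by
  rw [laxCoeff]
  refine Finset.sum_congr rfl fun k _ => ?_
  rw [laxB, if_neg (by omega)]
  by_cases hk : (k : ℤ) ≤ j
  · rw [if_pos hk, if_neg (by omega), opD_apply_zero]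
  · rw [if_neg hk, coeffInt]
    by_cases h : n ≤ j - k
    · rw [if_pos (by omega), if_pos (by omega), show j - k - n = j - n - k by ring]
    · rw [if_neg (by omega), if_neg (by omega)]

/-- Below `j = 0` the partial sum is empty, and from `j = r` on it is the full sum, which vanishes
by the recursion. For `0 ≤ j < r` it is a row of `P_m` applied to the gradient. -/
theorem isFlow_of_nonneg (hb : IsPositiveSeries a b) (c : PowerSeries (DiffSeries U)) {n : ℤ}
    (hn : 0 ≤ n) :
    IsFlow a b c n (fun j => laxCoeff a b c n j) ∧ ∀ m : ℕ, m ≤ r →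
      vectorField (fun j : Fin r => laxCoeff a b c n j)
        = schouten 2 (MatDiffOp.bivector (hamOp U a m)) (hamiltonian b c (n + r - m)) := by
  have hβ := Ring.mul_inverse_cancel b (isUnit_of_quad_eq_one hb.2.2)
  have hsum : ∀ j : ℤ, ∑ k ∈ Finset.range (r + 1),
      DiffOp.apply (opD U a k) (coeffInt b (n - j + k)) = 0 := by
    intro j
    refine (Finset.sum_congr rfl fun k hk => ?_).trans
      (sum_opD_coeffInt_eq_zero (e := fun i => r - i) hb.2.2 hβ (n - j + r))
    have := Finset.mem_range.1 hk
    congr 2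
    omega
  refine ⟨fun j => ?_, fun m hm => ?_⟩
  · by_cases h : 0 ≤ j ∧ j < r
    · rw [dif_pos h]
      congr 1
      simp [h.1]
    · rw [dif_neg h, laxCoeff_of_nonneg c hn]
      by_cases hj : 0 ≤ j
      · rw [← hsum j]
        refine Finset.sum_congr rfl fun k hk => ?_
        have := Finset.mem_range.1 hk
        rw [if_pos (by omega)]
      · exact Finset.sum_eq_zero fun k _ => if_neg (by omega)
  · rw [hamiltonian, if_pos (by omega), schouten_hamOp_functional a m _ _ fun i =>
      deltaW_coeff_inverse (e := fun i => r - i) hb.2.2 hβ i _]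
    congr 1
    funext j
    rw [laxCoeff_of_nonneg c hn, ← sum_blockSign_smul
      (fun k => DiffOp.apply (opD U a k) (coeffInt b (n - j + k)))
      (fun k hk => opD_apply_eq_zero a (Or.inl hk) _)
      (fun k hk => opD_apply_eq_zero a (Or.inr hk) _) (hsum j) hm j]
    refine Finset.sum_congr rfl fun i _ => ?_
    have := i.2
    rw [hamOp_apply]
    congr 3
    omega

theorem isFlow_of_neg (b : PowerSeries (DiffSeries U)) {c : PowerSeries (DiffSeries U)}
    (hc : IsNegativeSeries a c) {n : ℤ} (hn : n < 0) :
    IsFlow a b c n (fun j => laxCoeff a b c n j) ∧ ∀ m : ℕ, m ≤ r →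
      vectorField (fun j : Fin r => laxCoeff a b c n j)
        = schouten 2 (MatDiffOp.bivector (hamOp U a m)) (hamiltonian b c (n - m)) := by
  have hβ := Ring.mul_inverse_cancel c (isUnit_of_quad_eq_one hc.2)
  have hsum : ∀ j : ℤ, ∑ k ∈ Finset.range (r + 1),
      DiffOp.apply (opD U a k) (coeffInt c (j - n - k)) = 0 :=
    fun j => sum_opD_coeffInt_eq_zero (e := fun i => i) hc.2 hβ (j - n)
  refine ⟨fun j => ?_, fun m hm => ?_⟩
  · by_cases h : 0 ≤ j ∧ j < r
    · rw [dif_pos h]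
      congr 1
      simp [h.1]
    · rw [dif_neg h, laxCoeff_of_neg c hn]
      by_cases hj : 0 ≤ j
      · refine Finset.sum_eq_zero fun k hk => ?_
        have := Finset.mem_range.1 hk
        rw [if_pos (by omega)]
      · rw [← hsum j]
        exact Finset.sum_congr rfl fun k _ => if_neg (by omega)
  · rw [hamiltonian, if_neg (by omega)]
    have hδ : ∀ i : Fin r, deltaW U i (functional
        (-(2 * PowerSeries.coeff (-1 - (n - m)).toNat (Ring.inverse c))))
        = incl U (-coeffInt c (((-1 - (n - m)).toNat : ℕ) - (i : ℕ))) := by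
      intro i
      rw [functional_neg, map_neg, map_neg,
        deltaW_coeff_inverse (e := fun i => i) hc.2 hβ i _]
    rw [schouten_hamOp_functional a m _ _ hδ]
    congr 1
    funext j
    -- The projection to negative powers keeps `k > j`, which by the recursion is minus the sum over
    -- `k ≤ j`; the sign is matched by the one in the definition of `H_n` for `n < 0`.
    have h1 : laxCoeff a b c n j = -∑ k ∈ Finset.range (r + 1), (if (k : ℤ) ≤ j then
        DiffOp.apply (opD U a k) (coeffInt c (j - n - k)) else 0) := by
      rw [eq_neg_iff_add_eq_zero, laxCoeff_of_neg c hn, ← Finset.sum_add_distrib]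
      refine (Finset.sum_congr rfl fun k _ => ?_).trans (hsum j)
      split_ifs <;> simp
    rw [h1, ← sum_blockSign_smul
      (fun k => DiffOp.apply (opD U a k) (coeffInt c (j - n - k)))
      (fun k hk => opD_apply_eq_zero a (Or.inl hk) _)
      (fun k hk => opD_apply_eq_zero a (Or.inr hk) _) (hsum j) hm j, ← Finset.sum_neg_distrib]
    refine Finset.sum_congr rfl fun i _ => ?_
    rw [hamOp_apply, opD_apply_neg, smul_neg]
    congr 4
    omega

end

end RKdVCH

end

/-! ### Assembly of the theorem. -/

theorem mainTheorem3 (r : ℕ) (hr : 0 < r) (a : Fin (r + 1) → ℝ) (ha : a ≠ 0)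
    (U : TopologicalSpace.Opens (Fin r → ℝ)) (hU : (U : Set (Fin r → ℝ)).Nonempty) :
    (∃! b : PowerSeries (RKdVCH.DiffSeries U), RKdVCH.IsPositiveSeries a b) ∧
    ((∀ w ∈ U, 0 < w ⟨0, hr⟩) → ∃! c : PowerSeries (RKdVCH.DiffSeries U),
      RKdVCH.IsNegativeSeries a c ∧ RKdVCH.HasPositiveLeadingTerm c) ∧
    ∃ P : Fin (r + 1) → RKdVCH.MatDiffOp U,
      (∀ m, P m = RKdVCH.hamOp U a m) ∧
      LinearIndependent ℝ P ∧
      (∀ m, RKdVCH.MatDiffOp.IsHamiltonian (P m)) ∧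
      (∀ m m', m ≠ m' → RKdVCH.MatDiffOp.AreCompatible (P m) (P m')) ∧
      ∀ b c : PowerSeries (RKdVCH.DiffSeries U),
        (RKdVCH.IsPositiveSeries a b → ∀ n : ℤ, 0 ≤ n →
          ∃ X : Fin r → RKdVCH.DiffSeries U, RKdVCH.IsFlow a b c n X ∧
            ∀ m : Fin (r + 1), RKdVCH.vectorField X =
              RKdVCH.schouten 2 (RKdVCH.MatDiffOp.bivector (P m.rev))
                (RKdVCH.hamiltonian b c (n + m))) ∧
        (RKdVCH.IsNegativeSeries a c → ∀ n : ℤ, n < 0 →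
          ∃ X : Fin r → RKdVCH.DiffSeries U, RKdVCH.IsFlow a b c n X ∧
            ∀ m : Fin (r + 1), RKdVCH.vectorField X =
              RKdVCH.schouten 2 (RKdVCH.MatDiffOp.bivector (P m))
                (RKdVCH.hamiltonian b c (n - m))) := by
  have hLI := RKdVCH.hamOp_linearIndependent hr hU a
  have hle : ∀ m : Fin (r + 1), (m : ℕ) ≤ r := fun m => Nat.lt_succ_iff.1 m.2
  have hH : ∀ m : Fin (r + 1), RKdVCH.MatDiffOp.IsHamiltonian (RKdVCH.hamOp U a m) :=
    fun m => ⟨RKdVCH.hamOp_isSkew a m, RKdVCH.schouten_hamOp a (hle m) (hle m)⟩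
  refine ⟨RKdVCH.existsUnique_isPositiveSeries a U, RKdVCH.existsUnique_isNegativeSeries hr a U,
    fun m => RKdVCH.hamOp U a m, fun _ => rfl, hLI, hH, fun m m' hm => ⟨?_, hH m, hH m',
      RKdVCH.schouten_hamOp a (hle m) (hle m')⟩, fun b c => ⟨fun hb n hn => ?_, fun hc n hn => ?_⟩⟩
  · have hinj : Function.Injective ![m, m'] := by
      intro x y hxy
      fin_cases x <;> fin_cases y <;> simp_all
    convert hLI.comp ![m, m'] hinj using 1
    funext x
    fin_cases x <;> rfl
  · obtain ⟨h1, h2⟩ := RKdVCH.isFlow_of_nonneg hb c hn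
    refine ⟨_, h1, fun m => ?_⟩
    have hm := hle m
    -- Reversal in `Fin (r + 1)` is `m ↦ r - m`, which turns the index `n + r - m` of
    -- `isFlow_of_nonneg` into `n + m`.
    have hrev : (m.rev : ℕ) = r - m := by rw [Fin.val_rev]; omega
    rw [h2 m.rev (hle _), show n + r - ((m.rev : ℕ) : ℤ) = n + (m : ℕ) by omega]
  · obtain ⟨h1, h2⟩ := RKdVCH.isFlow_of_neg b hc hn
    exact ⟨_, h1, fun m => h2 m (hle m)⟩
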